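/- Let $X$ be a smooth (Hausdorff, finite-dimensional) manifold, possibly with boundary, let $N\to X$ be a smooth real vector bundle and $E\to X$ a smooth complex vector bundle, both of finite rank. Let $\gamma^\perp\in\Gamma(\operatorname{End}N)$ and $\gamma^E\in\Gamma(\operatorname{End}_{\mathbb C}E)$ be smooth with $\det(\mathbb 1-\gamma^\perp_x)>0$ for every $x\in X$. Let $\nabla,\tilde\nabla$ be smooth connections on $TX$, let $\nabla^\perp,\tilde\nabla^\perp$ be smooth connections on $N$ preserved by $\gamma^\perp$ (i.e. $\nabla^\perp(\gamma^\perp\sigma)=\gamma^\perp\nabla^\perp\sigma$, and likewise for $\tilde\nabla^\perp$), and let $\nabla^E,\tilde\nabla^E$ be smooth complex-linear connections on $E$ preserved by $\gamma^E$. (The case of interest: $X$ is a component of the fixed-point set $M_\gamma$ of an isometry $\gamma$ which preserves all structures, $N=M_\gamma^\perp$ is its normal bundle, $\gamma^\perp=\mathrm d\gamma|_N$, which is orthogonal without eigenvalue $1$, and the connections are induced by $\gamma$-invariant connections on $TM$ and on the twisting bundle $E$.) For such connections with curvatures $R,R^\perp,\Omega$ put, in the algebra of complex differential forms of mixed degree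 on $X$, $$\hat A(\nabla)={\det}^{1/2}\frac{R/2}{\sinh(R/2)}=\exp\Big(\tfrac12\operatorname{Str}_{TX}\ln\frac{R/2}{\sinh(R/2)}\Big),\qquad \mathrm{ch}_\gamma(\nabla^E)=\operatorname{Str}_E\big(\gamma^E\exp(-\Omega)\big),$$ $${\det}^{-1/2}\big(\mathbb 1-\gamma^\perp\exp(-R^\perp)\big)=\exp\big(-\tfrac12\operatorname{Str}_N\ln f^\perp\big),\qquad f^\perp=\mathbb 1-\gamma^\perp\exp(-R^\perp),$$ where $\operatorname{Str}(\alpha\otimes a)=\operatorname{tr}(a)\,\alpha$ and the part of degree $0$ of $\det^{-1/2}$ is the positive root $\det(\mathbb 1-\gamma^\perp)^{-1/2}$, and let $$\mathfrak a(\nabla,\nabla^\perp,\nabla^E)=\frac{\hat A(\nabla)\wedge\mathrm{ch}_\gamma(\nabla^E)}{\det^{1/2}(\mathbb 1-\gamma^\perp\exp(-R^\perp))}.$$ Along the linear paths $\nabla_s=(1-s)\nabla+s\tilde\nabla$, $\nabla_s^\perp=(1-s)\nabla^\perp+s\tilde\nabla^\perp$, $\nabla^E_s=(1-s)\nabla^E+s\tilde\nabla^E$,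 $s\in[0,1]$, with curvatures $R_s,R_s^\perp,\Omega_s$ and $f_s^\perp=\mathbb 1-\gamma^\perp\exp(-R_s^\perp)$, define $$\mathsf T\hat A(\tilde\nabla,\nabla)=\frac12\int_0^1\hat A(\nabla_s)\wedge\operatorname{Str}_{TX}\Big(\frac{\mathrm d\nabla_s}{\mathrm ds}\,h'(R_s)\Big)\mathrm ds,\qquad h(z)=\ln\frac{z/2}{\sinh(z/2)},$$ $$\mathsf T\mathrm{ch}_\gamma(\tilde\nabla^E,\nabla^E)=-\int_0^1\operatorname{Str}_E\Big(\gamma^E\,\frac{\mathrm d\nabla^E_s}{\mathrm ds}\exp(-\Omega_s)\Big)\mathrm ds,$$ $$\mathsf T\exp\big(-\tfrac12\operatorname{Str}_N\ln f^\perp\big)=-\frac12\int_0^1\operatorname{Str}_N\Big(\frac{\mathrm d\nabla_s^\perp}{\mathrm ds}\,\frac{\mathbb 1-f_s^\perp}{f_s^\perp}\Big)\wedge\exp\big(-\tfrac12\operatorname{Str}_N\ln f_s^\perp\big)\,\mathrm ds .$$ A transgression form of a form $\alpha$ depending on connections is a smooth form $\mathsf T\alpha$ with $\alpha(\text{connections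 with tilde})-\alpha(\text{connections without tilde})=\mathrm d\,\mathsf T\alpha$. Then these three forms are transgression forms of $\hat A$, of $\mathrm{ch}_\gamma$ and of $\exp(-\frac12\operatorname{Str}_N\ln f^\perp)$, respectively, and $$\begin{aligned}\mathsf T\mathfrak a={}&\mathsf T\big(\exp(-\tfrac12\operatorname{Str}_N\ln f^\perp)\big)\wedge\hat A(\tilde\nabla)\wedge\mathrm{ch}_\gamma(\tilde\nabla^E)\\&+\exp(-\tfrac12\operatorname{Str}_N\ln f^\perp)\wedge\mathsf T\hat A(\tilde\nabla,\nabla)\wedge\mathrm{ch}_\gamma(\tilde\nabla^E)\\&+\exp(-\tfrac12\operatorname{Str}_N\ln f^\perp)\wedge\hat A(\nabla)\wedge\mathsf T\mathrm{ch}_\gamma(\tilde\nabla^E,\nabla^E)\end{aligned}$$ is a transgression form of $\mathfrak a$: it is smooth and $$\mathfrak a(\tilde\nabla,\tilde\nabla^\perp,\tilde\nabla^E)-\mathfrak a(\nabla,\nabla^\perp,\nabla^E)=\mathrm d\,\mathsf T\mathfrak a .$$ -/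

import Mathlib

open Bundle Module
open scoped Manifold ContDiff TensorProduct

namespace EquivariantTransgression

noncomputable section

/-! ### Power series evaluated at nilpotent elements -/

/-- The value `∑ₖ pₖ aᵏ` of a power series `p` at a nilpotent element `a` (a finite sum). -/
def nilEval {R A : Type*} [CommRing R] [Ring A] [Algebra R A] (p : PowerSeries R) (a : A) : A :=
  ∑ k ∈ Finset.range (nilpotencyClass a), PowerSeries.coeff k p • a ^ k

/-- The power series of `sinh (z / 2) / (z / 2) = ∑ₘ (z / 2) ^ (2 m) / (2 m + 1)!`. -/
def sinhHalfDiv : PowerSeries ℝ :=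
  PowerSeries.mk fun k => if Even k then (2 ^ k * ((k + 1).factorial : ℝ))⁻¹ else 0

/-- The power series of `ln ((z / 2) / sinh (z / 2))`. -/
def lnAHat : PowerSeries ℝ := PowerSeries.logOf sinhHalfDiv⁻¹

/-! ### Complex exterior forms on a real vector space -/

section Forms

variable (T : Type*) [AddCommGroup T] [Module ℝ T]

/-- The algebra `⋀ T* ⊗ ℂ` of complex exterior forms of mixed degree; its product is the wedge
product. -/
abbrev FormAlg := ExteriorAlgebra ℂ (T →ₗ[ℝ] ℂ)

variable {T} in
/-- The covector `v ∈ T* ⊗ ℂ` as a form of degree one. -/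
abbrev oneForm (v : T →ₗ[ℝ] ℂ) : FormAlg T := ExteriorAlgebra.ι ℂ v

variable {T} in
/-- The pullback of exterior forms under a linear map; it is an algebra homomorphism. -/
def pullbackForm {T' : Type*} [AddCommGroup T'] [Module ℝ T'] (L : T →ₗ[ℝ] T') :
    FormAlg T' →ₐ[ℂ] FormAlg T :=
  ExteriorAlgebra.map
    { toFun := fun v => v ∘ₗ L
      map_add' := fun _ _ => rfl
      map_smul' := fun _ _ => rfl }

variable [FiniteDimensional ℝ T]

/-- A basis `e₁, …, eₙ` of `T`. -/
abbrev vecBasis : Basis (Fin (finrank ℝ T)) ℝ T := finBasis ℝ T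

/-- The dual basis `e¹, …, eⁿ`, as complex-valued covectors. -/
def covec (i : Fin (finrank ℝ T)) : T →ₗ[ℝ] ℂ :=
  Complex.ofRealCLM.toLinearMap ∘ₗ (vecBasis T).coord i

/-- The covectors `e¹, …, eⁿ` form a complex basis of `T* ⊗ ℂ`. -/
def covecBasis : Basis (Fin (finrank ℝ T)) ℂ (T →ₗ[ℝ] ℂ) :=
  Basis.ofEquivFun
    { toFun := fun v i => v (vecBasis T i)
      map_add' := fun _ _ => rfl
      map_smul' := fun _ _ => rfl
      invFun := fun c => ∑ i, c i • covec T i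
      left_inv := fun v => by
        refine (vecBasis T).ext fun j => ?_
        simp [covec, Finsupp.single_apply, apply_ite]
      right_inv := fun c => by
        funext j
        simp [covec, Finsupp.single_apply, apply_ite] }

/-- The induced basis `e^{j₁} ∧ … ∧ e^{jₖ}`, `j₁ < … < jₖ`, of the algebra of exterior forms. -/
abbrev formBasis : Basis (Finset (Fin (finrank ℝ T))) ℂ (FormAlg T) :=
  (covecBasis T).ExteriorAlgebra

variable {T} in
/-- The coefficient of a form at a basis monomial. -/
def formCoeff (J : Finset (Fin (finrank ℝ T))) (α : FormAlg T) : ℂ := (formBasis T).repr α J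

variable {T} in
/-- The integral `∫₀¹ f(s) ds` of a form-valued function, coefficient by coefficient. -/
def formIntegral (f : ℝ → FormAlg T) : FormAlg T :=
  ∑ J, (∫ s in (0 : ℝ)..1, formCoeff J (f s)) • formBasis T J

end Forms

/-- The derivative at `y` (within `S`), in direction `v`, of a form-valued function on a normed
space, coefficient by coefficient. -/
def formDeriv {E : Type*} [NormedAddCommGroup E] [NormedSpace ℝ E] [FiniteDimensional ℝ E]
    (f : E → FormAlg E) (S : Set E) (y v : E) : FormAlg E :=
  ∑ J, fderivWithin ℝ (fun z => formCoeff J (f z)) S y v • formBasis E J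

/-- The exterior derivative `∑ᵢ eⁱ ∧ ∂ᵢ f` (within `S`) of a form of mixed degree on a normed
space. -/
def extDerivFlat {E : Type*} [NormedAddCommGroup E] [NormedSpace ℝ E] [FiniteDimensional ℝ E]
    (f : E → FormAlg E) (S : Set E) (y : E) : FormAlg E :=
  ∑ i, oneForm (covec E i) * formDeriv f S y (vecBasis E i)

/-! ### Endomorphism-valued forms -/

section EndForms

variable (𝕂 : Type*) [Field 𝕂] [Algebra 𝕂 ℂ] (T : Type*) [AddCommGroup T] [Module ℝ T]
  (W : Type*) [AddCommGroup W] [Module 𝕂 W]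

/-- The algebra `⋀ T* ⊗ End W` of complex exterior forms with values in the `𝕂`-linear
endomorphisms of `W` (`𝕂` is `ℝ` or `ℂ`), with product
`(α ⊗ a) (β ⊗ b) = (α ∧ β) ⊗ (a b)`. -/
abbrev EndFormAlg := FormAlg T ⊗[𝕂] Module.End 𝕂 W

variable {𝕂 T W}

/-- An endomorphism as a form of degree zero. -/
def ofEnd (a : Module.End 𝕂 W) : EndFormAlg 𝕂 T W := (1 : FormAlg T) ⊗ₜ[𝕂] a

/-- The (fibrewise) trace `α ⊗ a ↦ tr(a) α`. It is the supertrace of a bundle all of whose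
sections are even. -/
def strace : EndFormAlg 𝕂 T W →ₗ[𝕂] FormAlg T :=
  (TensorProduct.rid 𝕂 (FormAlg T)).toLinearMap ∘ₗ
    LinearMap.lTensor (FormAlg T) (LinearMap.trace 𝕂 W)

/-- The linear endomorphism that agrees with `φ` on a basis, for a map `φ` that is known to be
linear: it is `φ` itself, as a bundled linear map. -/
def endOfMap (φ : W → W) : Module.End 𝕂 W :=
  (Basis.ofVectorSpace 𝕂 W).constr 𝕂 fun a => φ (Basis.ofVectorSpace 𝕂 W a)

variable [FiniteDimensional ℝ T]

/-- The endomorphism-valued form `∑ᵢ eⁱ ⊗ A(eᵢ)` of degree one attached to a linear map `A` on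
`T` with values in the endomorphisms of `W`. -/
def endOneForm (A : T → W → W) : EndFormAlg 𝕂 T W :=
  ∑ i, oneForm (covec T i) ⊗ₜ[𝕂] endOfMap (A (vecBasis T i))

/-- The endomorphism-valued form `∑_{i<j} eⁱ ∧ eʲ ⊗ B(eᵢ, eⱼ)` of degree two attached to an
alternating bilinear map `B` on `T` with values in the endomorphisms of `W`. -/
def endTwoForm (B : T → T → W → W) : EndFormAlg 𝕂 T W :=
  ∑ i, ∑ j, if i < j then
    (oneForm (covec T i) * oneForm (covec T j)) ⊗ₜ[𝕂]
      endOfMap (B (vecBasis T i) (vecBasis T j))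
  else 0

end EndForms

/-! ### Differential forms on a manifold -/

instance tangentSpaceFinite {E : Type*} [NormedAddCommGroup E] [NormedSpace ℝ E]
    [FiniteDimensional ℝ E] {H : Type*} [TopologicalSpace H] (I : ModelWithCorners ℝ E H)
    {X : Type*} [TopologicalSpace X] [ChartedSpace H X] (x : X) :
    FiniteDimensional ℝ (TangentSpace I x) :=
  inferInstanceAs (FiniteDimensional ℝ E)

section Manifold

variable {E : Type*} [NormedAddCommGroup E] [NormedSpace ℝ E] [FiniteDimensional ℝ E]
  {H : Type*} [TopologicalSpace H] (I : ModelWithCorners ℝ E H)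
  (X : Type*) [TopologicalSpace X] [ChartedSpace H X]

/-- Complex differential forms of mixed degree on `X` (no regularity). Sums and (wedge) products
are taken pointwise. -/
abbrev DiffForm := Π x : X, FormAlg (TangentSpace I x)

variable {I X}

/-- A form in the preferred chart `φ` at `x`: the pullback of `α` under `φ⁻¹`. -/
def inChart (α : DiffForm I X) (x : X) (y : E) : FormAlg E :=
  pullbackForm (mfderivWithin 𝓘(ℝ, E) I (extChartAt I x).symm (Set.range I) y).toLinearMap
    (α ((extChartAt I x).symm y))

/-- Smoothness of a form: around every point, its coefficients in the chart are smooth. -/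
def IsSmoothForm (α : DiffForm I X) : Prop :=
  ∀ x J, ContDiffWithinAt ℝ ∞ (fun y => formCoeff J (inChart α x y)) (Set.range I)
    (extChartAt I x x)

/-- The exterior derivative: `dα = φ* d((φ⁻¹)* α)` at `x`, for the chart `φ` at `x`. -/
def dForm (α : DiffForm I X) : DiffForm I X := fun x =>
  pullbackForm (T' := E) (mfderiv I 𝓘(ℝ, E) (extChartAt I x) x).toLinearMap
    (extDerivFlat (inChart α x) (Set.range I) (extChartAt I x x))

/-- `θ` is a transgression form from `α` to `β`: it is smooth, and `β - α = dθ`. -/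
def IsTransgression (α β θ : DiffForm I X) : Prop :=
  IsSmoothForm θ ∧ β - α = dForm θ

end Manifold

/-! ### Connections, their paths and their curvature -/

section Connections

variable {E : Type*} [NormedAddCommGroup E] [NormedSpace ℝ E] [FiniteDimensional ℝ E]
  {H : Type*} [TopologicalSpace H] {I : ModelWithCorners ℝ E H}
  {X : Type*} [TopologicalSpace X] [ChartedSpace H X] [IsManifold I ∞ X]
  {F : Type*} [NormedAddCommGroup F] [NormedSpace ℝ F]
  {V : X → Type*} [TopologicalSpace (TotalSpace F V)]
  [∀ x, AddCommGroup (V x)] [∀ x, Module ℝ (V x)] [∀ x, TopologicalSpace (V x)]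
  [∀ x, IsTopologicalAddGroup (V x)] [∀ x, ContinuousSMul ℝ (V x)] [FiberBundle F V]

/-- The point `∇ₛ = (1 - s) ∇ + s ∇'` of the linear path from `∇` to `∇'`. -/
def pathConn (cov cov' : CovariantDerivative I F V) (s : ℝ) : CovariantDerivative I F V :=
  cov'.affineCombination cov fun _ => s

/-- The curvature `R(u, v) w = ∇_u ∇_v w - ∇_v ∇_u w - ∇_[u, v] w` at `x`, computed with the
extensions of `u`, `v`, `w` to smooth local sections; by tensoriality the choice of the
extensions does not matter. -/
def curvature (cov : CovariantDerivative I F V) (x : X) (u v : TangentSpace I x) (w : V x) : V x :=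
  let U : Π y : X, TangentSpace I y := FiberBundle.extend E u
  let U' : Π y : X, TangentSpace I y := FiberBundle.extend E v
  let W : Π y : X, V y := FiberBundle.extend F w
  cov (fun y => cov W y (U' y)) x u - cov (fun y => cov W y (U y)) x v
    - cov W x (VectorField.mlieBracket I U U' x)

section

variable (𝕂 : Type*) [Field 𝕂] [Algebra 𝕂 ℂ] [∀ x, Module 𝕂 (V x)]

/-- The curvature as a form of degree two with values in the `𝕂`-linear endomorphisms. -/
def curvForm (cov : CovariantDerivative I F V) (x : X) : EndFormAlg 𝕂 (TangentSpace I x) (V x) :=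
  endTwoForm (curvature cov x)

/-- The velocity `d∇ₛ/ds = ∇' - ∇` of the linear path from `∇` to `∇'`, as a form of degree one
with values in the `𝕂`-linear endomorphisms: `(∇' - ∇)_v w`, computed with an extension of `w` to
a smooth local section. -/
def velocityForm (cov cov' : CovariantDerivative I F V) (x : X) :
    EndFormAlg 𝕂 (TangentSpace I x) (V x) :=
  endOneForm fun v w => cov' (FiberBundle.extend F w) x v - cov (FiberBundle.extend F w) x v

/-- The bundle endomorphism `a` is smooth: it maps smooth sections to smooth sections. -/
def IsSmoothEnd (I : ModelWithCorners ℝ E H) (F : Type*) [NormedAddCommGroup F] [NormedSpace ℝ F]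
    {V : X → Type*} [TopologicalSpace (TotalSpace F V)]
    [∀ x, AddCommGroup (V x)] [∀ x, TopologicalSpace (V x)] [FiberBundle F V]
    [∀ x, Module 𝕂 (V x)] (a : Π x, Module.End 𝕂 (V x)) : Prop :=
  ∀ σ : Π x, V x, ContMDiff I (I.prod 𝓘(ℝ, F)) ∞ (fun x => TotalSpace.mk' F x (σ x)) →
    ContMDiff I (I.prod 𝓘(ℝ, F)) ∞ (fun x => TotalSpace.mk' F x (a x (σ x)))

variable {𝕂} in
/-- The bundle endomorphism `a` preserves the connection: `∇_v (a σ) = a (∇_v σ)` for all smooth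
sections `σ`. -/
def Preserves (a : Π x, Module.End 𝕂 (V x)) (cov : CovariantDerivative I F V) : Prop :=
  ∀ σ : Π x, V x, ContMDiff I (I.prod 𝓘(ℝ, F)) ∞ (fun x => TotalSpace.mk' F x (σ x)) →
    ∀ (x : X) (v : TangentSpace I x), cov (fun y => a y (σ y)) x v = a x (cov σ x v)

end

/-! ### The three characteristic forms -/

/-- The `Â`-form `det^{1/2} ((R/2) / sinh (R/2)) = exp (½ Str ln ((R/2) / sinh (R/2)))` of a
connection with curvature `R`. -/
def aHatForm (cov : CovariantDerivative I F V) : DiffForm I X := fun x =>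
  nilEval (PowerSeries.exp ℂ) ((1 / 2 : ℂ) • strace (nilEval lnAHat (curvForm ℝ cov x)))

/-- `f = 1 - γ exp (-R)`, where `R` is the curvature of the connection. -/
def normalF (γ : Π x, Module.End ℝ (V x)) (cov : CovariantDerivative I F V) (x : X) :
    EndFormAlg ℝ (TangentSpace I x) (V x) :=
  1 - ofEnd (γ x) * nilEval (PowerSeries.exp ℝ) (-curvForm ℝ cov x)

/-- The form `det^{-1/2} (1 - γ exp (-R)) = exp (-½ Str ln f)`, `f = 1 - γ exp (-R)`.

Here `f = f₀ u`, where `f₀ = 1 - γ` is the part of degree zero and `u = f₀⁻¹ f` is unipotent, and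
`f₀` and `u` commute when `γ` preserves the connection. Hence
`exp (-½ Str ln f) = det(f₀)^{-1/2} exp (-½ Str ln u)`, where the root of `det(f₀) > 0` is the
positive one and `ln u` is the finite sum `∑ₖ (-1)^(k+1) (u - 1)^k / k`. -/
def normalForm (γ : Π x, Module.End ℝ (V x)) (cov : CovariantDerivative I F V) : DiffForm I X :=
  fun x => ((Real.sqrt (LinearMap.det (1 - γ x)))⁻¹ : ℂ) •
    nilEval (PowerSeries.exp ℂ) ((-1 / 2 : ℂ) • strace (nilEval (PowerSeries.log ℝ)
      (Ring.inverse (ofEnd (1 - γ x)) * normalF γ cov x - 1)))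

/-- The localised Chern character form `Str (γ exp (-Ω))` of a complex bundle, where `Ω` is the
curvature of the connection. -/
def chernForm {F : Type*} [NormedAddCommGroup F] [NormedSpace ℂ F]
    {V : X → Type*} [TopologicalSpace (TotalSpace F V)]
    [∀ x, AddCommGroup (V x)] [∀ x, Module ℂ (V x)] [∀ x, TopologicalSpace (V x)]
    [∀ x, IsTopologicalAddGroup (V x)] [∀ x, ContinuousSMul ℝ (V x)] [FiberBundle F V]
    (γ : Π x, Module.End ℂ (V x)) (cov : CovariantDerivative I F V) : DiffForm I X := fun x =>
  strace (ofEnd (γ x) * nilEval (PowerSeries.exp ℂ) (-curvForm ℂ cov x))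

/-! ### The transgression forms

In each of them the first connection is the initial point `∇` (`s = 0`) and the second one the
final point `∇'` (`s = 1`) of the path `∇ₛ`. -/

/-- `½ ∫₀¹ Â(∇ₛ) Str (d∇ₛ/ds · (d/dR ln ((R/2) / sinh (R/2)))(Rₛ)) ds`. -/
def aHatTransgression (cov cov' : CovariantDerivative I F V) : DiffForm I X := fun x =>
  (1 / 2 : ℂ) • formIntegral fun s => aHatForm (pathConn cov cov' s) x *
    strace (velocityForm ℝ cov cov' x *
      nilEval (PowerSeries.derivative ℝ lnAHat) (curvForm ℝ (pathConn cov cov' s) x))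

/-- `-½ ∫₀¹ Str (d∇ₛ/ds · (1 - fₛ) / fₛ) exp (-½ Str ln fₛ) ds`, with `fₛ = 1 - γ exp (-Rₛ)`. -/
def normalTransgression (γ : Π x, Module.End ℝ (V x)) (cov cov' : CovariantDerivative I F V) :
    DiffForm I X := fun x =>
  (-1 / 2 : ℂ) • formIntegral fun s =>
    strace (velocityForm ℝ cov cov' x * ((1 - normalF γ (pathConn cov cov' s) x) *
      Ring.inverse (normalF γ (pathConn cov cov' s) x))) * normalForm γ (pathConn cov cov' s) x

/-- `-∫₀¹ Str (γ · d∇ₛ/ds · exp (-Ωₛ)) ds`. -/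
def chernTransgression {F : Type*} [NormedAddCommGroup F] [NormedSpace ℂ F]
    {V : X → Type*} [TopologicalSpace (TotalSpace F V)]
    [∀ x, AddCommGroup (V x)] [∀ x, Module ℂ (V x)] [∀ x, TopologicalSpace (V x)]
    [∀ x, IsTopologicalAddGroup (V x)] [∀ x, ContinuousSMul ℝ (V x)] [FiberBundle F V]
    (γ : Π x, Module.End ℂ (V x)) (cov cov' : CovariantDerivative I F V) : DiffForm I X := fun x =>
  -formIntegral fun s => strace (ofEnd (γ x) * velocityForm ℂ cov cov' x *
    nilEval (PowerSeries.exp ℂ) (-curvForm ℂ (pathConn cov cov' s) x))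

end Connections

/-! ### The equivariant integrand and its transgression form -/

section Integrand

variable {E : Type*} [NormedAddCommGroup E] [NormedSpace ℝ E] [FiniteDimensional ℝ E]
  {H : Type*} [TopologicalSpace H] {I : ModelWithCorners ℝ E H}
  {X : Type*} [TopologicalSpace X] [ChartedSpace H X] [IsManifold I ∞ X]
  {FN : Type*} [NormedAddCommGroup FN] [NormedSpace ℝ FN]
  {N : X → Type*} [TopologicalSpace (TotalSpace FN N)]
  [∀ x, AddCommGroup (N x)] [∀ x, Module ℝ (N x)] [∀ x, TopologicalSpace (N x)]
  [∀ x, IsTopologicalAddGroup (N x)] [∀ x, ContinuousSMul ℝ (N x)] [FiberBundle FN N]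
  {FS : Type*} [NormedAddCommGroup FS] [NormedSpace ℂ FS]
  {S : X → Type*} [TopologicalSpace (TotalSpace FS S)]
  [∀ x, AddCommGroup (S x)] [∀ x, Module ℂ (S x)] [∀ x, TopologicalSpace (S x)]
  [∀ x, IsTopologicalAddGroup (S x)] [∀ x, ContinuousSMul ℝ (S x)] [FiberBundle FS S]

/-- The equivariant integrand `𝔞 = Â(∇) ∧ ch_γ(∇^S) / det^{1/2} (1 - γ exp (-R^N))`. -/
def integrand (γN : Π x, Module.End ℝ (N x)) (γS : Π x, Module.End ℂ (S x))
    (cov : CovariantDerivative I E (TangentSpace I : X → Type _))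
    (covN : CovariantDerivative I FN N) (covS : CovariantDerivative I FS S) : DiffForm I X :=
  aHatForm cov * chernForm γS covS * normalForm γN covN

/-- The sum of three products that is the transgression form of the integrand. -/
def integrandTransgression (γN : Π x, Module.End ℝ (N x)) (γS : Π x, Module.End ℂ (S x))
    (cov cov' : CovariantDerivative I E (TangentSpace I : X → Type _))
    (covN covN' : CovariantDerivative I FN N) (covS covS' : CovariantDerivative I FS S) :
    DiffForm I X :=
  normalTransgression γN covN covN' * aHatForm cov' * chernForm γS covS'
    + normalForm γN covN * aHatTransgression cov cov' * chernForm γS covS'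
    + normalForm γN covN * aHatForm cov * chernTransgression γS covS covS'

end Integrand

end

end EquivariantTransgression

namespace EquivariantTransgression

set_option linter.unusedSectionVars false

open Filter Topology

/-! ### Power series at nilpotent elements -/

section NilEval

variable {R A B : Type*} [CommRing R] [Ring A] [Algebra R A] [Ring B] [Algebra R B]

theorem nilEval_eq_sum (p : PowerSeries R) {a : A} {n : ℕ} (h : a ^ n = 0) :
    nilEval p a = ∑ k ∈ Finset.range n, PowerSeries.coeff k p • a ^ k := by
  have hle : nilpotencyClass a ≤ n := Nat.sInf_le h
  refine Finset.sum_subset (by simpa using hle) fun k _ hk => ?_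
  have hk' : nilpotencyClass a ≤ k := by simpa using hk
  have h0 : a ^ nilpotencyClass a = 0 := pow_nilpotencyClass ⟨n, h⟩
  rw [pow_eq_zero_of_le hk' h0, smul_zero]

theorem nilEval_eq_aeval_trunc (p : PowerSeries R) {a : A} {n : ℕ} (h : a ^ n = 0) :
    nilEval p a = Polynomial.aeval a (PowerSeries.trunc n p) := by
  rw [nilEval_eq_sum p h, Polynomial.aeval_def, PowerSeries.eval₂_trunc_eq_sum_range]
  exact Finset.sum_congr rfl fun k _ => Algebra.smul_def _ _

theorem nilEval_one {a : A} (h : IsNilpotent a) : nilEval (1 : PowerSeries R) a = 1 := by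
  obtain ⟨n, hn⟩ := h
  have hn' : a ^ (n + 1) = 0 := by rw [pow_succ, hn, zero_mul]
  rw [nilEval_eq_aeval_trunc _ hn', PowerSeries.trunc_one, map_one]

theorem nilEval_add (p q : PowerSeries R) (a : A) :
    nilEval (p + q) a = nilEval p a + nilEval q a := by
  simp [nilEval, add_smul, Finset.sum_add_distrib]

theorem nilEval_X {a : A} (h : IsNilpotent a) : nilEval (PowerSeries.X : PowerSeries R) a = a := by
  obtain ⟨n, hn⟩ := h
  have hn' : a ^ (n + 2) = 0 := by rw [pow_add, hn, zero_mul]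
  rw [nilEval_eq_aeval_trunc _ hn', PowerSeries.trunc_X, Polynomial.aeval_X]

theorem nilEval_mul (p q : PowerSeries R) {a : A} (h : IsNilpotent a) :
    nilEval (p * q) a = nilEval p a * nilEval q a := by
  obtain ⟨n, hn⟩ := h
  rw [nilEval_eq_aeval_trunc _ hn, nilEval_eq_aeval_trunc p hn, nilEval_eq_aeval_trunc q hn,
    ← map_mul, ← sub_eq_zero, ← map_sub]
  have hdvd : Polynomial.X ^ n ∣ PowerSeries.trunc n (p * q)
      - PowerSeries.trunc n p * PowerSeries.trunc n q := by
    rw [Polynomial.X_pow_dvd_iff]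
    intro d hd
    rw [Polynomial.coeff_sub, PowerSeries.coeff_trunc, if_pos hd, PowerSeries.coeff_mul,
      Polynomial.coeff_mul, sub_eq_zero]
    refine Finset.sum_congr rfl fun x hx => ?_
    have hx' := Finset.HasAntidiagonal.mem_antidiagonal.1 hx
    rw [PowerSeries.coeff_trunc, PowerSeries.coeff_trunc, if_pos (by omega), if_pos (by omega)]
  obtain ⟨r, hr⟩ := hdvd
  rw [hr, map_mul, map_pow, Polynomial.aeval_X, hn, zero_mul]

theorem nilpotencyClass_map (f : A →ₐ[R] B) (hf : Function.Injective f) (a : A) :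
    nilpotencyClass (f a) = nilpotencyClass a := by
  unfold nilpotencyClass
  congr 1
  ext k
  rw [Set.mem_ofPred_eq, Set.mem_ofPred_eq, ← map_pow, map_eq_zero_iff f hf]

theorem nilEval_map (p : PowerSeries R) (f : A →ₐ[R] B) (hf : Function.Injective f) (a : A) :
    nilEval p (f a) = f (nilEval p a) := by
  unfold nilEval
  rw [nilpotencyClass_map f hf, map_sum]
  simp

theorem nilEval_exp_complex [Algebra ℝ A] [Algebra ℂ A]
    (hsmul : ∀ (r : ℝ) (a : A), (r : ℂ) • a = r • a) (a : A) :
    nilEval (PowerSeries.exp ℂ) a = nilEval (PowerSeries.exp ℝ) a := by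
  unfold nilEval
  refine Finset.sum_congr rfl fun k _ => ?_
  have h : PowerSeries.coeff k (PowerSeries.exp ℂ)
      = (PowerSeries.coeff k (PowerSeries.exp ℝ) : ℝ) := by
    simp [PowerSeries.coeff_exp]
  rw [h, hsmul]

theorem nilEval_commute (p : PowerSeries R) {a c : A} (h : Commute c a) :
    Commute c (nilEval p a) := by
  unfold nilEval
  exact Commute.sum_right _ _ _ fun k _ => (h.pow_right k).smul_right _

theorem nilEval_mem (p : PowerSeries R) (S : Subalgebra R A) {a : A} (h : a ∈ S) :
    nilEval p a ∈ S :=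
  S.sum_mem fun k _ => S.smul_mem (S.pow_mem h k) _

theorem nilEval_log_derivative_mul [Algebra ℝ A] {a : A} (h : IsNilpotent a) :
    nilEval (PowerSeries.derivative ℝ (PowerSeries.log ℝ)) a * (1 + a) = 1 := by
  have key : PowerSeries.derivative ℝ (PowerSeries.log ℝ) * (1 + PowerSeries.X) = 1 := by
    ext n
    rw [mul_add, mul_one, map_add]
    rcases n with _ | n
    · simp [PowerSeries.deriv_log]
    · rw [PowerSeries.coeff_succ_mul_X]
      simp [PowerSeries.deriv_log, PowerSeries.coeff_one, pow_succ]
  calc _ = nilEval (PowerSeries.derivative ℝ (PowerSeries.log ℝ) * (1 + PowerSeries.X)) a := by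
        rw [nilEval_mul _ _ h, nilEval_add, nilEval_one h, nilEval_X h]
    _ = 1 := by rw [key, nilEval_one h]

theorem derivative_exp_real :
    PowerSeries.derivative ℝ (PowerSeries.exp ℝ) = PowerSeries.exp ℝ := by
  ext n
  rw [PowerSeries.coeff_derivative]
  simp [PowerSeries.coeff_exp, Nat.factorial_succ]
  field_simp

end NilEval

/-! ### Graded algebras of forms and the exterior derivative on a normed space -/

section FormData

/-- An algebra with parity involution `inv` and odd elements `gen i` that commute with every
element in the graded sense. -/
structure FormData (ι A : Type*) [Ring A] [Algebra ℝ A] where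
  /-- the odd generators -/
  gen : ι → A
  /-- the parity involution -/
  inv : A →ₐ[ℝ] A
  gen_mul : ∀ i a, gen i * a = inv a * gen i
  inv_gen : ∀ i, inv (gen i) = -gen i

variable {ι : Type*} {E : Type*} [NormedAddCommGroup E] [NormedSpace ℝ E]
  {A : Type*} [NormedRing A] [NormedAlgebra ℝ A] {B : Type*} [NormedRing B] [NormedAlgebra ℝ B]

namespace FormData

/-- The exterior derivative `∑ᵢ eⁱ ∂ᵢ f` along the directions `v i`, within `S`. -/
noncomputable def d [Fintype ι] (D : FormData ι A) (v : ι → E) (S : Set E) (f : E → A) (y : E) : A :=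
  ∑ i, D.gen i * fderivWithin ℝ f S y (v i)

variable (D : FormData ι A) {D' : FormData ι B} (v : ι → E) {S : Set E} {f g : E → A} {y : E}

theorem gen_mul_gen (i j : ι) : D.gen i * D.gen j = -(D.gen j * D.gen i) := by
  rw [D.gen_mul, D.inv_gen, neg_mul]

variable [Fintype ι]

theorem d_congr (h : f =ᶠ[𝓝[S] y] g) (hy : y ∈ S) : D.d v S f y = D.d v S g y := by
  unfold d
  rw [h.fderivWithin_eq (h.self_of_nhdsWithin hy)]

theorem d_add (hS : UniqueDiffWithinAt ℝ S y) (hf : DifferentiableWithinAt ℝ f S y)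
    (hg : DifferentiableWithinAt ℝ g S y) :
    D.d v S (fun z => f z + g z) y = D.d v S f y + D.d v S g y := by
  simp only [d, fderivWithin_fun_add hS hf hg, add_apply, mul_add,
    Finset.sum_add_distrib]

theorem d_const_smul (hS : UniqueDiffWithinAt ℝ S y) (hf : DifferentiableWithinAt ℝ f S y)
    (c : ℝ) : D.d v S (fun z => c • f z) y = c • D.d v S f y := by
  simp only [d, fderivWithin_fun_const_smul hS hf, smul_apply,
    mul_smul_comm, Finset.smul_sum]

theorem d_const (c : A) : D.d v S (fun _ => c) y = 0 := by
  simp [d]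

theorem d_sum (hS : UniqueDiffWithinAt ℝ S y) {κ : Type*} (u : Finset κ) {F : κ → E → A}
    (hF : ∀ k ∈ u, DifferentiableWithinAt ℝ (F k) S y) :
    D.d v S (fun z => ∑ k ∈ u, F k z) y = ∑ k ∈ u, D.d v S (F k) y := by
  simp only [d]
  rw [fderivWithin_fun_sum hS hF, Finset.sum_comm]
  simp [Finset.mul_sum]

theorem d_mul (hS : UniqueDiffWithinAt ℝ S y) (hf : DifferentiableWithinAt ℝ f S y)
    (hg : DifferentiableWithinAt ℝ g S y) :
    D.d v S (fun z => f z * g z) y = D.d v S f y * g y + D.inv (f y) * D.d v S g y := by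
  simp only [d, fderivWithin_fun_mul' hS hf hg]
  rw [Finset.sum_mul, Finset.mul_sum, ← Finset.sum_add_distrib]
  refine Finset.sum_congr rfl fun i _ => ?_
  simp only [add_apply, smul_apply, smul_eq_mul,
    MulOpposite.smul_eq_mul_unop, MulOpposite.unop_op, mul_add]
  rw [add_comm, ← mul_assoc, ← mul_assoc, ← mul_assoc, D.gen_mul i (f y)]

theorem d_linear [FiniteDimensional ℝ A] (hS : UniqueDiffWithinAt ℝ S y) (hf : DifferentiableWithinAt ℝ f S y)
    (T : A →ₗ[ℝ] B) (hT : ∀ i a, T (D.gen i * a) = D'.gen i * T a) :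
    D'.d v S (fun z => T (f z)) y = T (D.d v S f y) := by
  have h : fderivWithin ℝ (fun z => T (f z)) S y
      = (LinearMap.toContinuousLinearMap T).comp (fderivWithin ℝ f S y) :=
    (LinearMap.toContinuousLinearMap T).hasFDerivAt.comp_hasFDerivWithinAt y
      hf.hasFDerivWithinAt |>.fderivWithin hS
  simp [d, h, hT]

theorem d_inv [FiniteDimensional ℝ A] (hS : UniqueDiffWithinAt ℝ S y) (hf : DifferentiableWithinAt ℝ f S y) :
    D.d v S (fun z => D.inv (f z)) y = -D.inv (D.d v S f y) := by
  have h : fderivWithin ℝ (fun z => D.inv (f z)) S y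
      = (LinearMap.toContinuousLinearMap D.inv.toLinearMap).comp (fderivWithin ℝ f S y) :=
    (LinearMap.toContinuousLinearMap D.inv.toLinearMap).hasFDerivAt.comp_hasFDerivWithinAt y
      hf.hasFDerivWithinAt |>.fderivWithin hS
  simp [d, h, D.inv_gen]

theorem contDiffWithinAt_d (hS : UniqueDiffOn ℝ S) (hy : y ∈ S)
    (hf : ContDiffWithinAt ℝ ∞ f S y) : ContDiffWithinAt ℝ ∞ (D.d v S f) S y := by
  have h := hf.fderivWithin_right (m := ∞) hS (by simp) hy
  unfold d
  exact ContDiffWithinAt.sum fun i _ => contDiffWithinAt_const.mul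
    (h.clm_apply contDiffWithinAt_const)

theorem d_d (hS : UniqueDiffOn ℝ S) (hy : y ∈ S) (hcl : y ∈ closure (interior S))
    (hf : ContDiffWithinAt ℝ ∞ f S y) : D.d v S (D.d v S f) y = 0 := by
  have h := (hf.fderivWithin_right (m := ∞) hS (by simp) hy).differentiableWithinAt (by simp)
  have hsymm : IsSymmSndFDerivWithinAt ℝ f S y :=
    hf.isSymmSndFDerivWithinAt (by simpa using! WithTop.coe_le_coe.2 (le_top : (2 : ℕ∞) ≤ ⊤)) hS hcl hy
  have hi : ∀ i, HasFDerivWithinAt (fun z => D.gen i * fderivWithin ℝ f S z (v i))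
      ((ContinuousLinearMap.mul ℝ A (D.gen i)).comp
        ((ContinuousLinearMap.apply ℝ A (v i)).comp (fderivWithin ℝ (fderivWithin ℝ f S) S y)))
      S y := fun i =>
    (ContinuousLinearMap.mul ℝ A (D.gen i)).hasFDerivAt.comp_hasFDerivWithinAt y
      ((ContinuousLinearMap.apply ℝ A (v i)).hasFDerivAt.comp_hasFDerivWithinAt y
        h.hasFDerivWithinAt)
  have hd : D.d v S (D.d v S f) y = ∑ j, ∑ i, D.gen j * (D.gen i *
      fderivWithin ℝ (fderivWithin ℝ f S) S y (v j) (v i)) := by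
    unfold d
    rw [(HasFDerivWithinAt.fun_sum fun i _ => hi i).fderivWithin (hS y hy)]
    simp [Finset.mul_sum]
  rw [hd]
  have hswap : (∑ j, ∑ i, D.gen j * (D.gen i *
      fderivWithin ℝ (fderivWithin ℝ f S) S y (v j) (v i))) = -∑ j, ∑ i, D.gen j * (D.gen i *
      fderivWithin ℝ (fderivWithin ℝ f S) S y (v j) (v i)) := by
    conv_lhs => rw [Finset.sum_comm]
    simp only [← Finset.sum_neg_distrib]
    refine Finset.sum_congr rfl fun i _ => Finset.sum_congr rfl fun j _ => ?_
    rw [hsymm.eq (v j) (v i), ← mul_assoc, ← mul_assoc, gen_mul_gen D j i, neg_mul]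
  have h2 := eq_neg_iff_add_eq_zero.1 hswap
  rw [← two_smul ℝ] at h2
  exact (smul_eq_zero.1 h2).resolve_left two_ne_zero

/-- The covariant exterior derivative `da + A a - inv(a) A` of the connection form `A`. -/
noncomputable def covD (α a : E → A) (y : E) : A :=
  D.d v S a y + α y * a y - D.inv (a y) * α y

/-- The curvature `dα + α²` of the connection form `α`. -/
noncomputable def curv (S : Set E) (α : E → A) (y : E) : A := D.d v S α y + α y * α y

theorem covD_mul {α : E → A} (hS : UniqueDiffWithinAt ℝ S y)
    (hf : DifferentiableWithinAt ℝ f S y) (hg : DifferentiableWithinAt ℝ g S y) :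
    D.covD v (S := S) α (fun z => f z * g z) y
      = D.covD v (S := S) α f y * g y + D.inv (f y) * D.covD v (S := S) α g y := by
  simp only [covD, D.d_mul v hS hf hg, map_mul]
  noncomm_ring

theorem inv_d_of_odd [FiniteDimensional ℝ A] {α : E → A} (hodd : ∀ z, D.inv (α z) = -α z)
    (hS : UniqueDiffWithinAt ℝ S y) (hd : DifferentiableWithinAt ℝ α S y) :
    D.inv (D.d v S α y) = D.d v S α y := by
  have h := D.d_inv v hS hd
  simp only [hodd] at h
  have h2 := D.d_const_smul v hS hd (-1)
  simp only [neg_smul, one_smul] at h2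
  rw [h2, neg_inj] at h
  exact h.symm

theorem inv_curv [FiniteDimensional ℝ A] {α : E → A} (hodd : ∀ z, D.inv (α z) = -α z)
    (hS : UniqueDiffWithinAt ℝ S y) (hd : DifferentiableWithinAt ℝ α S y) :
    D.inv (D.curv v S α y) = D.curv v S α y := by
  simp [curv, D.inv_d_of_odd v hodd hS hd, hodd]

theorem bianchi [FiniteDimensional ℝ A] {α : E → A} (hodd : ∀ z, D.inv (α z) = -α z) (hS : UniqueDiffOn ℝ S) (hy : y ∈ S)
    (hcl : y ∈ closure (interior S)) (hf : ContDiffWithinAt ℝ ∞ α S y) :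
    D.covD v (S := S) α (D.curv v S α) y = 0 := by
  have hd := hf.differentiableWithinAt (by simp)
  have hd' := (D.contDiffWithinAt_d v hS hy hf).differentiableWithinAt (by simp)
  have h1 : D.d v S (D.curv v S α) y = D.d v S α y * α y - α y * D.d v S α y := by
    unfold curv
    rw [D.d_add v (hS y hy) hd' (hd.fun_mul hd), D.d_d v hS hy hcl hf,
      D.d_mul v (hS y hy) hd hd, hodd]
    noncomm_ring
  rw [covD, h1, D.inv_curv v hodd (hS y hy) hd, curv]
  noncomm_ring

theorem curv_commute [FiniteDimensional ℝ A] {α B : E → A} (hodd : ∀ z, D.inv (α z) = -α z) (hB : ∀ z, D.inv (B z) = B z)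
    (hS : UniqueDiffOn ℝ S) (hy : y ∈ S) (hcl : y ∈ closure (interior S))
    (hf : ContDiffWithinAt ℝ ∞ α S y) (hBs : ContDiffWithinAt ℝ ∞ B S y)
    (hpar : ∀ᶠ z in 𝓝[S] y, D.covD v (S := S) α B z = 0) :
    Commute (D.curv v S α y) (B y) := by
  have hd := hf.differentiableWithinAt (by simp)
  have hBd := hBs.differentiableWithinAt (by simp)
  have hU := hS y hy
  have h1 : D.d v S B =ᶠ[𝓝[S] y] fun z => B z * α z + (-1 : ℝ) • (α z * B z) := by
    filter_upwards [hpar] with z hz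
    rw [covD, hB] at hz
    rw [neg_smul, one_smul, ← sub_eq_add_neg, ← sub_eq_zero, ← hz]
    abel
  have h2 := D.d_congr v h1 hy
  rw [D.d_d v hS hy hcl hBs, D.d_add v hU (hBd.fun_mul hd) ((hd.fun_mul hBd).fun_const_smul _),
    D.d_const_smul v hU (hd.fun_mul hBd), D.d_mul v hU hd hBd, D.d_mul v hU hBd hd, hB, hodd,
    h1.self_of_nhdsWithin hy] at h2
  rw [commute_iff_eq, curv, ← sub_eq_zero]
  rw [eq_comm, ← neg_eq_zero] at h2
  rw [← h2]
  simp only [neg_smul, one_smul]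
  noncomm_ring

end FormData

end FormData

/-! ### Families of functions that are polynomial in a real parameter -/

section PolyFamily

variable {E : Type*} [NormedAddCommGroup E] [NormedSpace ℝ E]
  {M : Type*} [NormedAddCommGroup M] [NormedSpace ℝ M]
  {M' : Type*} [NormedAddCommGroup M'] [NormedSpace ℝ M']
  {A : Type*} [NormedRing A] [NormedAlgebra ℝ A] {S : Set E} {y : E}

/-- `f s` is, near `y` within `S`, the polynomial `∑ₖ sᵏ gₖ` in `s` of degree `< n`. -/
def IsPolyOn (S : Set E) (y : E) (f : ℝ → E → M) (n : ℕ) (g : ℕ → E → M) : Prop :=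
  (∀ k, ContDiffWithinAt ℝ ∞ (g k) S y) ∧
    ∀ᶠ z in 𝓝[S] y, ∀ s, f s z = ∑ k ∈ Finset.range n, s ^ k • g k z

/-- A family of functions that is polynomial in the parameter, with smooth coefficients. -/
def PolyFamily (S : Set E) (y : E) (f : ℝ → E → M) : Prop :=
  ∃ n g, IsPolyOn S y f n g

namespace PolyFamily

theorem of_smooth {g : E → M} (hg : ContDiffWithinAt ℝ ∞ g S y) :
    PolyFamily S y (fun _ => g) :=
  ⟨1, fun _ => g, fun _ => hg, Eventually.of_forall fun z s => by simp⟩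

theorem congr {f f' : ℝ → E → M} (hf : PolyFamily S y f)
    (h : ∀ᶠ z in 𝓝[S] y, ∀ s, f' s z = f s z) : PolyFamily S y f' := by
  obtain ⟨n, g, hg, hfg⟩ := hf
  refine ⟨n, g, hg, ?_⟩
  filter_upwards [h, hfg] with z h1 h2 s
  rw [h1, h2]

theorem extend_range {X : Type*} {n m : ℕ} {g : ℕ → X → M} (hnm : n ≤ m) (s : ℝ) (z : X) :
    ∑ k ∈ Finset.range n, s ^ k • g k z
      = ∑ k ∈ Finset.range m, s ^ k • (if k < n then g k else 0) z := by
  rw [← Finset.sum_subset (Finset.range_mono hnm)]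
  · refine Finset.sum_congr rfl fun k hk => ?_
    rw [if_pos (Finset.mem_range.1 hk)]
  · intro k _ hk
    rw [if_neg (by simpa using hk)]
    simp

theorem add {f f' : ℝ → E → M} (hf : PolyFamily S y f) (hf' : PolyFamily S y f') :
    PolyFamily S y (fun s z => f s z + f' s z) := by
  obtain ⟨n, g, hg, hfg⟩ := hf
  obtain ⟨n', g', hg', hfg'⟩ := hf'
  have h0 : ContDiffWithinAt ℝ ∞ (0 : E → M) S y := contDiffWithinAt_const (c := (0 : M))
  refine ⟨max n n', fun k => (fun z => (if k < n then g k else 0) z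
    + (if k < n' then g' k else 0) z), fun k => ?_, ?_⟩
  · refine ContDiffWithinAt.add ?_ ?_
    · split_ifs
      exacts [hg k, h0]
    · split_ifs
      exacts [hg' k, h0]
  · filter_upwards [hfg, hfg'] with z h1 h2 s
    rw [h1, h2, extend_range (le_max_left n n'), extend_range (le_max_right n n'),
      ← Finset.sum_add_distrib]
    simp only [smul_add]

theorem linear {f : ℝ → E → M} (hf : PolyFamily S y f) (T : M →L[ℝ] M') :
    PolyFamily S y (fun s z => T (f s z)) := by
  obtain ⟨n, g, hg, hfg⟩ := hf
  refine ⟨n, fun k z => T (g k z), fun k => T.contDiff.comp_contDiffWithinAt (hg k), ?_⟩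
  filter_upwards [hfg] with z h1 s
  rw [h1, map_sum]
  simp

theorem const_smul {f : ℝ → E → M} (hf : PolyFamily S y f) (c : ℝ) :
    PolyFamily S y (fun s z => c • f s z) :=
  hf.linear (c • ContinuousLinearMap.id ℝ M)

theorem neg {f : ℝ → E → M} (hf : PolyFamily S y f) : PolyFamily S y (fun s z => -f s z) :=
  hf.linear (-ContinuousLinearMap.id ℝ M)

theorem param_smul {f : ℝ → E → M} (hf : PolyFamily S y f) :
    PolyFamily S y (fun s z => s • f s z) := by
  obtain ⟨n, g, hg, hfg⟩ := hf
  refine ⟨n + 1, fun k => match k with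
    | 0 => 0
    | k + 1 => g k, fun k => ?_, ?_⟩
  · rcases k with _ | k
    · exact contDiffWithinAt_const (c := (0 : M))
    · exact hg k
  · filter_upwards [hfg] with z h1 s
    rw [h1, Finset.sum_range_succ', Finset.smul_sum]
    simp [pow_succ', mul_smul]

theorem zero : PolyFamily S y (fun _ _ => (0 : M)) := of_smooth contDiffWithinAt_const

theorem sum {κ : Type*} (u : Finset κ) {f : κ → ℝ → E → M} (hf : ∀ k ∈ u, PolyFamily S y (f k)) :
    PolyFamily S y (fun s z => ∑ k ∈ u, f k s z) := by
  classical
  induction u using Finset.induction_on with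
  | empty => simpa using zero
  | insert a u ha ih =>
    simp only [Finset.sum_insert ha]
    exact (hf a (by simp)).add (ih fun k hk => hf k (by simp [hk]))

theorem param_pow_smul {f : ℝ → E → M} (hf : PolyFamily S y f) (k : ℕ) :
    PolyFamily S y (fun s z => s ^ k • f s z) := by
  induction k with
  | zero => simpa using hf
  | succ k ih => simpa [pow_succ', mul_smul] using ih.param_smul

theorem mul {f f' : ℝ → E → A} (hf : PolyFamily S y f) (hf' : PolyFamily S y f') :
    PolyFamily S y (fun s z => f s z * f' s z) := by
  obtain ⟨n, g, hg, hfg⟩ := hf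
  obtain ⟨n', g', hg', hfg'⟩ := hf'
  have key : PolyFamily S y (fun s z => ∑ k ∈ Finset.range n, ∑ l ∈ Finset.range n',
      s ^ k • s ^ l • (g k z * g' l z)) :=
    sum _ fun k _ => sum _ fun l _ =>
      ((of_smooth ((hg k).mul (hg' l))).param_pow_smul l).param_pow_smul k
  refine key.congr ?_
  filter_upwards [hfg, hfg'] with z h1 h2 s
  rw [h1, h2, Finset.sum_mul_sum]
  refine Finset.sum_congr rfl fun k _ => Finset.sum_congr rfl fun l _ => ?_
  rw [smul_mul_assoc, mul_smul_comm]

theorem smul {c : E → ℝ} (hc : ContDiffWithinAt ℝ ∞ c S y) {f : ℝ → E → M}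
    (hf : PolyFamily S y f) : PolyFamily S y (fun s z => c z • f s z) := by
  obtain ⟨n, g, hg, hfg⟩ := hf
  refine ⟨n, fun k z => c z • g k z, fun k => hc.smul (hg k), ?_⟩
  filter_upwards [hfg] with z h1 s
  rw [h1, Finset.smul_sum]
  exact Finset.sum_congr rfl fun k _ => smul_comm _ _ _

theorem pow {f : ℝ → E → A} (hf : PolyFamily S y f) (k : ℕ) :
    PolyFamily S y (fun s z => f s z ^ k) := by
  induction k with
  | zero => simpa using of_smooth contDiffWithinAt_const
  | succ k ih => simpa [pow_succ] using ih.mul hf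

theorem nilEval {f : ℝ → E → A} (hf : PolyFamily S y f) (p : PowerSeries ℝ) {m : ℕ}
    (hm : ∀ᶠ z in 𝓝[S] y, ∀ s, f s z ^ m = 0) :
    PolyFamily S y (fun s z => nilEval p (f s z)) := by
  refine (sum (Finset.range m) fun k _ => (hf.pow k).const_smul (PowerSeries.coeff k p)).congr ?_
  filter_upwards [hm] with z hz s
  exact nilEval_eq_sum p (hz s)

theorem contDiffWithinAt {f : ℝ → E → M} (hf : PolyFamily S y f) (hy : y ∈ S) (s : ℝ) :
    ContDiffWithinAt ℝ ∞ (f s) S y := by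
  obtain ⟨n, g, hg, hfg⟩ := hf
  have h : ContDiffWithinAt ℝ ∞ (fun z => ∑ k ∈ Finset.range n, s ^ k • g k z) S y :=
    ContDiffWithinAt.sum fun k _ => (hg k).const_smul _
  exact h.congr_of_eventuallyEq_of_mem (hfg.mono fun z hz => hz s) hy

theorem differentiableWithinAt {f : ℝ → E → M} (hf : PolyFamily S y f) (hy : y ∈ S) (s : ℝ) :
    DifferentiableWithinAt ℝ (f s) S y :=
  (hf.contDiffWithinAt hy s).differentiableWithinAt (by simp)

end PolyFamily

theorem IsPolyOn.d_eq {ι : Type*} [Fintype ι] (D : FormData ι A) (v : ι → E) {f : ℝ → E → A}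
    {n : ℕ} {g : ℕ → E → A} (h : IsPolyOn S y f n g) (hS : UniqueDiffOn ℝ S) (hy : y ∈ S) (s : ℝ) :
    D.d v S (f s) y = ∑ k ∈ Finset.range n, s ^ k • D.d v S (g k) y := by
  have hd : ∀ k, DifferentiableWithinAt ℝ (g k) S y := fun k =>
    (h.1 k).differentiableWithinAt (by simp)
  have h1 : f s =ᶠ[𝓝[S] y] fun z => ∑ k ∈ Finset.range n, s ^ k • g k z :=
    h.2.mono fun z hz => hz s
  rw [D.d_congr v h1 hy, D.d_sum v (hS y hy) _ fun k _ => (hd k).fun_const_smul _]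
  exact Finset.sum_congr rfl fun k _ => D.d_const_smul v (hS y hy) (hd k) _

theorem PolyFamily.d {ι : Type*} [Fintype ι] (D : FormData ι A) (v : ι → E) {f : ℝ → E → A}
    (hf : PolyFamily S y f) (hS : UniqueDiffOn ℝ S) (hy : y ∈ S) :
    PolyFamily S y (fun s => D.d v S (f s)) := by
  obtain ⟨n, g, hg, hfg⟩ := hf
  refine ⟨n, fun k => D.d v S (g k), fun k => D.contDiffWithinAt_d v hS hy (hg k), ?_⟩
  have hev : ∀ᶠ z in 𝓝[S] y, ∀ k ∈ Finset.range n, DifferentiableWithinAt ℝ (g k) S z := by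
    rw [Filter.eventually_all_finset]
    intro k _
    have := ((hg k).of_le (n := ∞) (m := 1) (by simp)).eventually (by simp)
    rw [Set.insert_eq_of_mem hy] at this
    exact this.mono fun z hz => hz.differentiableWithinAt (by simp)
  filter_upwards [hev, eventually_eventually_nhdsWithin.2 hfg, self_mem_nhdsWithin]
    with z h1 h2 hz s
  have h3 : f s =ᶠ[𝓝[S] z] fun z => ∑ k ∈ Finset.range n, s ^ k • g k z :=
    h2.mono fun z hz => hz s
  rw [D.d_congr v h3 hz, D.d_sum v (hS z hz) _ fun k hk => (h1 k hk).fun_const_smul _]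
  exact Finset.sum_congr rfl fun k hk => D.d_const_smul v (hS z hz) (h1 k hk) _

/-- If the derivative of `F` in the parameter is the exterior derivative of a polynomial family,
then `F 1 - F 0` is the exterior derivative of its integral over `[0, 1]`. -/
theorem IsPolyOn.sub_eq_d {ι : Type*} [Fintype ι] (D : FormData ι A) (v : ι → E) {f : ℝ → E → A}
    {n : ℕ} {g : ℕ → E → A} (h : IsPolyOn S y f n g) (hS : UniqueDiffOn ℝ S) (hy : y ∈ S)
    {F : ℝ → A} (hF : ∀ s, HasDerivAt F (D.d v S (f s) y) s) :
    F 1 - F 0 = D.d v S (fun z => ∑ k ∈ Finset.range n, ((k : ℝ) + 1)⁻¹ • g k z) y := by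
  have hd : ∀ k, DifferentiableWithinAt ℝ (g k) S y := fun k =>
    (h.1 k).differentiableWithinAt (by simp)
  rw [D.d_sum v (hS y hy) _ fun k _ => (hd k).fun_const_smul _]
  simp only [D.d_const_smul v (hS y hy) (hd _)]
  let G : ℝ → A := fun s =>
    ∑ k ∈ Finset.range n, (s ^ (k + 1)) • (((k : ℝ) + 1)⁻¹ • D.d v S (g k) y)
  have hG : ∀ s, HasDerivAt G (D.d v S (f s) y) s := fun s => by
    rw [h.d_eq D v hS hy s]
    refine HasDerivAt.fun_sum fun k _ => ?_
    have h1 := (hasDerivAt_pow (k + 1) s).smul_const (((k : ℝ) + 1)⁻¹ • D.d v S (g k) y)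
    convert h1 using 1
    rw [smul_smul]
    congr 1
    push_cast
    field_simp
  have hc := is_const_of_deriv_eq_zero (f := fun s => F s - G s)
    (fun s => ((hF s).sub (hG s)).differentiableAt)
    (fun s => by simpa using ((hF s).fun_sub (hG s)).deriv) 1 0
  have hG0 : G 0 = 0 := by simp [G]
  have hG1 : G 1 = ∑ k ∈ Finset.range n, ((k : ℝ) + 1)⁻¹ • D.d v S (g k) y := by simp [G]
  simp only [hG0, sub_zero] at hc
  rw [← hG1, ← hc]
  abel

end PolyFamily

/-! ### Transgression on a normed space -/

section FlatTransgression

variable {ι : Type*} {E : Type*} [NormedAddCommGroup E] [NormedSpace ℝ E]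
  {W : Type*} [NormedRing W] [NormedAlgebra ℝ W]
  {Λ : Type*} [NormedRing Λ] [NormedAlgebra ℝ Λ]

/-! #### Derivatives along a path, up to the trace -/

/-- At the parameter `s`, the curve `a` in `W` has the derivative `b R'` up to commutators: the
trace of `c a'` equals that of `c b R'` for all `c ∈ C`. -/
structure TraceDerivAt (D : FormData ι W) (tr : W →ₗ[ℝ] Λ) (C : Subalgebra ℝ W) (R' : W)
    (a : ℝ → W) (b : W) (s : ℝ) : Prop where
  mem : a s ∈ C
  mem' : b ∈ C
  even : D.inv (a s) = a s
  deriv : ∃ a', HasDerivAt a a' s ∧ ∀ c ∈ C, tr (c * a') = tr (c * b * R')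

namespace TraceDerivAt

variable {D : FormData ι W} {tr : W →ₗ[ℝ] Λ} {C : Subalgebra ℝ W} {R' : W} {a a₁ : ℝ → W}
  {b b₁ : W} {s : ℝ}

theorem const {g : W} (hg : g ∈ C) (he : D.inv g = g) :
    TraceDerivAt D tr C R' (fun _ => g) 0 s :=
  ⟨hg, C.zero_mem, he, 0, hasDerivAt_const _ _, fun c _ => by simp⟩

theorem add (h : TraceDerivAt D tr C R' a b s) (h₁ : TraceDerivAt D tr C R' a₁ b₁ s) :
    TraceDerivAt D tr C R' (fun t => a t + a₁ t) (b + b₁) s := by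
  obtain ⟨a', ha, ht⟩ := h.deriv
  obtain ⟨a₁', ha₁, ht₁⟩ := h₁.deriv
  exact ⟨C.add_mem h.mem h₁.mem, C.add_mem h.mem' h₁.mem', by rw [map_add, h.even, h₁.even],
    a' + a₁', ha.fun_add ha₁, fun c hc => by
      rw [mul_add, map_add, ht c hc, ht₁ c hc, mul_add, add_mul, map_add]⟩

theorem smul (h : TraceDerivAt D tr C R' a b s) (r : ℝ) :
    TraceDerivAt D tr C R' (fun t => r • a t) (r • b) s := by
  obtain ⟨a', ha, ht⟩ := h.deriv
  exact ⟨C.smul_mem h.mem r, C.smul_mem h.mem' r, by rw [map_smul, h.even], r • a',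
    ha.fun_const_smul r, fun c hc => by
      rw [mul_smul_comm, map_smul, ht c hc, mul_smul_comm, smul_mul_assoc, map_smul]⟩

theorem sum {κ : Type*} (u : Finset κ) {a : κ → ℝ → W} {b : κ → W}
    (h : ∀ k ∈ u, TraceDerivAt D tr C R' (a k) (b k) s) :
    TraceDerivAt D tr C R' (fun t => ∑ k ∈ u, a k t) (∑ k ∈ u, b k) s := by
  classical
  induction u using Finset.induction_on with
  | empty => simpa using const C.zero_mem (map_zero D.inv)
  | insert k u hk ih =>
    simp only [Finset.sum_insert hk]
    exact (h k (by simp)).add (ih fun l hl => h l (by simp [hl]))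

theorem mul (htr : ∀ x y, D.inv x = x → tr (x * y) = tr (y * x))
    (hC : ∀ x ∈ C, ∀ y ∈ C, x * y = y * x)
    (h : TraceDerivAt D tr C R' a b s) (h₁ : TraceDerivAt D tr C R' a₁ b₁ s) :
    TraceDerivAt D tr C R' (fun t => a t * a₁ t) (a₁ s * b + a s * b₁) s := by
  obtain ⟨a', ha, ht⟩ := h.deriv
  obtain ⟨a₁', ha₁, ht₁⟩ := h₁.deriv
  refine ⟨C.mul_mem h.mem h₁.mem, C.add_mem (C.mul_mem h₁.mem h.mem') (C.mul_mem h.mem h₁.mem'),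
    by rw [map_mul, h.even, h₁.even], _, ha.fun_mul ha₁, fun c hc => ?_⟩
  have e1 : tr (c * (a' * a₁ s)) = tr (a₁ s * c * b * R') := by
    rw [← mul_assoc, ← htr _ _ h₁.even, ← mul_assoc, ht _ (C.mul_mem h₁.mem hc)]
  have e2 : tr (c * (a s * a₁')) = tr (c * a s * b₁ * R') := by
    rw [← mul_assoc, ht₁ _ (C.mul_mem hc h.mem)]
  rw [mul_add, map_add, e1, e2, mul_add, add_mul, map_add, hC _ h₁.mem _ hc]
  simp only [mul_assoc]

theorem pow (htr : ∀ x y, D.inv x = x → tr (x * y) = tr (y * x))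
    (hC : ∀ x ∈ C, ∀ y ∈ C, x * y = y * x) (h : TraceDerivAt D tr C R' a b s) (k : ℕ) :
    TraceDerivAt D tr C R' (fun t => a t ^ (k + 1)) (((k : ℝ) + 1) • (a s ^ k * b)) s := by
  induction k with
  | zero => simpa using h
  | succ k ih =>
    have h1 := mul htr hC ih h
    simp only [← pow_succ] at h1
    convert h1 using 1
    rw [mul_smul_comm, ← mul_assoc, ← pow_succ']
    push_cast
    module

theorem nilEval (htr : ∀ x y, D.inv x = x → tr (x * y) = tr (y * x))
    (hC : ∀ x ∈ C, ∀ y ∈ C, x * y = y * x) (h : TraceDerivAt D tr C R' a b s)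
    (p : PowerSeries ℝ) {m : ℕ} (hm : ∀ t, a t ^ m = 0) :
    TraceDerivAt D tr C R' (fun t => nilEval p (a t))
      (EquivariantTransgression.nilEval (PowerSeries.derivative ℝ p) (a s) * b) s := by
  have hm' : ∀ t, a t ^ (m + 1) = 0 := fun t => by rw [pow_succ, hm, zero_mul]
  simp only [nilEval_eq_sum p (hm' _), nilEval_eq_sum _ (hm s)]
  have h1 := (sum (Finset.range m) fun k _ =>
    (pow htr hC h k).smul (PowerSeries.coeff (k + 1) p)).add
      (const (D := D) (tr := tr) (R' := R') (s := s) (C.smul_mem C.one_mem (PowerSeries.coeff 0 p))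
        (by simp))
  convert h1 using 1
  · funext t
    rw [Finset.sum_range_succ']
    simp
  · rw [add_zero, Finset.sum_mul]
    refine Finset.sum_congr rfl fun k _ => ?_
    rw [PowerSeries.coeff_derivative, smul_mul_assoc, smul_smul]

end TraceDerivAt

theorem exists_commutative_subalgebra {A : Type*} [Ring A] [Algebra ℝ A] {x y : A}
    (h : Commute x y) : ∃ C : Subalgebra ℝ A, x ∈ C ∧ y ∈ C ∧
      (∀ a ∈ C, ∀ b ∈ C, a * b = b * a) ∧
      ∀ a ∈ C, ∀ b, a * b = 1 → b * a = 1 → b ∈ C := by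
  have hT : ({x, y} : Set A) ⊆ (Subalgebra.centralizer ℝ {x, y} : Set A) := by
    intro a ha
    rw [SetLike.mem_coe, Subalgebra.mem_centralizer_iff]
    rintro b (rfl | rfl) <;> rcases ha with rfl | rfl <;> first | rfl | exact h | exact h.symm
  refine ⟨Subalgebra.centralizer ℝ (Subalgebra.centralizer ℝ {x, y}),
    Set.subset_centralizer_centralizer (by simp), Set.subset_centralizer_centralizer (by simp),
    fun a ha b hb => ?_, fun a ha b hab hba => ?_⟩
  · have hle := Subalgebra.centralizer_le (R := ℝ) _ _ hT
    exact (Subalgebra.mem_centralizer_iff ℝ).1 hb a (hle ha)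
  · rw [Subalgebra.mem_centralizer_iff] at ha ⊢
    intro g hg
    calc g * b = b * a * (g * b) := by rw [hba, one_mul]
      _ = b * (a * g) * b := by noncomm_ring
      _ = b * (g * a) * b := by rw [ha g hg]
      _ = b * g * (a * b) := by noncomm_ring
      _ = b * g := by rw [hab, mul_one]

/-! #### Parallel elements -/

variable [Fintype ι]

/-- `a` is differentiable and even at `y`, and parallel at `y` for the connection form `α`. -/
structure IsParallelAt (D : FormData ι W) (v : ι → E) (S : Set E) (y : E) (α a : E → W) :
    Prop where
  diff : DifferentiableWithinAt ℝ a S y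
  even : D.inv (a y) = a y
  covD : D.covD v (S := S) α a y = 0

namespace IsParallelAt

variable {D : FormData ι W} {v : ι → E} {S : Set E} {y : E} {α a b : E → W}

theorem one : IsParallelAt D v S y α (fun _ => 1) :=
  ⟨differentiableWithinAt_const _, map_one _, by simp [FormData.covD, D.d_const]⟩

theorem mul (hS : UniqueDiffWithinAt ℝ S y) (ha : IsParallelAt D v S y α a)
    (hb : IsParallelAt D v S y α b) : IsParallelAt D v S y α (fun z => a z * b z) :=
  ⟨ha.diff.fun_mul hb.diff, by rw [map_mul, ha.even, hb.even],
    by rw [D.covD_mul v hS ha.diff hb.diff, ha.covD, hb.covD]; simp⟩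

theorem add (hS : UniqueDiffWithinAt ℝ S y) (ha : IsParallelAt D v S y α a)
    (hb : IsParallelAt D v S y α b) : IsParallelAt D v S y α (fun z => a z + b z) :=
  ⟨ha.diff.fun_add hb.diff, by rw [map_add, ha.even, hb.even], by
    have h1 := ha.covD
    have h2 := hb.covD
    rw [FormData.covD] at h1 h2 ⊢
    rw [D.d_add v hS ha.diff hb.diff, map_add, ← add_zero (0 : W)]
    nth_rewrite 1 [← h1]
    rw [← h2]
    noncomm_ring⟩

theorem smul (hS : UniqueDiffWithinAt ℝ S y) (ha : IsParallelAt D v S y α a) (r : ℝ) :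
    IsParallelAt D v S y α (fun z => r • a z) :=
  ⟨ha.diff.fun_const_smul r, by rw [map_smul, ha.even], by
    have h1 := ha.covD
    rw [FormData.covD] at h1 ⊢
    rw [D.d_const_smul v hS ha.diff, map_smul, mul_smul_comm, smul_mul_assoc, ← smul_add,
      ← smul_sub, h1, smul_zero]⟩

theorem sum (hS : UniqueDiffWithinAt ℝ S y) {κ : Type*} (u : Finset κ) {a : κ → E → W}
    (h : ∀ k ∈ u, IsParallelAt D v S y α (a k)) :
    IsParallelAt D v S y α (fun z => ∑ k ∈ u, a k z) := by
  classical
  induction u using Finset.induction_on with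
  | empty => simpa using (one (D := D) (v := v) (S := S) (y := y) (α := α)).smul hS 0
  | insert k u hk ih =>
    simp only [Finset.sum_insert hk]
    exact (h k (by simp)).add hS (ih fun l hl => h l (by simp [hl]))

theorem pow (hS : UniqueDiffWithinAt ℝ S y) (ha : IsParallelAt D v S y α a) (k : ℕ) :
    IsParallelAt D v S y α (fun z => a z ^ k) := by
  induction k with
  | zero => simpa using one
  | succ k ih => simpa [pow_succ] using ih.mul hS ha

theorem congr (hy : y ∈ S) (ha : IsParallelAt D v S y α a) (h : b =ᶠ[𝓝[S] y] a) :
    IsParallelAt D v S y α b :=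
  ⟨ha.diff.congr_of_eventuallyEq h (h.self_of_nhdsWithin hy),
    by rw [h.self_of_nhdsWithin hy, ha.even], by
    have h1 := ha.covD
    rw [FormData.covD] at h1 ⊢
    rw [D.d_congr v h hy, h.self_of_nhdsWithin hy, h1]⟩

theorem nilEval (hS : UniqueDiffWithinAt ℝ S y) (hy : y ∈ S) (ha : IsParallelAt D v S y α a)
    (p : PowerSeries ℝ) {m : ℕ} (hm : ∀ᶠ z in 𝓝[S] y, a z ^ m = 0) :
    IsParallelAt D v S y α (fun z => nilEval p (a z)) :=
  (sum hS (Finset.range m) fun k _ => (ha.pow hS k).smul hS (PowerSeries.coeff k p)).congr hy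
    (hm.mono fun _ hz => nilEval_eq_sum p hz)

/-- The inverse of a parallel element is parallel. -/
theorem inverse (hS : UniqueDiffWithinAt ℝ S y) (ha : IsParallelAt D v S y α a)
    (hb : DifferentiableWithinAt ℝ b S y) (hy : y ∈ S)
    (hab : ∀ᶠ z in 𝓝[S] y, a z * b z = 1) (hba : b y * a y = 1) :
    IsParallelAt D v S y α b := by
  have he : D.inv (b y) = b y := by
    have h1 : a y * D.inv (b y) = 1 := by
      rw [← ha.even, ← map_mul, hab.self_of_nhdsWithin hy, map_one]
    calc D.inv (b y) = b y * (a y * D.inv (b y)) := by rw [← mul_assoc, hba, one_mul]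
      _ = b y := by rw [h1, mul_one]
  refine ⟨hb, he, ?_⟩
  have h1 : IsParallelAt D v S y α (fun z => a z * b z) := one.congr hy hab
  have h2 := h1.covD
  rw [D.covD_mul v hS ha.diff hb, ha.covD, zero_mul, zero_add, ha.even] at h2
  calc _ = b y * (a y * D.covD v (S := S) α b y) := by rw [← mul_assoc, hba, one_mul]
    _ = 0 := by rw [h2, mul_zero]

end IsParallelAt

end FlatTransgression

section TracedForms

variable {ι : Type*} {W : Type*} [Ring W] [Algebra ℝ W] {Λ : Type*} [Ring Λ] [Algebra ℝ Λ]

/-- A graded trace `tr : W → Λ` between algebras of forms; `J` and `J'` are ideals of nilpotent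
elements containing the generators. -/
structure TracedForms (D : FormData ι W) (D' : FormData ι Λ) (tr : W →ₗ[ℝ] Λ)
    (J : Submodule ℝ W) (J' : Submodule ℝ Λ) (m : ℕ) : Prop where
  tr_gen_mul : ∀ i a, tr (D.gen i * a) = D'.gen i * tr a
  tr_inv : ∀ a, tr (D.inv a) = D'.inv (tr a)
  tr_comm : ∀ a b, D.inv a = a → tr (a * b) = tr (b * a)
  tr_odd : ∀ a b, D.inv a = -a → tr (a * b) = tr (D.inv b * a)
  comm_of_even : ∀ a b : Λ, D'.inv a = a → a * b = b * a
  gen_mem : ∀ i, D.gen i ∈ J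
  mul_mem_left : ∀ a b, b ∈ J → a * b ∈ J
  mul_mem_right : ∀ a b, a ∈ J → a * b ∈ J
  pow_eq_zero : ∀ a ∈ J, a ^ m = 0
  tr_mem : ∀ a ∈ J, tr a ∈ J'
  pow_eq_zero' : ∀ a ∈ J', a ^ m = 0

end TracedForms

section FlatTransgression

variable {ι : Type*} [Fintype ι] {E : Type*} [NormedAddCommGroup E] [NormedSpace ℝ E]
  {W : Type*} [NormedRing W] [NormedAlgebra ℝ W] [FiniteDimensional ℝ W]
  {Λ : Type*} [NormedRing Λ] [NormedAlgebra ℝ Λ] [FiniteDimensional ℝ Λ]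

/-- The families `F` and `T` of forms are polynomial in the parameter, the `F s` are even and
closed at `y`, and the derivative of `F` in the parameter is `d T`. -/
structure TransgressionPair (D' : FormData ι Λ) (v : ι → E) (S : Set E) (y : E)
    (F T : ℝ → E → Λ) : Prop where
  poly : PolyFamily S y F
  poly' : PolyFamily S y T
  closed : ∀ s, D'.d v S (F s) y = 0
  even : ∀ s, D'.inv (F s y) = F s y
  deriv : ∀ s, HasDerivAt (fun t => F t y) (D'.d v S (T s) y) s

/-- A connection form `α` and a variation `θ` of it, both smooth, odd and with values in `J`. -/
structure ConnectionPath (D : FormData ι W) (J : Submodule ℝ W) (S : Set E) (y : E)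
    (α θ : E → W) : Prop where
  smooth : ContDiffWithinAt ℝ ∞ α S y
  smooth' : ContDiffWithinAt ℝ ∞ θ S y
  odd : ∀ z, D.inv (α z) = -α z
  odd' : ∀ z, D.inv (θ z) = -θ z
  mem : ∀ z, α z ∈ J
  mem' : ∀ z, θ z ∈ J

/-- The point `α + s θ` of the path of connection forms. -/
def pathForm (α θ : E → W) (s : ℝ) (z : E) : W := α z + s • θ z

/-- `γ` is smooth, even, and parallel near `y` for `α` and for `α + θ`. -/
structure ParallelEnd (D : FormData ι W) (v : ι → E) (S : Set E) (y : E) (α θ γ : E → W) :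
    Prop where
  smooth : ContDiffWithinAt ℝ ∞ γ S y
  even : ∀ z, D.inv (γ z) = γ z
  parallel : ∀ᶠ z in 𝓝[S] y, D.covD v (S := S) α γ z = 0
  parallel' : ∀ᶠ z in 𝓝[S] y, D.covD v (S := S) (fun z => α z + θ z) γ z = 0

variable {D : FormData ι W} {D' : FormData ι Λ} {tr : W →ₗ[ℝ] Λ} {J : Submodule ℝ W}
  {J' : Submodule ℝ Λ} {m : ℕ} {v : ι → E} {S : Set E} {y : E} {α θ γ : E → W}

namespace TracedForms

theorem d_tr (hT : TracedForms D D' tr J J' m) (hS : UniqueDiffWithinAt ℝ S y)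
    (hα : D.inv (α y) = -α y) {a : E → W} (ha : DifferentiableWithinAt ℝ a S y) :
    D'.d v S (fun z => tr (a z)) y = tr (D.covD v (S := S) α a y) := by
  rw [D.d_linear (D' := D') v hS ha tr hT.tr_gen_mul, FormData.covD, map_sub, map_add,
    hT.tr_odd _ _ hα, add_sub_cancel_right]

end TracedForms

theorem FormData.d_mem (D : FormData ι W) (hgen : ∀ i, D.gen i ∈ J)
    (hmul : ∀ a b, a ∈ J → a * b ∈ J) (f : E → W) (z : E) : D.d v S f z ∈ J :=
  J.sum_mem fun i _ => hmul _ _ (hgen i)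

namespace ConnectionPath

theorem pathForm_smooth (h : ConnectionPath D J S y α θ) (s : ℝ) :
    ContDiffWithinAt ℝ ∞ (pathForm α θ s) S y :=
  h.smooth.add (h.smooth'.const_smul s)

theorem pathForm_odd (h : ConnectionPath D J S y α θ) (s : ℝ) (z : E) :
    D.inv (pathForm α θ s z) = -pathForm α θ s z := by
  rw [pathForm, map_add, map_smul, h.odd, h.odd', smul_neg, ← neg_add]

theorem pathForm_diff (h : ConnectionPath D J S y α θ) (s : ℝ) :
    DifferentiableWithinAt ℝ (pathForm α θ s) S y :=
  (h.pathForm_smooth s).differentiableWithinAt (by simp)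

theorem diff' (h : ConnectionPath D J S y α θ) : DifferentiableWithinAt ℝ θ S y :=
  h.smooth'.differentiableWithinAt (by simp)

theorem polyFamily_curv (h : ConnectionPath D J S y α θ) (hS : UniqueDiffOn ℝ S) (hy : y ∈ S) :
    PolyFamily S y (fun s => D.curv v S (pathForm α θ s)) := by
  have h1 : PolyFamily S y (pathForm α θ) :=
    (PolyFamily.of_smooth h.smooth).add (PolyFamily.of_smooth h.smooth').param_smul
  exact (h1.d D v hS hy).add (h1.mul h1)

theorem curv_mem (hT : TracedForms D D' tr J J' m) (h : ConnectionPath D J S y α θ) (s : ℝ)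
    (z : E) : D.curv v S (pathForm α θ s) z ∈ J :=
  J.add_mem (D.d_mem hT.gen_mem hT.mul_mem_right _ z)
    (hT.mul_mem_left _ _ (J.add_mem (h.mem z) (J.smul_mem s (h.mem' z))))

theorem hasDerivAt_curv (h : ConnectionPath D J S y α θ) (hS : UniqueDiffOn ℝ S) (hy : y ∈ S)
    (s : ℝ) : HasDerivAt (fun t => D.curv v S (pathForm α θ t) y)
      (D.covD v (S := S) (pathForm α θ s) θ y) s := by
  have h1 : HasDerivAt (fun t : ℝ => pathForm α θ t y) (θ y) s := by
    simpa [pathForm] using ((hasDerivAt_id s).smul_const (θ y)).const_add (α y)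
  have h2 : ∀ t, D.d v S (pathForm α θ t) y = D.d v S α y + t • D.d v S θ y := fun t => by
    unfold pathForm
    rw [D.d_add v (hS y hy) (h.smooth.differentiableWithinAt (by simp)) (h.diff'.fun_const_smul _),
      D.d_const_smul v (hS y hy) h.diff']
  have h3 : HasDerivAt (fun t : ℝ => D.d v S (pathForm α θ t) y) (D.d v S θ y) s := by
    simp only [h2]
    simpa using ((hasDerivAt_id s).smul_const (D.d v S θ y)).const_add (D.d v S α y)
  refine HasDerivAt.congr_deriv (h3.fun_add (h1.fun_mul h1)) ?_
  unfold FormData.covD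
  rw [h.odd']
  noncomm_ring

theorem parallel_curv (h : ConnectionPath D J S y α θ) (hS : UniqueDiffOn ℝ S) (hy : y ∈ S)
    (hcl : y ∈ closure (interior S)) (s : ℝ) :
    IsParallelAt D v S y (pathForm α θ s) (D.curv v S (pathForm α θ s)) :=
  ⟨(h.polyFamily_curv hS hy).differentiableWithinAt hy s,
    D.inv_curv v (h.pathForm_odd s) (hS y hy) (h.pathForm_diff s),
    D.bianchi v (h.pathForm_odd s) hS hy hcl (h.pathForm_smooth s)⟩

end ConnectionPath

namespace ParallelEnd

theorem covD_eq_zero (hγ : ParallelEnd D v S y α θ γ)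
    (s : ℝ) : ∀ᶠ z in 𝓝[S] y, D.covD v (S := S) (pathForm α θ s) γ z = 0 := by
  filter_upwards [hγ.parallel, hγ.parallel'] with z h1 h2
  have h3 : D.covD v (S := S) (pathForm α θ s) γ z
      = (1 - s) • D.covD v (S := S) α γ z
        + s • D.covD v (S := S) (fun z => α z + θ z) γ z := by
    simp only [FormData.covD, pathForm, add_mul, mul_add, smul_mul_assoc, mul_smul_comm]
    module
  rw [h3, h1, h2]
  simp

theorem parallelAt (hγ : ParallelEnd D v S y α θ γ) (hy : y ∈ S)
    (s : ℝ) : IsParallelAt D v S y (pathForm α θ s) γ :=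
  ⟨hγ.smooth.differentiableWithinAt (by simp), hγ.even y,
    (hγ.covD_eq_zero s).self_of_nhdsWithin hy⟩

theorem commute (hγ : ParallelEnd D v S y α θ γ) (hα : ConnectionPath D J S y α θ)
    (hS : UniqueDiffOn ℝ S) (hy : y ∈ S) (hcl : y ∈ closure (interior S)) (s : ℝ) :
    Commute (D.curv v S (pathForm α θ s) y) (γ y) :=
  D.curv_commute v (hα.pathForm_odd s) hγ.even hS hy hcl (hα.pathForm_smooth s) hγ.smooth
    (hγ.covD_eq_zero s)

end ParallelEnd

/-- Transgression of the trace of a function `a` of the curvature with derivative `b`. -/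
theorem transgressionPair_tr (hT : TracedForms D D' tr J J' m) (hα : ConnectionPath D J S y α θ)
    (hS : UniqueDiffOn ℝ S) (hy : y ∈ S) {a b : ℝ → E → W} (ha : PolyFamily S y a)
    (hb : PolyFamily S y b) (hpa : ∀ s, IsParallelAt D v S y (pathForm α θ s) (a s))
    (hpb : ∀ s, IsParallelAt D v S y (pathForm α θ s) (b s))
    (hder : ∀ s, ∃ C, TraceDerivAt D tr C (D.covD v (S := S) (pathForm α θ s) θ y)
      (fun t => a t y) (b s y) s) :
    TransgressionPair D' v S y (fun s z => tr (a s z)) (fun s z => tr (θ z * b s z)) where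
  poly := ha.linear (LinearMap.toContinuousLinearMap tr)
  poly' := ((PolyFamily.of_smooth hα.smooth').mul hb).linear (LinearMap.toContinuousLinearMap tr)
  closed s := by
    rw [hT.d_tr (hS y hy) (hα.pathForm_odd s y) (hpa s).diff, (hpa s).covD, map_zero]
  even s := by rw [← hT.tr_inv, (hpa s).even]
  deriv s := by
    obtain ⟨C, hC⟩ := hder s
    obtain ⟨a', ha', ht⟩ := hC.deriv
    have h1 := (LinearMap.toContinuousLinearMap tr).hasFDerivAt.comp_hasDerivAt s ha'
    refine HasDerivAt.congr_deriv h1 ?_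
    rw [hT.d_tr (hS y hy) (hα.pathForm_odd s y) (hα.diff'.fun_mul (hpb s).diff),
      D.covD_mul v (hS y hy) hα.diff' (hpb s).diff, (hpb s).covD, mul_zero, add_zero,
      ← hT.tr_comm _ _ (hpb s).even]
    have h2 := ht 1 C.one_mem
    rw [one_mul, one_mul] at h2
    exact h2

theorem TransgressionPair.congr {F T T' : ℝ → E → Λ} (h : TransgressionPair D' v S y F T)
    (hy : y ∈ S) (hT : ∀ᶠ z in 𝓝[S] y, ∀ s, T' s z = T s z) : TransgressionPair D' v S y F T' where
  poly := h.poly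
  poly' := h.poly'.congr hT
  closed := h.closed
  even := h.even
  deriv s := by
    rw [D'.d_congr v (hT.mono fun z hz => hz s) hy]
    exact h.deriv s

theorem FormData.covD_zero (D : FormData ι W) (a : E → W) (z : E) :
    D.covD v (S := S) (fun _ => 0) a z = D.d v S a z := by
  simp [FormData.covD]

/-- Transgression of the exponential of an even form, multiplied with a constant. -/
theorem TransgressionPair.exp {F T : ℝ → E → Λ} (h : TransgressionPair D' v S y F T)
    (hcomm : ∀ a b : Λ, D'.inv a = a → a * b = b * a)
    (hJ' : ∀ a ∈ J', a ^ m = 0) (hF : ∀ᶠ z in 𝓝[S] y, ∀ s, F s z ∈ J') (hS : UniqueDiffOn ℝ S) (hy : y ∈ S)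
    (c : ℝ) {κ : E → ℝ} (hκ : ContDiffWithinAt ℝ ∞ κ S y) (hκ' : fderivWithin ℝ κ S y = 0) :
    TransgressionPair D' v S y
      (fun s z => κ z • nilEval (PowerSeries.exp ℝ) (c • F s z))
      (fun s z => c • (T s z * (κ z • nilEval (PowerSeries.exp ℝ) (c • F s z)))) := by
  have hnil : ∀ᶠ z in 𝓝[S] y, ∀ s, (c • F s z) ^ m = 0 :=
    hF.mono fun z hz s => hJ' _ (J'.smul_mem c (hz s))
  have hpol := h.poly.const_smul c
  have hG : PolyFamily S y (fun s z => nilEval (PowerSeries.exp ℝ) (c • F s z)) :=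
    hpol.nilEval _ hnil
  have hU := hS y hy
  have hpar : ∀ s, IsParallelAt D' v S y (fun _ => 0)
      (fun z => nilEval (PowerSeries.exp ℝ) (c • F s z)) := fun s => by
    refine IsParallelAt.nilEval hU hy ?_ _ (hnil.mono fun z hz => hz s)
    refine IsParallelAt.smul hU ?_ c
    exact ⟨h.poly.differentiableWithinAt hy s, h.even s,
      by rw [FormData.covD_zero, h.closed s]⟩
  have hκpar : ∀ s, D'.d v S (fun z => κ z • nilEval (PowerSeries.exp ℝ) (c • F s z)) y = 0 := by
    intro s
    have h1 := (hpar s).covD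
    rw [FormData.covD_zero] at h1
    have hd : fderivWithin ℝ (fun z => κ z • nilEval (PowerSeries.exp ℝ) (c • F s z)) S y
        = κ y • fderivWithin ℝ (fun z => nilEval (PowerSeries.exp ℝ) (c • F s z)) S y := by
      rw [fderivWithin_fun_smul hU (hκ.differentiableWithinAt (by simp)) (hpar s).diff, hκ']
      ext
      simp
    unfold FormData.d at h1 ⊢
    rw [hd]
    simp only [smul_apply, mul_smul_comm, ← Finset.smul_sum]
    rw [h1, smul_zero]
  have heven : ∀ s, D'.inv (κ y • nilEval (PowerSeries.exp ℝ) (c • F s y))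
      = κ y • nilEval (PowerSeries.exp ℝ) (c • F s y) := fun s => by
    rw [map_smul, (hpar s).even]
  refine ⟨hG.smul hκ, (h.poly'.mul (hG.smul hκ)).const_smul c, hκpar, heven, fun s => ?_⟩
  have hTd : DifferentiableWithinAt ℝ (T s) S y := h.poly'.differentiableWithinAt hy s
  have hKd := (hG.smul hκ).differentiableWithinAt hy s
  rw [D'.d_const_smul v hU (hTd.fun_mul hKd), D'.d_mul v hU hTd hKd, hκpar s, mul_zero, add_zero]
  obtain ⟨C, hxC, -, hCcomm, -⟩ := exists_commutative_subalgebra (Commute.refl (c • F s y))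
  have hev : D'.inv (c • F s y) = c • F s y := by rw [map_smul, h.even]
  have hbase : TraceDerivAt D' (LinearMap.id : Λ →ₗ[ℝ] Λ) C (c • D'.d v S (T s) y)
      (fun t => c • F t y) 1 s :=
    ⟨hxC, C.one_mem, hev, _, (h.deriv s).fun_const_smul c, fun d _ => by simp⟩
  obtain ⟨a', ha', ht⟩ := (hbase.nilEval (fun a b => hcomm a b) hCcomm (PowerSeries.exp ℝ)
    fun t => hnil.self_of_nhdsWithin hy t).deriv
  have h2 := ht 1 C.one_mem
  rw [derivative_exp_real] at h2
  simp only [LinearMap.id_apply, one_mul, mul_one] at h2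
  have h3 := ha'.fun_const_smul (κ y)
  refine h3.congr_deriv ?_
  rw [h2, ← hcomm _ _ (heven s), smul_mul_assoc, mul_smul_comm, smul_comm]

end FlatTransgression

section FlatTransgression

variable {ι : Type*} [Fintype ι] {E : Type*} [NormedAddCommGroup E] [NormedSpace ℝ E]
  {W : Type*} [NormedRing W] [NormedAlgebra ℝ W] [FiniteDimensional ℝ W]
  {Λ : Type*} [NormedRing Λ] [NormedAlgebra ℝ Λ] [FiniteDimensional ℝ Λ]
  {D : FormData ι W} {D' : FormData ι Λ} {tr : W →ₗ[ℝ] Λ} {J : Submodule ℝ W}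
  {J' : Submodule ℝ Λ} {m : ℕ} {v : ι → E} {S : Set E} {y : E} {α θ γ : E → W}

theorem inv_nilEval (D : FormData ι W) (p : PowerSeries ℝ) {a : W} (ha : D.inv a = a) :
    D.inv (nilEval p a) = nilEval p a :=
  nilEval_mem p (AlgHom.equalizer D.inv (AlgHom.id ℝ W)) ha

theorem TracedForms.nilEval_mem (hT : TracedForms D D' tr J J' m) {p : PowerSeries ℝ}
    (hp : PowerSeries.constantCoeff p = 0) {a : W} (ha : a ∈ J) : nilEval p a ∈ J := by
  have hm : a ^ (m + 1) = 0 := by rw [pow_succ, hT.pow_eq_zero a ha, zero_mul]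
  rw [nilEval_eq_sum p hm, Finset.sum_range_succ']
  simp only [PowerSeries.coeff_zero_eq_constantCoeff, hp, zero_smul, add_zero]
  exact J.sum_mem fun k _ => J.smul_mem _ (by rw [pow_succ]; exact hT.mul_mem_left _ _ ha)

theorem TracedForms.isNilpotent (hT : TracedForms D D' tr J J' m) {a : W} (ha : a ∈ J) :
    IsNilpotent a := ⟨m, hT.pow_eq_zero a ha⟩

theorem TracedForms.nilEval_exp_sub_one_mem (hT : TracedForms D D' tr J J' m) {a : W}
    (ha : a ∈ J) : nilEval (PowerSeries.exp ℝ) a - 1 ∈ J := by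
  have h := hT.nilEval_mem (p := PowerSeries.exp ℝ - 1) (by simp) ha
  have h1 := nilEval_add (PowerSeries.exp ℝ - 1) 1 a
  rw [sub_add_cancel, nilEval_one (hT.isNilpotent ha)] at h1
  rwa [h1, add_sub_cancel_right]

namespace ConnectionPath

theorem eventually_even_curv (h : ConnectionPath D J S y α θ) (hS : UniqueDiffOn ℝ S)
    (hy : y ∈ S) : ∀ᶠ z in 𝓝[S] y, ∀ s,
      D.inv (D.curv v S (pathForm α θ s) z) = D.curv v S (pathForm α θ s) z := by
  have hev : ∀ {f : E → W}, ContDiffWithinAt ℝ ∞ f S y →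
      ∀ᶠ z in 𝓝[S] y, DifferentiableWithinAt ℝ f S z := fun {f} hf => by
    have := (hf.of_le (n := ∞) (m := 1) (by simp)).eventually (by simp)
    rw [Set.insert_eq_of_mem hy] at this
    exact this.mono fun z hz => hz.differentiableWithinAt (by simp)
  filter_upwards [hev h.smooth, hev h.smooth', self_mem_nhdsWithin] with z h1 h2 hz s
  exact D.inv_curv v (h.pathForm_odd s) (hS z hz) (h1.fun_add (h2.fun_const_smul s))

theorem traceDerivAt_curv (h : ConnectionPath D J S y α θ) (hS : UniqueDiffOn ℝ S)
    (hy : y ∈ S) (s : ℝ) {C : Subalgebra ℝ W} (hC : D.curv v S (pathForm α θ s) y ∈ C) :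
    TraceDerivAt D tr C (D.covD v (S := S) (pathForm α θ s) θ y)
      (fun t => D.curv v S (pathForm α θ t) y) 1 s :=
  ⟨hC, C.one_mem, (h.eventually_even_curv hS hy).self_of_nhdsWithin hy s, _,
    h.hasDerivAt_curv hS hy s, fun c _ => by rw [mul_one]⟩

end ConnectionPath

/-- Transgression of `exp (c tr p(R))`, for a power series `p` without constant term. -/
theorem transgressionPair_exp_tr (hT : TracedForms D D' tr J J' m)
    (hα : ConnectionPath D J S y α θ) (hS : UniqueDiffOn ℝ S) (hy : y ∈ S)
    (hcl : y ∈ closure (interior S)) {p : PowerSeries ℝ} (hp : PowerSeries.constantCoeff p = 0)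
    (c : ℝ) :
    TransgressionPair D' v S y
      (fun s z => nilEval (PowerSeries.exp ℝ)
        (c • tr (nilEval p (D.curv v S (pathForm α θ s) z))))
      (fun s z => c • (nilEval (PowerSeries.exp ℝ)
        (c • tr (nilEval p (D.curv v S (pathForm α θ s) z))) *
          tr (θ z * nilEval (PowerSeries.derivative ℝ p) (D.curv v S (pathForm α θ s) z)))) := by
  have hmem : ∀ s z, D.curv v S (pathForm α θ s) z ∈ J := hα.curv_mem hT
  have hm : ∀ᶠ z in 𝓝[S] y, ∀ s, D.curv v S (pathForm α θ s) z ^ m = 0 :=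
    Eventually.of_forall fun z s => hT.pow_eq_zero _ (hmem s z)
  have hpol := hα.polyFamily_curv (v := v) hS hy
  have hpar := hα.parallel_curv (v := v) hS hy hcl
  have h1 := transgressionPair_tr (v := v) hT hα hS hy (hpol.nilEval p hm)
    (hpol.nilEval (PowerSeries.derivative ℝ p) hm)
    (fun s => (hpar s).nilEval (hS y hy) hy p (hm.mono fun z hz => hz s))
    (fun s => (hpar s).nilEval (hS y hy) hy _ (hm.mono fun z hz => hz s))
    (fun s => by
      obtain ⟨C, hC, -, hcomm, -⟩ :=
        exists_commutative_subalgebra (Commute.refl (D.curv v S (pathForm α θ s) y))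
      refine ⟨C, ?_⟩
      have h := (hα.traceDerivAt_curv (tr := tr) hS hy s hC).nilEval hT.tr_comm hcomm p
        (fun t => hT.pow_eq_zero _ (hmem t y))
      rwa [mul_one] at h)
  have h2 := h1.exp (J' := J') hT.comm_of_even hT.pow_eq_zero'
    (Eventually.of_forall fun z s => hT.tr_mem _ (hT.nilEval_mem hp (hmem s z))) hS hy c
    (κ := fun _ => 1) contDiffWithinAt_const (by simp)
  simp only [one_smul] at h2
  refine h2.congr hy ?_
  filter_upwards [hα.eventually_even_curv (v := v) hS hy] with z hz s
  congr 1
  refine hT.comm_of_even _ _ (inv_nilEval D' _ ?_)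
  rw [map_smul, ← hT.tr_inv, inv_nilEval D _ (hz s)]

/-- Transgression of `tr (γ exp (-R))`. -/
theorem transgressionPair_tr_exp (hT : TracedForms D D' tr J J' m)
    (hα : ConnectionPath D J S y α θ) (hγ : ParallelEnd D v S y α θ γ) (hS : UniqueDiffOn ℝ S)
    (hy : y ∈ S) (hcl : y ∈ closure (interior S)) :
    TransgressionPair D' v S y
      (fun s z => tr (γ z * nilEval (PowerSeries.exp ℝ) (-D.curv v S (pathForm α θ s) z)))
      (fun s z => -tr (γ z * θ z *
        nilEval (PowerSeries.exp ℝ) (-D.curv v S (pathForm α θ s) z))) := by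
  have hmem : ∀ s z, -D.curv v S (pathForm α θ s) z ∈ J := fun s z =>
    J.neg_mem (hα.curv_mem hT s z)
  have hm : ∀ᶠ z in 𝓝[S] y, ∀ s, (-D.curv v S (pathForm α θ s) z) ^ m = 0 :=
    Eventually.of_forall fun z s => hT.pow_eq_zero _ (hmem s z)
  have hpol := (hα.polyFamily_curv (v := v) hS hy).neg
  have hpar : ∀ s, IsParallelAt D v S y (pathForm α θ s)
      (fun z => -D.curv v S (pathForm α θ s) z) := fun s => by
    simpa using (hα.parallel_curv (v := v) hS hy hcl s).smul (hS y hy) (-1)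
  have hpolγ := PolyFamily.of_smooth (S := S) (y := y) hγ.smooth
  have hpare := fun s => (hpar s).nilEval (hS y hy) hy (PowerSeries.exp ℝ) (hm.mono fun z hz => hz s)
  have h1 := transgressionPair_tr (v := v) hT hα hS hy
    (hpolγ.mul (hpol.nilEval (PowerSeries.exp ℝ) hm))
    (((hpol.nilEval (PowerSeries.exp ℝ) hm).mul hpolγ).const_smul (-1))
    (fun s => (hγ.parallelAt hy s).mul (hS y hy) (hpare s))
    (fun s => ((hpare s).mul (hS y hy) (hγ.parallelAt hy s)).smul (hS y hy) (-1))
    (fun s => by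
      have hc := hγ.commute hα hS hy hcl s
      obtain ⟨C, hC, hCγ, hcomm, -⟩ := exists_commutative_subalgebra hc
      refine ⟨C, ?_⟩
      have h := (((hα.traceDerivAt_curv (tr := tr) hS hy s hC).smul (-1)).nilEval hT.tr_comm hcomm
        (PowerSeries.exp ℝ) (m := m) (fun t => by simpa using hT.pow_eq_zero _ (hmem t y)))
      have h' := (TraceDerivAt.const hCγ (hγ.even y)).mul hT.tr_comm hcomm h
      simp only [neg_smul, one_smul, derivative_exp_real, mul_zero, zero_add, mul_neg,
        mul_one] at h'
      rw [neg_smul, one_smul, (nilEval_commute (PowerSeries.exp ℝ) hc.symm.neg_right).eq.symm]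
      exact h')
  refine h1.congr hy (Eventually.of_forall fun z s => ?_)
  rw [mul_assoc, hT.tr_comm _ _ (hγ.even z), neg_smul, one_smul, mul_neg, map_neg, mul_assoc]

theorem TracedForms.unipotent_mem (hT : TracedForms D D' tr J J' m) {g R : W} (hg : IsUnit (1 - g))
    (hR : R ∈ J) :
    Ring.inverse (1 - g) * (1 - g * nilEval (PowerSeries.exp ℝ) (-R)) - 1 ∈ J := by
  have h1 : Ring.inverse (1 - g) * (1 - g * nilEval (PowerSeries.exp ℝ) (-R)) - 1
      = (-(Ring.inverse (1 - g) * g)) * (nilEval (PowerSeries.exp ℝ) (-R) - 1) := by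
    calc _ = Ring.inverse (1 - g) * (1 - g * nilEval (PowerSeries.exp ℝ) (-R))
          - Ring.inverse (1 - g) * (1 - g) := by rw [Ring.inverse_mul_cancel _ hg]
      _ = _ := by noncomm_ring
  rw [h1]
  exact hT.mul_mem_left _ _ (hT.nilEval_exp_sub_one_mem (J.neg_mem hR))

theorem inverse_one_sub_eq {g f n q : W} (hg : IsUnit (1 - g))
    (hn : n = Ring.inverse (1 - g) * f - 1) (hq : q * (1 + n) = 1) (hq' : Commute q n) :
    f * (q * Ring.inverse (1 - g)) = 1 ∧ (q * Ring.inverse (1 - g)) * f = 1 := by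
  have h1 : 1 + n = Ring.inverse (1 - g) * f := by rw [hn]; abel
  have h2 : f = (1 - g) * (1 + n) := by rw [h1, ← mul_assoc, Ring.mul_inverse_cancel _ hg, one_mul]
  have h3 : (1 + n) * q = 1 := by
    rw [add_mul, ← hq'.eq, one_mul, ← hq, mul_add, mul_one]
  constructor
  · rw [h2, ← mul_assoc, mul_assoc (1 - g), h3, mul_one, Ring.mul_inverse_cancel _ hg]
  · rw [mul_assoc, ← h1, hq]

/-- Transgression of `κ exp (c tr ln f)`, where `f = 1 - γ exp (-R) = (1 - γ) u` and the logarithm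
is that of the unipotent factor `u`. -/
theorem transgressionPair_exp_tr_log (hT : TracedForms D D' tr J J' m)
    (hα : ConnectionPath D J S y α θ) (hγ : ParallelEnd D v S y α θ γ) (hS : UniqueDiffOn ℝ S)
    (hy : y ∈ S) (hcl : y ∈ closure (interior S)) (hunit : ∀ᶠ z in 𝓝[S] y, IsUnit (1 - γ z))
    (c : ℝ) {κ : E → ℝ} (hκ : ContDiffWithinAt ℝ ∞ κ S y) (hκ' : fderivWithin ℝ κ S y = 0)
    {f : ℝ → E → W} (hf : ∀ s z, f s z = 1 - γ z *
      nilEval (PowerSeries.exp ℝ) (-D.curv v S (pathForm α θ s) z)) :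
    TransgressionPair D' v S y
      (fun s z => κ z • nilEval (PowerSeries.exp ℝ) (c • tr (nilEval (PowerSeries.log ℝ)
        (Ring.inverse (1 - γ z) * f s z - 1))))
      (fun s z => c • (tr (θ z * ((1 - f s z) * Ring.inverse (f s z))) *
        (κ z • nilEval (PowerSeries.exp ℝ) (c • tr (nilEval (PowerSeries.log ℝ)
          (Ring.inverse (1 - γ z) * f s z - 1)))))) := by
  have : CompleteSpace W := FiniteDimensional.complete ℝ W
  have hU := hS y hy
  have hmem : ∀ s z, -D.curv v S (pathForm α θ s) z ∈ J := fun s z =>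
    J.neg_mem (hα.curv_mem hT s z)
  have hm : ∀ᶠ z in 𝓝[S] y, ∀ s, (-D.curv v S (pathForm α θ s) z) ^ m = 0 :=
    Eventually.of_forall fun z s => hT.pow_eq_zero _ (hmem s z)
  have hpol := (hα.polyFamily_curv (v := v) hS hy).neg
  have hpar : ∀ s, IsParallelAt D v S y (pathForm α θ s)
      (fun z => -D.curv v S (pathForm α θ s) z) := fun s => by
    simpa using (hα.parallel_curv (v := v) hS hy hcl s).smul hU (-1)
  have hpolγ := PolyFamily.of_smooth (S := S) (y := y) hγ.smooth
  have hone := PolyFamily.of_smooth (S := S) (y := y) (contDiffWithinAt_const (c := (1 : W)))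
  -- the inverse of `1 - γ`
  have hinv : ContDiffWithinAt ℝ ∞ (fun z => Ring.inverse (1 - γ z)) S y := by
    obtain ⟨u, hu⟩ := hunit.self_of_nhdsWithin hy
    have h1 := contDiffAt_ringInverse ℝ (n := ∞) u
    rw [hu] at h1
    exact h1.comp_contDiffWithinAt y (contDiffWithinAt_const.sub hγ.smooth)
  have hpolinv := PolyFamily.of_smooth (S := S) (y := y) hinv
  have hpar1 : ∀ s, IsParallelAt D v S y (pathForm α θ s) (fun z => 1 - γ z) := fun s => by
    simpa [sub_eq_add_neg] using IsParallelAt.one.add hU ((hγ.parallelAt hy s).smul hU (-1))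
  have hparinv : ∀ s, IsParallelAt D v S y (pathForm α θ s) (fun z => Ring.inverse (1 - γ z)) :=
    fun s => (hpar1 s).inverse hU (hinv.differentiableWithinAt (by simp)) hy
      (hunit.mono fun z hz => Ring.mul_inverse_cancel _ hz)
      (Ring.inverse_mul_cancel _ (hunit.self_of_nhdsWithin hy))
  -- the family `f`
  have hpolf : PolyFamily S y f := by
    have h1 := hone.add ((hpolγ.mul (hpol.nilEval (PowerSeries.exp ℝ) hm)).neg)
    exact h1.congr (Eventually.of_forall fun z s => by rw [hf, sub_eq_add_neg])
  have hparf : ∀ s, IsParallelAt D v S y (pathForm α θ s) (f s) := fun s => by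
    have h1 := (hγ.parallelAt hy s).mul hU
      ((hpar s).nilEval hU hy (PowerSeries.exp ℝ) (hm.mono fun z hz => hz s))
    have h2 := IsParallelAt.one.add hU (h1.smul hU (-1))
    refine h2.congr hy (Eventually.of_forall fun z => ?_)
    simp only [hf, neg_smul, one_smul, sub_eq_add_neg]
  -- the nilpotent family `n = u - 1`
  set n : ℝ → E → W := fun s z => Ring.inverse (1 - γ z) * f s z - 1 with hn
  have hnmem : ∀ᶠ z in 𝓝[S] y, ∀ s, n s z ∈ J := by
    filter_upwards [hunit] with z hz s
    simp only [hn, hf]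
    exact hT.unipotent_mem hz (hα.curv_mem hT s z)
  have hnm : ∀ᶠ z in 𝓝[S] y, ∀ s, n s z ^ m = 0 :=
    hnmem.mono fun z hz s => hT.pow_eq_zero _ (hz s)
  have hpoln : PolyFamily S y n :=
    ((hpolinv.mul hpolf).add hone.neg).congr
      (Eventually.of_forall fun z s => by simp only [hn, sub_eq_add_neg])
  have hparn : ∀ s, IsParallelAt D v S y (pathForm α θ s) (n s) := fun s =>
    (((hparinv s).mul hU (hparf s)).add hU (IsParallelAt.one.smul hU (-1))).congr hy
      (Eventually.of_forall fun z => by simp only [hn, neg_smul, one_smul, sub_eq_add_neg])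
  -- the inverse of `f`
  set q : ℝ → E → W := fun s z =>
    nilEval (PowerSeries.derivative ℝ (PowerSeries.log ℝ)) (n s z) with hq
  have hpolq : PolyFamily S y q := hpoln.nilEval _ hnm
  have hparq : ∀ s, IsParallelAt D v S y (pathForm α θ s) (q s) := fun s =>
    (hparn s).nilEval hU hy _ (hnm.mono fun z hz => hz s)
  have hfinv : ∀ᶠ z in 𝓝[S] y, ∀ s,
      Ring.inverse (f s z) = q s z * Ring.inverse (1 - γ z) := by
    filter_upwards [hunit, hnm] with z hz hzn s
    have h1 := inverse_one_sub_eq hz (rfl : n s z = _)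
      (nilEval_log_derivative_mul ⟨m, hzn s⟩)
      (nilEval_commute (PowerSeries.derivative ℝ (PowerSeries.log ℝ)) (Commute.refl (n s z))).symm
    exact Ring.inverse_unit ⟨f s z, q s z * Ring.inverse (1 - γ z), h1.1, h1.2⟩
  have hpolb : PolyFamily S y (fun s z => (1 - f s z) * Ring.inverse (f s z)) := by
    refine ((hone.add hpolf.neg).mul (hpolq.mul hpolinv)).congr ?_
    filter_upwards [hfinv] with z hz s
    rw [hz, sub_eq_add_neg]
  have hparb : ∀ s, IsParallelAt D v S y (pathForm α θ s)
      (fun z => (1 - f s z) * Ring.inverse (f s z)) := fun s => by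
    refine (((IsParallelAt.one.add hU ((hparf s).smul hU (-1))).mul hU
      ((hparq s).mul hU (hparinv s)))).congr hy ?_
    filter_upwards [hfinv] with z hz
    rw [hz s, neg_smul, one_smul, sub_eq_add_neg]
  have h1 := transgressionPair_tr (v := v) hT hα hS hy (hpoln.nilEval (PowerSeries.log ℝ) hnm)
    hpolb (fun s => (hparn s).nilEval hU hy _ (hnm.mono fun z hz => hz s)) hparb
    (fun s => by
      have hc := hγ.commute hα hS hy hcl s
      obtain ⟨C, hC, hCγ, hcomm, hCinv⟩ := exists_commutative_subalgebra hc
      refine ⟨C, ?_⟩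
      have hu := hunit.self_of_nhdsWithin hy
      have hCi : Ring.inverse (1 - γ y) ∈ C := hCinv _ (C.sub_mem C.one_mem hCγ) _
        (Ring.mul_inverse_cancel _ hu) (Ring.inverse_mul_cancel _ hu)
      have he := ((hα.traceDerivAt_curv (tr := tr) hS hy s hC).smul (-1)).nilEval hT.tr_comm hcomm
        (PowerSeries.exp ℝ) (m := m) (fun t => by simpa using hT.pow_eq_zero _ (hmem t y))
      have hγe := (TraceDerivAt.const hCγ (hγ.even y)).mul hT.tr_comm hcomm he
      have hfe := (TraceDerivAt.const C.one_mem (map_one _)).add (hγe.smul (-1))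
      have hie := (TraceDerivAt.const hCi (hparinv s).even).mul hT.tr_comm hcomm hfe
      have hne := hie.add (TraceDerivAt.const (C.neg_mem C.one_mem) (by simp))
      have hlog := hne.nilEval hT.tr_comm hcomm (PowerSeries.log ℝ) (m := m) (fun t => by
        have h2 := hnm.self_of_nhdsWithin hy t
        simpa [hn, hf, sub_eq_add_neg] using h2)
      have hb : (1 - f s y) * Ring.inverse (f s y) = q s y * (Ring.inverse (1 - γ y) *
          (γ y * nilEval (PowerSeries.exp ℝ) (-D.curv v S (pathForm α θ s) y))) := by
        have hfC : 1 - f s y ∈ C := by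
          rw [hf, sub_sub_cancel]
          exact C.mul_mem hCγ (nilEval_mem _ _ (C.neg_mem hC))
        have hqC : q s y ∈ C := nilEval_mem _ _ (C.sub_mem (C.mul_mem hCi (by
          rw [← sub_sub_cancel 1 (f s y)]
          exact C.sub_mem C.one_mem hfC)) C.one_mem)
        rw [hfinv.self_of_nhdsWithin hy s, hcomm _ hfC _ (C.mul_mem hqC hCi), hf,
          sub_sub_cancel, mul_assoc]
      rw [hb]
      convert hlog using 1
      · simp [hn, hf, sub_eq_add_neg]
      · simp [hq, hn, hf, sub_eq_add_neg, derivative_exp_real])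
  exact h1.exp (J' := J') hT.comm_of_even hT.pow_eq_zero'
    (hnmem.mono fun z hz s => hT.tr_mem _ (hT.nilEval_mem PowerSeries.constantCoeff_log (hz s)))
    hS hy c hκ hκ'

end FlatTransgression

noncomputable section

/-! ### The graded algebras of forms and of endomorphism-valued forms -/

section NilIdeal

variable {ι A : Type*} [Ring A] [Algebra ℝ A]

namespace FormData

/-- The elements `∑ᵢ eⁱ wᵢ`. -/
def genIdeal [Fintype ι] (D : FormData ι A) : Submodule ℝ A where
  carrier := {a | ∃ w : ι → A, a = ∑ i, D.gen i * w i}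
  add_mem' := by
    rintro _ _ ⟨w, rfl⟩ ⟨w', rfl⟩
    exact ⟨w + w', by simp [mul_add, Finset.sum_add_distrib]⟩
  zero_mem' := ⟨0, by simp⟩
  smul_mem' := by
    rintro c _ ⟨w, rfl⟩
    exact ⟨c • w, by simp [Finset.smul_sum]⟩

variable (D : FormData ι A)

theorem mul_gen (hD : ∀ a, D.inv (D.inv a) = a) (i : ι) (a : A) :
    a * D.gen i = D.gen i * D.inv a := by
  rw [D.gen_mul, hD]

theorem pow_eq_zero_of_finset (hD : ∀ a, D.inv (D.inv a) = a)
    (hsq : ∀ i, D.gen i * D.gen i = 0) (s : Finset ι) (w : ι → A) :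
    (∑ i ∈ s, D.gen i * w i) ^ 2 ^ s.card = 0 := by
  classical
  induction s using Finset.induction_on with
  | empty => simp
  | insert i s hi ih =>
    rw [Finset.sum_insert hi, Finset.card_insert_of_notMem hi, pow_succ 2, pow_mul]
    set b := ∑ i ∈ s, D.gen i * w i
    have key : ∀ k : ℕ, ∃ x, (D.gen i * w i + b) ^ k = D.gen i * x + b ^ k := by
      intro k
      induction k with
      | zero => exact ⟨0, by simp⟩
      | succ k ihk =>
        obtain ⟨x, hx⟩ := ihk
        refine ⟨x * (D.gen i * w i + b) + D.inv (b ^ k) * w i, ?_⟩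
        rw [pow_succ, hx, add_mul, mul_add (b ^ k), ← mul_assoc (b ^ k), D.mul_gen hD, pow_succ]
        noncomm_ring
    obtain ⟨x, hx⟩ := key (2 ^ s.card)
    rw [hx, ih, add_zero, sq, mul_assoc, ← mul_assoc x, D.mul_gen hD, ← mul_assoc, ← mul_assoc,
      hsq, zero_mul, zero_mul]

variable [Fintype ι]

theorem pow_eq_zero_of_mem_genIdeal (hD : ∀ a, D.inv (D.inv a) = a)
    (hsq : ∀ i, D.gen i * D.gen i = 0) {a : A} (ha : a ∈ D.genIdeal) :
    a ^ 2 ^ Fintype.card ι = 0 := by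
  obtain ⟨w, rfl⟩ := ha
  exact D.pow_eq_zero_of_finset hD hsq Finset.univ w

theorem gen_mul_mem_genIdeal (i : ι) (a : A) : D.gen i * a ∈ D.genIdeal := by
  classical
  exact ⟨Pi.single i a, by simp [Pi.single_apply]⟩

theorem mul_mem_genIdeal_right {a : A} (b : A) (ha : a ∈ D.genIdeal) : a * b ∈ D.genIdeal := by
  obtain ⟨w, rfl⟩ := ha
  exact ⟨fun i => w i * b, by simp [Finset.sum_mul, mul_assoc]⟩

theorem mul_mem_genIdeal_left (hD : ∀ a, D.inv (D.inv a) = a) (a : A) {b : A}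
    (hb : b ∈ D.genIdeal) : a * b ∈ D.genIdeal := by
  obtain ⟨w, rfl⟩ := hb
  exact ⟨fun i => D.inv a * w i, by
    simp only [Finset.mul_sum, ← mul_assoc, D.mul_gen hD]⟩

end FormData

end NilIdeal

section Parity

variable {R M : Type*} [CommRing R] [AddCommGroup M] [Module R M]

open ExteriorAlgebra in
theorem ι_mul_eq_involute_mul (v : M) (a : ExteriorAlgebra R M) :
    ι R v * a = CliffordAlgebra.involute a * ι R v := by
  induction a using ExteriorAlgebra.induction with
  | algebraMap r => simpa using (Algebra.commutes r (ι R v)).symm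
  | ι w =>
    rw [show CliffordAlgebra.involute (ι R w) = -ι R w from CliffordAlgebra.involute_ι w, neg_mul,
      eq_neg_iff_add_eq_zero]
    exact ExteriorAlgebra.ι_add_mul_swap v w
  | mul a b ha hb => rw [← mul_assoc, ha, mul_assoc, hb, map_mul, mul_assoc]
  | add a b ha hb => rw [mul_add, ha, hb, map_add, add_mul]

open ExteriorAlgebra in
theorem commute_of_involute_eq {a : ExteriorAlgebra R M} (ha : CliffordAlgebra.involute a = a)
    (b : ExteriorAlgebra R M) : a * b = b * a := by
  induction b using ExteriorAlgebra.induction with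
  | algebraMap r => exact (Algebra.commutes r a).symm
  | ι v => rw [ι_mul_eq_involute_mul, ha]
  | mul b c hb hc => rw [← mul_assoc, hb, mul_assoc, hc, mul_assoc]
  | add b c hb hc => rw [mul_add, hb, hc, add_mul]

open ExteriorAlgebra in
theorem mul_eq_involute_mul_of_odd {a : ExteriorAlgebra R M}
    (ha : CliffordAlgebra.involute a = -a) (b : ExteriorAlgebra R M) :
    a * b = CliffordAlgebra.involute b * a := by
  induction b using ExteriorAlgebra.induction with
  | algebraMap r => simpa using (Algebra.commutes r a).symm
  | ι v =>
    rw [show CliffordAlgebra.involute (ι R v) = -ι R v from CliffordAlgebra.involute_ι v, neg_mul,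
      ι_mul_eq_involute_mul, ha]
    simp
  | mul b c hb hc => rw [← mul_assoc, hb, mul_assoc, hc, map_mul, mul_assoc]
  | add b c hb hc => rw [mul_add, hb, hc, map_add, add_mul]

end Parity

section Concrete

variable (𝕂 : Type*) [Field 𝕂] [Algebra 𝕂 ℂ] (T : Type*) [AddCommGroup T] [Module ℝ T]
  (W : Type*) [AddCommGroup W] [Module 𝕂 W]

variable {𝕂 T W} in
theorem strace_tmul (α : FormAlg T) (a : Module.End 𝕂 W) :
    strace (α ⊗ₜ[𝕂] a) = LinearMap.trace 𝕂 W a • α := by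
  simp [strace]

variable {𝕂 T W} in
theorem strace_smul (c : ℂ) (a : EndFormAlg 𝕂 T W) : strace (c • a) = c • strace a := by
  induction a using TensorProduct.induction_on with
  | zero => simp
  | tmul α a => rw [TensorProduct.smul_tmul', strace_tmul, strace_tmul, smul_comm]
  | add a b ha hb => rw [smul_add, map_add, ha, hb, map_add, smul_add]

/-- The trace as a real linear map. -/
def straceReal : EndFormAlg 𝕂 T W →ₗ[ℝ] FormAlg T where
  toFun := strace
  map_add' := map_add _
  map_smul' r a := strace_smul (r : ℂ) a

variable {𝕂 T W} in
theorem straceReal_apply (a : EndFormAlg 𝕂 T W) : straceReal 𝕂 T W a = strace a := rfl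

/-- The parity involution on endomorphism-valued forms. -/
def involuteEnd : EndFormAlg 𝕂 T W →ₐ[ℂ] EndFormAlg 𝕂 T W :=
  Algebra.TensorProduct.map CliffordAlgebra.involute (AlgHom.id 𝕂 _)

variable {𝕂 T W} in
theorem involuteEnd_tmul (α : FormAlg T) (a : Module.End 𝕂 W) :
    involuteEnd 𝕂 T W (α ⊗ₜ a) = CliffordAlgebra.involute α ⊗ₜ a := rfl

variable {𝕂 T W} in
theorem involuteEnd_involuteEnd (a : EndFormAlg 𝕂 T W) :
    involuteEnd 𝕂 T W (involuteEnd 𝕂 T W a) = a := by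
  induction a using TensorProduct.induction_on with
  | zero => simp
  | tmul α a => simp [involuteEnd_tmul]
  | add a b ha hb => rw [map_add, map_add, ha, hb]

variable [FiniteDimensional ℝ T]

/-- The generators and the parity of the algebra of complex exterior forms. -/
def formData : FormData (Fin (finrank ℝ T)) (FormAlg T) where
  gen i := oneForm (covec T i)
  inv := (CliffordAlgebra.involute (R := ℂ)).restrictScalars ℝ
  gen_mul _ a := ι_mul_eq_involute_mul _ a
  inv_gen _ := CliffordAlgebra.involute_ι _

/-- The generators and the parity of the algebra of endomorphism-valued forms. -/
def endFormData : FormData (Fin (finrank ℝ T)) (EndFormAlg 𝕂 T W) where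
  gen i := oneForm (covec T i) ⊗ₜ 1
  inv := (involuteEnd 𝕂 T W).restrictScalars ℝ
  gen_mul i a := by
    change _ = involuteEnd 𝕂 T W a * _
    induction a using TensorProduct.induction_on with
    | zero => simp
    | tmul α a =>
      rw [involuteEnd_tmul, Algebra.TensorProduct.tmul_mul_tmul,
        Algebra.TensorProduct.tmul_mul_tmul, one_mul, mul_one, ι_mul_eq_involute_mul]
    | add a b ha hb => rw [mul_add, ha, hb, map_add, add_mul]
  inv_gen i := by
    change involuteEnd 𝕂 T W _ = _
    rw [involuteEnd_tmul, show CliffordAlgebra.involute (oneForm (covec T i)) = -oneForm (covec T i)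
      from CliffordAlgebra.involute_ι _, TensorProduct.neg_tmul]

theorem strace_mul_comm_of_even (a b : EndFormAlg 𝕂 T W) (ha : involuteEnd 𝕂 T W a = a) :
    strace (a * b) = strace (b * a) := by
  have key : ∀ a b : EndFormAlg 𝕂 T W,
      strace ((a + involuteEnd 𝕂 T W a) * b) = strace (b * (a + involuteEnd 𝕂 T W a)) := by
    intro a b
    induction a using TensorProduct.induction_on with
    | zero => simp
    | add a a' h h' =>
      rw [map_add, add_add_add_comm, add_mul, mul_add, map_add, map_add, h, h']
    | tmul α a =>
      induction b using TensorProduct.induction_on with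
      | zero => simp
      | add b b' h h' => rw [mul_add _ b b', add_mul b b', map_add, map_add, h, h']
      | tmul β b =>
        rw [involuteEnd_tmul, ← TensorProduct.add_tmul, Algebra.TensorProduct.tmul_mul_tmul,
          Algebra.TensorProduct.tmul_mul_tmul, strace_tmul, strace_tmul, LinearMap.trace_mul_comm,
          commute_of_involute_eq]
        rw [map_add, CliffordAlgebra.involute_involute, add_comm]
  have h := key a b
  rw [ha, ← two_smul ℂ a, smul_mul_assoc, mul_smul_comm, strace_smul, strace_smul] at h
  exact smul_right_injective _ (two_ne_zero (α := ℂ)) h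

theorem strace_mul_of_odd (a b : EndFormAlg 𝕂 T W) (ha : involuteEnd 𝕂 T W a = -a) :
    strace (a * b) = strace (involuteEnd 𝕂 T W b * a) := by
  have key : ∀ a b : EndFormAlg 𝕂 T W, strace ((a - involuteEnd 𝕂 T W a) * b)
      = strace (involuteEnd 𝕂 T W b * (a - involuteEnd 𝕂 T W a)) := by
    intro a b
    induction a using TensorProduct.induction_on with
    | zero => simp
    | add a a' h h' =>
      rw [map_add, add_sub_add_comm, add_mul, mul_add, map_add, map_add, h, h']
    | tmul α a =>
      induction b using TensorProduct.induction_on with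
      | zero => simp
      | add b b' h h' =>
        rw [mul_add _ b b', map_add (involuteEnd 𝕂 T W) b b', add_mul (involuteEnd 𝕂 T W b),
          map_add, map_add, h, h']
      | tmul β b =>
        rw [involuteEnd_tmul, involuteEnd_tmul, ← TensorProduct.sub_tmul,
          Algebra.TensorProduct.tmul_mul_tmul, Algebra.TensorProduct.tmul_mul_tmul, strace_tmul,
          strace_tmul, LinearMap.trace_mul_comm, mul_eq_involute_mul_of_odd]
        rw [map_sub, CliffordAlgebra.involute_involute, neg_sub]
  have h := key a b
  rw [ha, sub_neg_eq_add, ← two_smul ℂ a, smul_mul_assoc, mul_smul_comm, strace_smul,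
    strace_smul] at h
  exact smul_right_injective _ (two_ne_zero (α := ℂ)) h

theorem strace_oneForm_mul (v : T →ₗ[ℝ] ℂ) (a : EndFormAlg 𝕂 T W) :
    strace ((oneForm v ⊗ₜ 1) * a) = oneForm v * strace a := by
  induction a using TensorProduct.induction_on with
  | zero => simp
  | tmul α a =>
    rw [Algebra.TensorProduct.tmul_mul_tmul, one_mul, strace_tmul, strace_tmul, mul_smul_comm]
  | add a b ha hb => rw [mul_add, map_add, ha, hb, map_add, mul_add]

theorem strace_involuteEnd (a : EndFormAlg 𝕂 T W) :
    strace (involuteEnd 𝕂 T W a) = CliffordAlgebra.involute (strace a) := by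
  induction a using TensorProduct.induction_on with
  | zero => simp
  | tmul α a =>
    rw [involuteEnd_tmul, strace_tmul, strace_tmul, ← algebraMap_smul ℂ, ← algebraMap_smul ℂ _ α,
      map_smul]
  | add a b ha hb => rw [map_add, map_add, ha, hb, map_add, map_add]

theorem tracedForms : TracedForms (endFormData 𝕂 T W) (formData T) (straceReal 𝕂 T W)
    (endFormData 𝕂 T W).genIdeal (formData T).genIdeal (2 ^ finrank ℝ T) where
  tr_gen_mul i a := strace_oneForm_mul 𝕂 T W _ a
  tr_inv a := strace_involuteEnd 𝕂 T W a
  tr_comm a b ha := strace_mul_comm_of_even 𝕂 T W a b ha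
  tr_odd a b ha := strace_mul_of_odd 𝕂 T W a b ha
  comm_of_even a b ha := commute_of_involute_eq ha b
  gen_mem i := by simpa using (endFormData 𝕂 T W).gen_mul_mem_genIdeal i 1
  mul_mem_left a b hb :=
    (endFormData 𝕂 T W).mul_mem_genIdeal_left involuteEnd_involuteEnd a hb
  mul_mem_right a b ha := (endFormData 𝕂 T W).mul_mem_genIdeal_right b ha
  pow_eq_zero a ha := by
    have h := (endFormData 𝕂 T W).pow_eq_zero_of_mem_genIdeal involuteEnd_involuteEnd (fun i => by
      change (oneForm (covec T i) ⊗ₜ[𝕂] 1) * (oneForm (covec T i) ⊗ₜ 1) = _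
      rw [Algebra.TensorProduct.tmul_mul_tmul, ExteriorAlgebra.ι_sq_zero,
        TensorProduct.zero_tmul]) ha
    simpa using h
  tr_mem := by
    rintro _ ⟨w, rfl⟩
    exact ⟨fun i => strace (w i), by
      rw [map_sum]
      exact Finset.sum_congr rfl fun i _ => strace_oneForm_mul 𝕂 T W _ _⟩
  pow_eq_zero' a ha := by
    have h := (formData T).pow_eq_zero_of_mem_genIdeal CliffordAlgebra.involute_involute
      (fun i => ExteriorAlgebra.ι_sq_zero _) ha
    simpa using h

end Concrete

/-! ### Norms on the algebras of forms -/

section Norms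

/-- The norm of a finite-dimensional algebra by means of its left regular representation. -/
abbrev leftRegularNormedRing (A : Type*) [Ring A] [Algebra ℝ A] [Module.Finite ℝ A] :
    NormedRing A :=
  letI : NormedRing (Matrix (Fin (finrank ℝ A)) (Fin (finrank ℝ A)) ℝ) := Matrix.linftyOpNormedRing
  NormedRing.induced A (Matrix (Fin (finrank ℝ A)) (Fin (finrank ℝ A)) ℝ)
    (Algebra.leftMulMatrix (finBasis ℝ A)) (Algebra.leftMulMatrix_injective _)

/-- The norm `leftRegularNormedRing` is a norm of real algebras. -/
abbrev leftRegularNormedAlgebra (A : Type*) [Ring A] [Algebra ℝ A] [Module.Finite ℝ A] :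
    letI := leftRegularNormedRing A
    NormedAlgebra ℝ A :=
  letI : NormedRing (Matrix (Fin (finrank ℝ A)) (Fin (finrank ℝ A)) ℝ) := Matrix.linftyOpNormedRing
  letI : NormedAlgebra ℝ (Matrix (Fin (finrank ℝ A)) (Fin (finrank ℝ A)) ℝ) :=
    Matrix.linftyOpNormedAlgebra
  NormedAlgebra.induced ℝ A (Matrix (Fin (finrank ℝ A)) (Fin (finrank ℝ A)) ℝ)
    (Algebra.leftMulMatrix (finBasis ℝ A))

variable (𝕂 : Type*) [Field 𝕂] [Algebra 𝕂 ℂ] (T : Type*) [AddCommGroup T] [Module ℝ T]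
  [FiniteDimensional ℝ T] (W : Type*) [AddCommGroup W] [Module 𝕂 W] [Module.Finite 𝕂 W]

instance formAlgFinite : Module.Finite ℂ (FormAlg T) := Module.Finite.of_basis (formBasis T)

instance endFormAlgFiniteComplex : Module.Finite ℂ (EndFormAlg 𝕂 T W) :=
  Module.Finite.of_basis ((formBasis T).tensorProduct (finBasis 𝕂 (End 𝕂 W)))

instance endFormAlgFinite : Module.Finite ℝ (EndFormAlg 𝕂 T W) := Module.Finite.trans ℂ _

instance formAlgNormedRing : NormedRing (FormAlg T) := leftRegularNormedRing _

instance formAlgNormedAlgebra : NormedAlgebra ℝ (FormAlg T) := leftRegularNormedAlgebra _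

instance endFormAlgNormedRing : NormedRing (EndFormAlg 𝕂 T W) := leftRegularNormedRing _

instance endFormAlgNormedAlgebra : NormedAlgebra ℝ (EndFormAlg 𝕂 T W) :=
  leftRegularNormedAlgebra _

end Norms

/-! ### Endomorphism-valued forms under a change of frame -/

theorem nilEval_algebra_congr {R A : Type*} [CommRing R] [Ring A] (i j : Algebra R A)
    (h : ∀ (r : R) (a : A), i.toSMul.smul r a = j.toSMul.smul r a) (p : PowerSeries R) (a : A) :
    @nilEval R A _ _ i p a = @nilEval R A _ _ j p a :=
  Finset.sum_congr rfl fun _ _ => h _ _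

section Frames

variable (𝕂 : Type*) [Field 𝕂] [Algebra 𝕂 ℂ] (T : Type*) [AddCommGroup T] [Module ℝ T]
  (W : Type*) [AddCommGroup W] [Module 𝕂 W]

variable {𝕂 T W} in
/-- The value of a real power series, for any of the fields `𝕂`. -/
abbrev realNilEval (p : PowerSeries ℝ) (a : EndFormAlg 𝕂 T W) : EndFormAlg 𝕂 T W := nilEval p a

theorem nilEval_eq_realNilEval {W : Type*} [AddCommGroup W] [Module ℝ W] (p : PowerSeries ℝ)
    (a : EndFormAlg ℝ T W) : nilEval p a = realNilEval p a := by
  refine nilEval_algebra_congr _ _ (fun r a => ?_) p a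
  change r • a = _
  rw [← algebraMap_smul ℂ r a]
  rfl

theorem nilEval_exp_eq_realNilEval {W : Type*} [AddCommGroup W] [Module ℂ W]
    (a : EndFormAlg ℂ T W) :
    nilEval (PowerSeries.exp ℂ) a = realNilEval (PowerSeries.exp ℝ) a :=
  nilEval_exp_complex (fun _ _ => rfl) a

instance formAlgScalarTower [Algebra ℝ 𝕂] [IsScalarTower ℝ 𝕂 ℂ] :
    @IsScalarTower ℝ 𝕂 (FormAlg T) _ _ Algebra.complexToReal.toSMul :=
  ⟨fun r k a => by
    rw [← algebraMap_smul ℂ (r • k) a, ← algebraMap_smul ℂ k a, Algebra.smul_def r k, map_mul,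
      ← IsScalarTower.algebraMap_apply ℝ 𝕂 ℂ, mul_smul]
    rfl⟩

variable {𝕂 T W}

variable {T' : Type*} [AddCommGroup T'] [Module ℝ T'] {W' : Type*} [AddCommGroup W'] [Module 𝕂 W']

/-- The pullback of forms under a linear isomorphism. -/
def pullbackEquiv (L : T' ≃ₗ[ℝ] T) : FormAlg T ≃ₐ[ℂ] FormAlg T' :=
  AlgEquiv.ofAlgHom (pullbackForm L.toLinearMap) (pullbackForm L.symm.toLinearMap)
    (by
      refine ExteriorAlgebra.hom_ext (LinearMap.ext fun v => ?_)
      simp only [pullbackForm, LinearMap.comp_apply, AlgHom.toLinearMap_apply, AlgHom.comp_apply,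
        ExteriorAlgebra.map_apply_ι, AlgHom.id_apply]
      congr 1
      ext t
      simp)
    (by
      refine ExteriorAlgebra.hom_ext (LinearMap.ext fun v => ?_)
      simp only [pullbackForm, LinearMap.comp_apply, AlgHom.toLinearMap_apply, AlgHom.comp_apply,
        ExteriorAlgebra.map_apply_ι, AlgHom.id_apply]
      congr 1
      ext t
      simp)

theorem pullbackEquiv_apply (L : T' ≃ₗ[ℝ] T) (a : FormAlg T) :
    pullbackEquiv L a = pullbackForm L.toLinearMap a := rfl

theorem pullbackForm_oneForm (L : T' →ₗ[ℝ] T) (v : T →ₗ[ℝ] ℂ) :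
    pullbackForm L (oneForm v) = oneForm (v ∘ₗ L) :=
  ExteriorAlgebra.map_apply_ι _ _

/-- The isomorphism of algebras of endomorphism-valued forms induced by changes of frames. -/
def frameEquiv (L : T' ≃ₗ[ℝ] T) (τ : W ≃ₗ[𝕂] W') : EndFormAlg 𝕂 T W ≃ₐ[ℂ] EndFormAlg 𝕂 T' W' :=
  Algebra.TensorProduct.congr (pullbackEquiv L) (τ.conjAlgEquiv 𝕂)

theorem frameEquiv_tmul (L : T' ≃ₗ[ℝ] T) (τ : W ≃ₗ[𝕂] W') (a : FormAlg T) (b : End 𝕂 W) :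
    frameEquiv L τ (a ⊗ₜ b) = pullbackForm L.toLinearMap a ⊗ₜ τ.conj b := rfl

theorem strace_frameEquiv (L : T' ≃ₗ[ℝ] T) (τ : W ≃ₗ[𝕂] W') (a : EndFormAlg 𝕂 T W) :
    strace (frameEquiv L τ a) = pullbackForm L.toLinearMap (strace a) := by
  induction a using TensorProduct.induction_on with
  | zero => simp
  | tmul α a =>
    rw [frameEquiv_tmul, strace_tmul, strace_tmul, LinearMap.trace_conj', ← algebraMap_smul ℂ,
      ← algebraMap_smul ℂ _ α, map_smul]
  | add a b ha hb => rw [map_add, map_add, ha, hb, map_add, map_add]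

theorem frameEquiv_ofEnd (L : T' ≃ₗ[ℝ] T) (τ : W ≃ₗ[𝕂] W') (a : End 𝕂 W) :
    frameEquiv L τ (ofEnd a) = ofEnd (τ.conj a) := by
  rw [ofEnd, frameEquiv_tmul, map_one]; rfl

theorem frameEquiv_realNilEval (L : T' ≃ₗ[ℝ] T) (τ : W ≃ₗ[𝕂] W') (p : PowerSeries ℝ)
    (a : EndFormAlg 𝕂 T W) :
    frameEquiv L τ (realNilEval p a) = realNilEval p (frameEquiv L τ a) :=
  (nilEval_map p ((frameEquiv L τ).toAlgHom.restrictScalars ℝ) (frameEquiv L τ).injective a).symm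

theorem frameEquiv_inverse (L : T' ≃ₗ[ℝ] T) (τ : W ≃ₗ[𝕂] W') (a : EndFormAlg 𝕂 T W) :
    frameEquiv L τ (Ring.inverse a) = Ring.inverse (frameEquiv L τ a) := by
  by_cases h : IsUnit a
  · obtain ⟨u, rfl⟩ := h
    rw [Ring.inverse_unit]
    exact (Ring.inverse_unit (Units.map (frameEquiv L τ).toRingEquiv.toMonoidHom u)).symm
  · rw [Ring.inverse_non_unit _ h, map_zero, Ring.inverse_non_unit]
    exact fun h' => h (by simpa using h'.map (frameEquiv L τ).symm)

theorem endOfMap_linear (φ : End 𝕂 W) : endOfMap (𝕂 := 𝕂) (fun w => φ w) = φ :=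
  (Basis.ofVectorSpace 𝕂 W).ext fun a => by rw [endOfMap, Basis.constr_basis]

section Basis

variable [Algebra ℝ 𝕂] [IsScalarTower ℝ 𝕂 ℂ] [FiniteDimensional ℝ T] [FiniteDimensional ℝ T']
  [Module ℝ W'] [IsScalarTower ℝ 𝕂 W']

theorem sum_covec_comp_tmul {M N : Type*} [AddCommGroup M] [Module 𝕂 M] [Module ℝ M]
    [IsScalarTower ℝ 𝕂 M] [AddCommGroup N] [Module 𝕂 N] [Module ℝ N] [IsScalarTower ℝ 𝕂 N]
    (L : T' →ₗ[ℝ] T) (f : T →ₗ[ℝ] M) (g : (T' →ₗ[ℝ] ℂ) →ₗ[ℝ] N) :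
    ∑ i, g (covec T i ∘ₗ L) ⊗ₜ[𝕂] f (vecBasis T i)
      = ∑ a, g (covec T' a) ⊗ₜ[𝕂] f (L (vecBasis T' a)) := by
  have h1 : ∀ i, covec T i ∘ₗ L
      = ∑ a, (vecBasis T).repr (L (vecBasis T' a)) i • covec T' a := fun i => by
    refine (vecBasis T').ext fun b => ?_
    simp [covec, Finsupp.single_apply, apply_ite]
  have h2 : ∀ a, f (L (vecBasis T' a))
      = ∑ i, (vecBasis T).repr (L (vecBasis T' a)) i • f (vecBasis T i) := fun a => by
    conv_lhs => rw [← (vecBasis T).sum_repr (L (vecBasis T' a)), map_sum]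
    simp only [map_smul]
  simp only [h1, h2, map_sum, map_smul, TensorProduct.sum_tmul, TensorProduct.tmul_sum,
    TensorProduct.smul_tmul]
  exact Finset.sum_comm

/-- Multiplication by a one-form on the right of a given form, as a real linear map. -/
def oneFormReal (T : Type*) [AddCommGroup T] [Module ℝ T] :
    (T →ₗ[ℝ] ℂ) →ₗ[ℝ] FormAlg T where
  toFun v := oneForm v
  map_add' := map_add _
  map_smul' r v := (ExteriorAlgebra.ι ℂ).map_smul (r : ℂ) v

theorem endOneForm_eq (A : T' →ₗ[ℝ] End 𝕂 W') :
    endOneForm (𝕂 := 𝕂) (fun v w => A v w)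
      = ∑ i, oneForm (covec T' i) ⊗ₜ[𝕂] A (vecBasis T' i) := by
  simp only [endOneForm]
  exact Finset.sum_congr rfl fun i _ => by rw [endOfMap_linear]

theorem frameEquiv_endOneForm (L : T' ≃ₗ[ℝ] T) (τ : W ≃ₗ[𝕂] W') (A : T' →ₗ[ℝ] End 𝕂 W') :
    frameEquiv L τ (endOneForm fun v w => τ.symm (A (L.symm v) (τ w)))
      = endOneForm (fun v w => A v w) := by
  rw [endOneForm_eq]
  have h : ∀ v, endOfMap (𝕂 := 𝕂) (fun w => τ.symm (A (L.symm v) (τ w)))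
      = τ.symm.conj (A (L.symm v)) := fun v => endOfMap_linear (τ.symm.conj (A (L.symm v)))
  simp only [endOneForm, h, map_sum, frameEquiv_tmul, pullbackForm_oneForm]
  have h3 := sum_covec_comp_tmul (𝕂 := 𝕂) L.toLinearMap (A ∘ₗ L.symm.toLinearMap) (oneFormReal T')
  simp only [LinearMap.comp_apply, LinearEquiv.coe_coe, L.symm_apply_apply] at h3
  refine Eq.trans (Finset.sum_congr rfl fun i _ => ?_) h3
  congr 1
  exact τ.conj.apply_symm_apply _

theorem sum_mul_tmul_eq_sum_lt (w : Fin (finrank ℝ T) → Fin (finrank ℝ T) → End 𝕂 W) :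
    ∑ i, ∑ j, (oneForm (covec T i) * oneForm (covec T j)) ⊗ₜ[𝕂] w i j
      = ∑ i, ∑ j, if i < j then
        (oneForm (covec T i) * oneForm (covec T j)) ⊗ₜ[𝕂] (w i j - w j i) else 0 := by
  let g : Fin (finrank ℝ T) → Fin (finrank ℝ T) → FormAlg T :=
    fun i j => oneForm (covec T i) * oneForm (covec T j)
  have hself : ∀ i, g i i = 0 := fun i => ExteriorAlgebra.ι_sq_zero _
  have hswap : ∀ i j, g j i = -g i j := fun i j =>
    eq_neg_of_add_eq_zero_left (ExteriorAlgebra.ι_add_mul_swap _ _)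
  change ∑ i, ∑ j, g i j ⊗ₜ[𝕂] w i j = ∑ i, ∑ j, if i < j then g i j ⊗ₜ[𝕂] (w i j - w j i) else 0
  clear_value g
  have hsplit : ∀ i j, g i j ⊗ₜ[𝕂] w i j
      = (if i < j then g i j ⊗ₜ[𝕂] w i j else 0) + (if j < i then g i j ⊗ₜ[𝕂] w i j else 0) := by
    intro i j
    rcases lt_trichotomy i j with h | h | h
    · rw [if_pos h, if_neg h.not_gt, add_zero]
    · subst h
      rw [hself, TensorProduct.zero_tmul]
      simp
    · rw [if_pos h, if_neg h.not_gt, zero_add]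
  rw [Finset.sum_congr rfl fun i _ => Finset.sum_congr rfl fun j _ => hsplit i j]
  simp only [Finset.sum_add_distrib]
  rw [Finset.sum_comm (f := fun i j => if j < i then g i j ⊗ₜ[𝕂] w i j else 0)]
  simp only [← Finset.sum_add_distrib]
  refine Finset.sum_congr rfl fun i _ => Finset.sum_congr rfl fun j _ => ?_
  split_ifs
  · rw [hswap i j, TensorProduct.tmul_sub, TensorProduct.neg_tmul, sub_eq_add_neg]
  · rw [add_zero]

theorem two_smul_endTwoForm (B : T → T → End 𝕂 W) (hB : ∀ u v, B v u = -B u v) :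
    (2 : ℕ) • endTwoForm (fun u v w => B u v w)
      = ∑ i, ∑ j, (oneForm (covec T i) * oneForm (covec T j)) ⊗ₜ[𝕂]
        B (vecBasis T i) (vecBasis T j) := by
  rw [sum_mul_tmul_eq_sum_lt, endTwoForm, Finset.smul_sum]
  refine Finset.sum_congr rfl fun i _ => ?_
  rw [Finset.smul_sum]
  refine Finset.sum_congr rfl fun j _ => ?_
  split_ifs
  · rw [endOfMap_linear, hB (vecBasis T i) (vecBasis T j), sub_neg_eq_add, ← two_nsmul,
      TensorProduct.tmul_smul]
  · simp

theorem frameEquiv_endTwoForm (L : T' ≃ₗ[ℝ] T) (τ : W ≃ₗ[𝕂] W')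
    (B : T' →ₗ[ℝ] T' →ₗ[ℝ] End 𝕂 W') (hB : ∀ u v, B v u = -B u v) :
    frameEquiv L τ (endTwoForm fun u v w => τ.symm (B (L.symm u) (L.symm v) (τ w)))
      = endTwoForm (fun u v w => B u v w) := by
  have h2 : (2 : ℂ) ≠ 0 := two_ne_zero
  have hl : (2 : ℕ) • endTwoForm (𝕂 := 𝕂) (fun u v w => τ.symm (B (L.symm u) (L.symm v) (τ w)))
      = _ := two_smul_endTwoForm (fun u v => τ.symm.conj (B (L.symm u) (L.symm v)))
      (fun u v => by rw [hB, map_neg])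
  refine smul_right_injective _ h2 ?_
  change (2 : ℂ) • _ = (2 : ℂ) • _
  rw [← map_smul, ← Nat.cast_ofNat, Nat.cast_smul_eq_nsmul, Nat.cast_smul_eq_nsmul,
    two_smul_endTwoForm (fun u v => B u v) hB, hl]
  have hconj : ∀ b, τ.conj (τ.symm.conj b) = b := fun b => τ.conj.apply_symm_apply b
  simp only [map_sum, frameEquiv_tmul, map_mul, pullbackForm_oneForm, hconj]
  have hinner := fun i => sum_covec_comp_tmul (𝕂 := 𝕂) L.toLinearMap
    (B (L.symm (vecBasis T i)) ∘ₗ L.symm.toLinearMap)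
    (LinearMap.mulLeft ℝ (oneForm (covec T i ∘ₗ L.toLinearMap)) ∘ₗ oneFormReal T')
  have houter := fun b => sum_covec_comp_tmul (𝕂 := 𝕂) L.toLinearMap
    (B.flip (vecBasis T' b) ∘ₗ L.symm.toLinearMap)
    (LinearMap.mulRight ℝ (oneForm (covec T' b)) ∘ₗ oneFormReal T')
  simp only [LinearMap.comp_apply, LinearMap.mulLeft_apply, LinearMap.mulRight_apply,
    LinearEquiv.coe_coe, L.symm_apply_apply, LinearMap.flip_apply] at hinner houter
  refine (Finset.sum_congr rfl fun i _ => hinner i).trans ?_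
  rw [Finset.sum_comm]
  refine (Finset.sum_congr rfl fun b _ => houter b).trans ?_
  rw [Finset.sum_comm]
  rfl

end Basis

end Frames

/-! ### Coefficients, derivatives and integrals of forms -/

section Coefficients

variable {T : Type*} [AddCommGroup T] [Module ℝ T] [FiniteDimensional ℝ T]
  {E : Type*} [NormedAddCommGroup E] [NormedSpace ℝ E]

/-- A coefficient of a form, as a continuous real linear functional. -/
def formCoeffL (J : Finset (Fin (finrank ℝ T))) : FormAlg T →L[ℝ] ℂ :=
  LinearMap.toContinuousLinearMap
    { toFun := fun a => formCoeff J a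
      map_add' := fun a b => by simp [formCoeff]
      map_smul' := fun r a => by
        change (formBasis T).repr ((r : ℂ) • a) J = (r : ℂ) • (formBasis T).repr a J
        rw [map_smul]
        rfl }

theorem formCoeffL_apply (J : Finset (Fin (finrank ℝ T))) (a : FormAlg T) :
    formCoeffL J a = formCoeff J a := rfl

theorem sum_formCoeff (a : FormAlg T) : ∑ J, formCoeff J a • formBasis T J = a :=
  (formBasis T).sum_repr a

theorem fderivWithin_linear_comp {G N : Type*} [NormedAddCommGroup G] [NormedSpace ℝ G]
    [FiniteDimensional ℝ G] [NormedAddCommGroup N] [NormedSpace ℝ N] (ℓ : G →ₗ[ℝ] N)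
    {S : Set E} {y : E} (hS : UniqueDiffWithinAt ℝ S y) {A : E → G}
    (hA : DifferentiableWithinAt ℝ A S y) (v : E) :
    fderivWithin ℝ (fun z => ℓ (A z)) S y v = ℓ (fderivWithin ℝ A S y v) := by
  have h := (ℓ.toContinuousLinearMap.hasFDerivAt.comp_hasFDerivWithinAt y
    hA.hasFDerivWithinAt).fderivWithin hS
  exact congrArg (fun φ => φ v) h

theorem contDiffWithinAt_linear_comp {G N : Type*} [NormedAddCommGroup G] [NormedSpace ℝ G]
    [FiniteDimensional ℝ G] [NormedAddCommGroup N] [NormedSpace ℝ N] (ℓ : G →ₗ[ℝ] N)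
    {S : Set E} {y : E} {A : E → G} (hA : ContDiffWithinAt ℝ ∞ A S y) :
    ContDiffWithinAt ℝ ∞ (fun z => ℓ (A z)) S y :=
  ℓ.toContinuousLinearMap.contDiff.comp_contDiffWithinAt hA

theorem contDiffWithinAt_formCoeff {f : E → FormAlg T} {S : Set E} {y : E}
    (h : ContDiffWithinAt ℝ ∞ f S y) (J : Finset (Fin (finrank ℝ T))) :
    ContDiffWithinAt ℝ ∞ (fun z => formCoeff J (f z)) S y :=
  (formCoeffL J).contDiff.comp_contDiffWithinAt h

theorem extDerivFlat_eq_d [FiniteDimensional ℝ E] {f : E → FormAlg E} {S : Set E} {y : E}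
    (hS : UniqueDiffWithinAt ℝ S y) (hf : DifferentiableWithinAt ℝ f S y) :
    extDerivFlat f S y = (formData E).d (vecBasis E) S f y := by
  refine Finset.sum_congr rfl fun i _ => ?_
  congr 1
  conv_rhs => rw [← sum_formCoeff (fderivWithin ℝ f S y (vecBasis E i))]
  refine Finset.sum_congr rfl fun J _ => ?_
  have h := ((formCoeffL (T := E) J).hasFDerivAt.comp_hasFDerivWithinAt y
    hf.hasFDerivWithinAt).fderivWithin hS
  congr 1
  exact congrArg (fun φ => φ (vecBasis E i)) h

theorem formIntegral_poly {f : ℝ → FormAlg T} {n : ℕ} {g : ℕ → FormAlg T}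
    (h : ∀ s, f s = ∑ k ∈ Finset.range n, s ^ k • g k) :
    formIntegral f = ∑ k ∈ Finset.range n, ((k : ℝ) + 1)⁻¹ • g k := by
  have h1 : ∀ J s, formCoeff J (f s) = ∑ k ∈ Finset.range n, ((s ^ k : ℝ) : ℂ) * formCoeff J (g k) :=
    fun J s => by
      rw [h, ← formCoeffL_apply, map_sum]
      exact Finset.sum_congr rfl fun k _ => by
        rw [map_smul, formCoeffL_apply, Complex.real_smul]
  have h2 : ∀ J, ∫ s in (0 : ℝ)..1, formCoeff J (f s)
      = formCoeff J (∑ k ∈ Finset.range n, ((k : ℝ) + 1)⁻¹ • g k) := fun J => by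
    simp only [h1]
    rw [intervalIntegral.integral_finsetSum fun k _ => by
      apply Continuous.intervalIntegrable; fun_prop, ← formCoeffL_apply, map_sum]
    refine Finset.sum_congr rfl fun k _ => ?_
    rw [intervalIntegral.integral_mul_const, intervalIntegral.integral_ofReal, integral_pow,
      map_smul, formCoeffL_apply, Complex.real_smul]
    congr 2
    simp
  simp only [formIntegral, h2]
  exact sum_formCoeff _

theorem pullbackEquiv_formIntegral {T' : Type*} [AddCommGroup T'] [Module ℝ T']
    (L : T' ≃ₗ[ℝ] T) {f : ℝ → FormAlg T} {n : ℕ} {g : ℕ → FormAlg T'}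
    (h : ∀ s, pullbackForm L.toLinearMap (f s) = ∑ k ∈ Finset.range n, s ^ k • g k) :
    pullbackForm L.toLinearMap (formIntegral f)
      = ∑ k ∈ Finset.range n, ((k : ℝ) + 1)⁻¹ • g k := by
  have hsmul : ∀ (r : ℝ) a, (pullbackEquiv L).symm (r • a) = r • (pullbackEquiv L).symm a :=
    fun r a => map_smul (pullbackEquiv L).symm (r : ℂ) a
  have h1 : ∀ s, f s = ∑ k ∈ Finset.range n, s ^ k • (pullbackEquiv L).symm (g k) := fun s => by
    rw [← (pullbackEquiv L).symm_apply_apply (f s), pullbackEquiv_apply, h, map_sum]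
    simp only [hsmul]
  rw [formIntegral_poly h1, ← pullbackEquiv_apply]
  refine (pullbackEquiv L).symm.injective ?_
  rw [AlgEquiv.symm_apply_apply, map_sum]
  simp only [hsmul]

end Coefficients

/-! ### Connection forms of matrix-valued one-forms -/

section ConnectionForms

variable (𝕂 : Type*) [Field 𝕂] [Algebra ℝ 𝕂] [Algebra 𝕂 ℂ] [IsScalarTower ℝ 𝕂 ℂ]
  {E : Type*} [NormedAddCommGroup E] [NormedSpace ℝ E] [FiniteDimensional ℝ E]
  {F : Type*} [NormedAddCommGroup F] [NormedSpace ℝ F] [FiniteDimensional ℝ F]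
  [Module 𝕂 F] [IsScalarTower ℝ 𝕂 F] [Module.Finite 𝕂 F]

theorem endOfMap_add (φ ψ : F → F) :
    endOfMap (𝕂 := 𝕂) (fun w => φ w + ψ w) = endOfMap φ + endOfMap ψ :=
  (Basis.ofVectorSpace 𝕂 F).ext fun a => by
    simp only [endOfMap, LinearMap.add_apply, Basis.constr_basis]

theorem endOfMap_sub (φ ψ : F → F) :
    endOfMap (𝕂 := 𝕂) (fun w => φ w - ψ w) = endOfMap φ - endOfMap ψ :=
  (Basis.ofVectorSpace 𝕂 F).ext fun a => by
    simp only [endOfMap, LinearMap.sub_apply, Basis.constr_basis]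

theorem endOfMap_smul (r : ℝ) (φ : F → F) :
    endOfMap (𝕂 := 𝕂) (fun w => r • φ w) = r • endOfMap φ :=
  (Basis.ofVectorSpace 𝕂 F).ext fun a => by
    simp only [endOfMap, LinearMap.smul_apply, Basis.constr_basis]

theorem endOfMap_comp {φ : F → F} (hφ : ∃ φ' : End 𝕂 F, ∀ w, φ w = φ' w) (ψ : F → F) :
    endOfMap (𝕂 := 𝕂) (fun w => φ (ψ w)) = endOfMap φ * endOfMap ψ := by
  obtain ⟨φ', hφ'⟩ := hφ
  obtain rfl : φ = fun w => φ' w := funext hφ'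
  rw [endOfMap_linear]
  exact (Basis.ofVectorSpace 𝕂 F).ext fun a => by
    simp only [endOfMap, Module.End.mul_apply, Basis.constr_basis]

variable (E F) in
/-- A real endomorphism as an endomorphism-valued form of degree zero. -/
def endFormL : (F →L[ℝ] F) →ₗ[ℝ] EndFormAlg 𝕂 E F where
  toFun φ := ofEnd (endOfMap φ)
  map_add' φ ψ := by
    rw [ofEnd, ofEnd, ofEnd, ← TensorProduct.tmul_add, ← endOfMap_add]; rfl
  map_smul' r φ := by
    rw [ofEnd, ofEnd, RingHom.id_apply, TensorProduct.smul_tmul', TensorProduct.smul_tmul,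
      ← endOfMap_smul]; rfl

theorem endFormL_apply (φ : F →L[ℝ] F) :
    endFormL 𝕂 E F  φ = ofEnd (endOfMap φ) := rfl

variable (E F) in
/-- The endomorphism-valued one-form of a linear map, depending linearly on it. -/
def connFormL : (E →L[ℝ] F →L[ℝ] F) →ₗ[ℝ] EndFormAlg 𝕂 E F :=
  ∑ i, (LinearMap.mulLeft ℝ ((endFormData 𝕂 E F).gen i) ∘ₗ endFormL 𝕂 E F) ∘ₗ
    (ContinuousLinearMap.apply ℝ (F →L[ℝ] F) (vecBasis E i)).toLinearMap

theorem gen_mul_ofEnd (i : Fin (finrank ℝ E)) (a : End 𝕂 F) :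
    (endFormData 𝕂 E F).gen i * ofEnd a = oneForm (covec E i) ⊗ₜ a := by
  change (oneForm (covec E i) ⊗ₜ[𝕂] 1) * (1 ⊗ₜ a) = _
  rw [Algebra.TensorProduct.tmul_mul_tmul, mul_one, one_mul]

theorem connFormL_eq_sum (A : E →L[ℝ] F →L[ℝ] F) :
    connFormL 𝕂 E F A = ∑ i, (endFormData 𝕂 E F).gen i * endFormL 𝕂 E F (A (vecBasis E i)) := by
  simp [connFormL]

theorem connFormL_apply (A : E →L[ℝ] F →L[ℝ] F) :
    connFormL 𝕂 E F A = endOneForm fun v w => A v w := by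
  rw [connFormL_eq_sum, endOneForm]
  exact Finset.sum_congr rfl fun i _ => gen_mul_ofEnd 𝕂 i _

theorem connFormL_mem (A : E →L[ℝ] F →L[ℝ] F) :
    connFormL 𝕂 E F A ∈ (endFormData 𝕂 E F).genIdeal :=
  ⟨_, connFormL_eq_sum 𝕂 A⟩

theorem inv_endFormL (φ : F →L[ℝ] F) :
    (endFormData 𝕂 E F).inv (endFormL 𝕂 E F φ) = endFormL 𝕂 E F φ := by
  change involuteEnd 𝕂 E F (_ ⊗ₜ _) = _
  rw [involuteEnd_tmul, map_one]; rfl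

theorem inv_connFormL (A : E →L[ℝ] F →L[ℝ] F) :
    (endFormData 𝕂 E F).inv (connFormL 𝕂 E F A) = -connFormL 𝕂 E F A := by
  simp only [connFormL_eq_sum, map_sum, map_mul, inv_endFormL, (endFormData 𝕂 E F).inv_gen,
    neg_mul, Finset.sum_neg_distrib]

variable {S : Set E} {y : E}

instance bilinNormedAddCommGroup : NormedAddCommGroup (E →L[ℝ] F →L[ℝ] F) :=
  ContinuousLinearMap.toNormedAddCommGroup

instance bilinNormedSpace : NormedSpace ℝ (E →L[ℝ] F →L[ℝ] F) :=
  ContinuousLinearMap.toNormedSpace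

theorem connectionPath_connFormL {A B : E → E →L[ℝ] F →L[ℝ] F}
    (hA : ContDiffWithinAt ℝ ∞ A S y) (hB : ContDiffWithinAt ℝ ∞ B S y) :
    ConnectionPath (endFormData 𝕂 E F) (endFormData 𝕂 E F).genIdeal S y
      (fun z => connFormL 𝕂 E F (A z)) (fun z => connFormL 𝕂 E F (B z)) where
  smooth := contDiffWithinAt_linear_comp (N := EndFormAlg 𝕂 E F) (connFormL 𝕂 E F) hA
  smooth' := contDiffWithinAt_linear_comp (N := EndFormAlg 𝕂 E F) (connFormL 𝕂 E F) hB
  odd _ := inv_connFormL 𝕂 _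
  odd' _ := inv_connFormL 𝕂 _
  mem _ := connFormL_mem 𝕂 _
  mem' _ := connFormL_mem 𝕂 _

/-- The curvature `∂ᵤ A_v - ∂ᵥ A_u + [A_u, A_v]` of a connection form. -/
def flatCurvature (A : E → E →L[ℝ] F →L[ℝ] F) (S : Set E) (y u v : E) (w : F) : F :=
  fderivWithin ℝ A S y u v w - fderivWithin ℝ A S y v u w + (A y u (A y v w) - A y v (A y u w))

theorem curv_connFormL (hS : UniqueDiffWithinAt ℝ S y) {A : E → E →L[ℝ] F →L[ℝ] F}
    (hA : DifferentiableWithinAt ℝ A S y) (hlin : ∀ v, ∃ φ : End 𝕂 F, ∀ w, A y v w = φ w) :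
    (endFormData 𝕂 E F).curv (vecBasis E) S (fun z => connFormL 𝕂 E F (A z)) y
      = endTwoForm (flatCurvature A S y) := by
  have h1 : ∀ (i j : Fin (finrank ℝ E)) (a : End 𝕂 F), (endFormData 𝕂 E F).gen i *
      (oneForm (covec E j) ⊗ₜ[𝕂] a)
      = (oneForm (covec E i) * oneForm (covec E j)) ⊗ₜ[𝕂] a := fun i j a => by
    change (oneForm (covec E i) ⊗ₜ[𝕂] 1) * _ = _
    rw [Algebra.TensorProduct.tmul_mul_tmul, one_mul]
  have h2 : (endFormData 𝕂 E F).curv (vecBasis E) S (fun z => connFormL 𝕂 E F (A z)) y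
      = ∑ i, ∑ j, (oneForm (covec E i) * oneForm (covec E j)) ⊗ₜ[𝕂]
        endOfMap (fun w => fderivWithin ℝ A S y (vecBasis E i) (vecBasis E j) w
          + A y (vecBasis E i) (A y (vecBasis E j) w)) := by
    have hd := fderivWithin_linear_comp (N := EndFormAlg 𝕂 E F) (connFormL 𝕂 E F ) hS hA
    simp only [FormData.curv, FormData.d, hd]
    simp only [connFormL_apply, endOneForm]
    rw [Finset.sum_mul_sum]
    simp only [Finset.mul_sum, h1, ← Finset.sum_add_distrib,
      Algebra.TensorProduct.tmul_mul_tmul, ← TensorProduct.tmul_add]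
    refine Finset.sum_congr rfl fun i _ => Finset.sum_congr rfl fun j _ => ?_
    rw [endOfMap_add 𝕂 (fun w => fderivWithin ℝ A S y (vecBasis E i) (vecBasis E j) w)
      (fun w => A y (vecBasis E i) (A y (vecBasis E j) w)),
      endOfMap_comp 𝕂 (hlin (vecBasis E i)) (fun w => A y (vecBasis E j) w)]
  rw [h2, sum_mul_tmul_eq_sum_lt, endTwoForm]
  refine Finset.sum_congr rfl fun i _ => Finset.sum_congr rfl fun j _ => ?_
  rw [← endOfMap_sub]
  split_ifs
  · congr 2
    funext w
    simp only [flatCurvature]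
    abel
  · rfl

theorem covD_endFormL (hS : UniqueDiffWithinAt ℝ S y) {A : E → E →L[ℝ] F →L[ℝ] F}
    {γ : E → F →L[ℝ] F} (hγ : DifferentiableWithinAt ℝ γ S y)
    (hlin : ∀ v, ∃ φ : End 𝕂 F, ∀ w, A y v w = φ w) (hlin' : ∃ φ : End 𝕂 F, ∀ w, γ y w = φ w)
    (hpar : ∀ v w, fderivWithin ℝ γ S y v w + A y v (γ y w) - γ y (A y v w) = 0) :
    (endFormData 𝕂 E F).covD (vecBasis E) (S := S) (fun z => connFormL 𝕂 E F (A z))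
      (fun z => endFormL 𝕂 E F (γ z)) y = 0 := by
  have h1 : ∀ (i : Fin (finrank ℝ E)) (a b : End 𝕂 F),
      (oneForm (covec E i) ⊗ₜ[𝕂] a) * ofEnd b = oneForm (covec E i) ⊗ₜ[𝕂] (a * b) := fun i a b => by
    rw [ofEnd, Algebra.TensorProduct.tmul_mul_tmul, mul_one]
  have h2 : ∀ (i : Fin (finrank ℝ E)) (a b : End 𝕂 F),
      ofEnd a * (oneForm (covec E i) ⊗ₜ[𝕂] b) = oneForm (covec E i) ⊗ₜ[𝕂] (a * b) := fun i a b => by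
    rw [ofEnd, Algebra.TensorProduct.tmul_mul_tmul, one_mul]
  rw [FormData.covD, inv_endFormL]
  have hd := fderivWithin_linear_comp (N := EndFormAlg 𝕂 E F) (endFormL 𝕂 E F ) hS hγ
  simp only [FormData.d, hd]
  simp only [connFormL_apply, endOneForm, endFormL_apply, gen_mul_ofEnd, Finset.sum_mul, Finset.mul_sum, h1, h2,
    ← Finset.sum_add_distrib, ← Finset.sum_sub_distrib, ← TensorProduct.tmul_add,
    ← TensorProduct.tmul_sub]
  refine Finset.sum_eq_zero fun i _ => ?_
  rw [← endOfMap_comp 𝕂 (hlin _), ← endOfMap_comp 𝕂 hlin', ← endOfMap_add, ← endOfMap_sub]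
  rw [show (fun w => fderivWithin ℝ γ S y (vecBasis E i) w + A y (vecBasis E i) (γ y w)
    - γ y (A y (vecBasis E i) w)) = fun w => ((0 : End 𝕂 F) w) from funext fun w => hpar _ w,
    endOfMap_linear, TensorProduct.tmul_zero]

theorem parallelEnd_endFormL {A B : E → E →L[ℝ] F →L[ℝ] F} {γ : E → F →L[ℝ] F}
    (hS : UniqueDiffOn ℝ S) (hγ : ContDiffWithinAt ℝ ∞ γ S y) (hy : y ∈ S)
    (hlin : ∀ᶠ z in 𝓝[S] y, ∀ v, ∃ φ : End 𝕂 F, ∀ w, A z v w = φ w)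
    (hlin' : ∀ᶠ z in 𝓝[S] y, ∀ v, ∃ φ : End 𝕂 F, ∀ w, B z v w = φ w)
    (hlinγ : ∀ᶠ z in 𝓝[S] y, ∃ φ : End 𝕂 F, ∀ w, γ z w = φ w)
    (hpar : ∀ᶠ z in 𝓝[S] y, ∀ v w,
      fderivWithin ℝ γ S z v w + A z v (γ z w) - γ z (A z v w) = 0)
    (hpar' : ∀ᶠ z in 𝓝[S] y, ∀ v w,
      fderivWithin ℝ γ S z v w + B z v (γ z w) - γ z (B z v w) = 0) :
    ParallelEnd (endFormData 𝕂 E F) (vecBasis E) S y (fun z => connFormL 𝕂 E F (A z))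
      (fun z => connFormL 𝕂 E F (B z - A z)) (fun z => endFormL 𝕂 E F (γ z)) := by
  have hdiff : ∀ᶠ z in 𝓝[S] y, DifferentiableWithinAt ℝ γ S z := by
    have h := (hγ.of_le (m := 1) (by simp)).eventually (by simp)
    rw [Set.insert_eq_of_mem hy] at h
    exact h.mono fun z hz => hz.differentiableWithinAt (by simp)
  refine ⟨contDiffWithinAt_linear_comp (N := EndFormAlg 𝕂 E F) (endFormL 𝕂 E F) hγ,
    fun z => inv_endFormL 𝕂 _, ?_, ?_⟩
  · filter_upwards [hlin, hlinγ, hpar, hdiff, self_mem_nhdsWithin] with z h1 h2 h3 h4 h5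
    exact covD_endFormL 𝕂 (hS z h5) h4 h1 h2 h3
  · filter_upwards [hlin', hlinγ, hpar', hdiff, self_mem_nhdsWithin] with z h1 h2 h3 h4 h5
    simp only [← map_add, add_sub_cancel]
    exact covD_endFormL 𝕂 (hS z h5) h4 h1 h2 h3

end ConnectionForms

/-! ### The determinant of `1 - γ` -/

section Determinant

variable {E : Type*} [NormedAddCommGroup E] [NormedSpace ℝ E] [FiniteDimensional ℝ E]
  {F : Type*} [NormedAddCommGroup F] [NormedSpace ℝ F] [FiniteDimensional ℝ F]

theorem contDiff_det :
    ContDiff ℝ ∞ (fun φ : F →L[ℝ] F => LinearMap.det (φ : F →ₗ[ℝ] F)) := by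
  have h : (fun φ : F →L[ℝ] F => LinearMap.det (φ : F →ₗ[ℝ] F))
      = fun φ => ∑ σ : Equiv.Perm (Fin (finrank ℝ F)), Equiv.Perm.sign σ •
        ∏ i, (finBasis ℝ F).repr (φ (finBasis ℝ F i)) (σ i) := by
    funext φ
    rw [← LinearMap.det_toMatrix (finBasis ℝ F), Matrix.det_apply]
    simp only [LinearMap.toMatrix_apply]
    rfl
  rw [h]
  refine ContDiff.sum fun σ _ => ContDiff.const_smul _ (contDiff_prod fun i _ => ?_)
  exact (LinearMap.toContinuousLinearMap (((finBasis ℝ F).coord (σ i)).comp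
    (ContinuousLinearMap.apply ℝ F (finBasis ℝ F i)).toLinearMap)).contDiff

theorem fderiv_det_commutator (M A : F →L[ℝ] F) :
    fderiv ℝ (fun φ : F →L[ℝ] F => LinearMap.det (φ : F →ₗ[ℝ] F)) M (M * A - A * M) = 0 := by
  set g : (F →L[ℝ] F) → ℝ := fun φ => LinearMap.det (φ : F →ₗ[ℝ] F) with hg
  have hgd : ∀ φ, DifferentiableAt ℝ g φ := fun φ =>
    (contDiff_det.differentiable (by simp)) φ
  have hgmul : ∀ φ ψ, g (φ * ψ) = g φ * g ψ := fun φ ψ => by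
    simp only [hg]
    exact LinearMap.det_comp _ _
  have hc : HasDerivAt (fun t : ℝ => (1 - t • A) * M * (1 + t • A)) (M * A - A * M) 0 := by
    have hA : HasDerivAt (fun t : ℝ => t • A) A 0 := by
      simpa using (hasDerivAt_id (0 : ℝ)).smul_const A
    have h := ((hA.const_sub 1).mul_const M).mul (hA.const_add 1)
    refine HasDerivAt.congr_deriv h ?_
    simp
    abel
  have h1 : HasDerivAt (fun t : ℝ => g ((1 - t • A) * M * (1 + t • A)))
      (fderiv ℝ g M (M * A - A * M)) 0 := by
    have h := ((hgd ((1 - (0 : ℝ) • A) * M * (1 + (0 : ℝ) • A))).hasFDerivAt).comp_hasDerivAt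
      (0 : ℝ) hc
    simpa [Function.comp_def] using h
  have hs : HasDerivAt (fun t : ℝ => 1 - (t ^ 2) • (A * A)) 0 0 := by
    have h := (((hasDerivAt_id (0 : ℝ)).pow 2).smul_const (A * A)).const_sub 1
    simpa using h
  have h2 : HasDerivAt (fun t : ℝ => g (1 - (t ^ 2) • (A * A)) * g M) 0 0 := by
    have h := ((hgd (1 - ((0 : ℝ) ^ 2) • (A * A))).hasFDerivAt.comp_hasDerivAt (0 : ℝ) hs).mul_const
      (g M)
    simpa [Function.comp_def] using h
  have h3 : (fun t : ℝ => g ((1 - t • A) * M * (1 + t • A)))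
      = fun t : ℝ => g (1 - (t ^ 2) • (A * A)) * g M := by
    funext t
    have h4 : (1 - (t ^ 2) • (A * A)) = (1 - t • A) * (1 + t • A) := by
      have h5 : (t ^ 2) • (A * A) = (t • A) * (t • A) := by rw [smul_mul_smul_comm, sq]
      rw [h5]
      simp only [mul_add, sub_mul, mul_one, one_mul]
      abel
    rw [hgmul, hgmul, h4, hgmul]
    ring
  rw [h3] at h1
  exact h1.unique h2

variable {S : Set E} {y : E} {γ : E → F →L[ℝ] F}

theorem contDiffWithinAt_inv_sqrt_det (hγ : ContDiffWithinAt ℝ ∞ γ S y)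
    (hpos : 0 < LinearMap.det ((1 - γ y : F →L[ℝ] F) : F →ₗ[ℝ] F)) :
    ContDiffWithinAt ℝ ∞
      (fun z => (Real.sqrt (LinearMap.det ((1 - γ z : F →L[ℝ] F) : F →ₗ[ℝ] F)))⁻¹) S y := by
  have h1 : ContDiffWithinAt ℝ ∞
      (fun z => LinearMap.det ((1 - γ z : F →L[ℝ] F) : F →ₗ[ℝ] F)) S y :=
    contDiff_det.comp_contDiffWithinAt (contDiffWithinAt_const.sub hγ)
  exact (h1.sqrt hpos.ne').inv (Real.sqrt_pos.2 hpos).ne'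

theorem fderivWithin_inv_sqrt_det (hS : UniqueDiffWithinAt ℝ S y)
    (hγ : DifferentiableWithinAt ℝ γ S y)
    (hpos : 0 < LinearMap.det ((1 - γ y : F →L[ℝ] F) : F →ₗ[ℝ] F))
    {A : E → F →L[ℝ] F} (hpar : ∀ v, fderivWithin ℝ γ S y v = γ y * A v - A v * γ y) :
    fderivWithin ℝ
      (fun z => (Real.sqrt (LinearMap.det ((1 - γ z : F →L[ℝ] F) : F →ₗ[ℝ] F)))⁻¹) S y = 0 := by
  set g : (F →L[ℝ] F) → ℝ := fun φ => LinearMap.det (φ : F →ₗ[ℝ] F) with hg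
  have hgd : DifferentiableAt ℝ g (1 - γ y) := (contDiff_det.differentiable (by simp)) _
  have h1 : HasFDerivWithinAt (fun z => g (1 - γ z))
      ((fderiv ℝ g (1 - γ y)).comp (-fderivWithin ℝ γ S y)) S y :=
    HasFDerivAt.comp_hasFDerivWithinAt (g := g) (f := fun z => 1 - γ z) y hgd.hasFDerivAt
      (hγ.hasFDerivWithinAt.const_sub 1)
  have h2 : (fderiv ℝ g (1 - γ y)).comp (-fderivWithin ℝ γ S y) = 0 := by
    ext v
    have h3 : -(γ y * A v - A v * γ y) = (1 - γ y) * A v - A v * (1 - γ y) := by noncomm_ring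
    simp only [ContinuousLinearMap.comp_apply, neg_apply, hpar, h3,
      zero_apply]
    exact fderiv_det_commutator _ _
  rw [h2] at h1
  have h4 := ((hasDerivAt_inv (Real.sqrt_pos.2 hpos).ne').comp_hasFDerivWithinAt y
    (h1.sqrt hpos.ne')).fderivWithin hS
  simp only [Function.comp_def, smul_zero] at h4
  exact h4

end Determinant

/-! ### Local sections and the connection matrix -/

section LocalSections

variable {E : Type*} [NormedAddCommGroup E] [NormedSpace ℝ E] [FiniteDimensional ℝ E]
  {H : Type*} [TopologicalSpace H] {I : ModelWithCorners ℝ E H}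
  {X : Type*} [TopologicalSpace X] [ChartedSpace H X] [IsManifold I ∞ X]
  {F : Type*} [NormedAddCommGroup F] [NormedSpace ℝ F] [FiniteDimensional ℝ F]
  {V : X → Type*} [TopologicalSpace (TotalSpace F V)]
  [∀ x, AddCommGroup (V x)] [∀ x, Module ℝ (V x)] [∀ x, TopologicalSpace (V x)]
  [∀ x, IsTopologicalAddGroup (V x)] [∀ x, ContinuousSMul ℝ (V x)] [FiberBundle F V]
  [VectorBundle ℝ F V] [ContMDiffVectorBundle ∞ F V I]

variable (I F) in
/-- The section `σ` is smooth in a neighbourhood of `x`. -/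
def SmoothNear (σ : Π x, V x) (x : X) : Prop :=
  ∀ᶠ z in 𝓝 x, ContMDiffAt I (I.prod 𝓘(ℝ, F)) ∞ (fun x => TotalSpace.mk' F x (σ x)) z

theorem SmoothNear.contMDiffAt {σ : Π x, V x} {x : X} (h : SmoothNear I F σ x) :
    ContMDiffAt I (I.prod 𝓘(ℝ, F)) ∞ (fun x => TotalSpace.mk' F x (σ x)) x :=
  Eventually.self_of_nhds h

theorem SmoothNear.mdifferentiableAt {σ : Π x, V x} {x : X} (h : SmoothNear I F σ x) :
    MDifferentiableAt I (I.prod 𝓘(ℝ, F)) (fun x => TotalSpace.mk' F x (σ x)) x :=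
  h.contMDiffAt.mdifferentiableAt (by simp)

theorem SmoothNear.eventually {σ : Π x, V x} {x : X} (h : SmoothNear I F σ x) :
    ∀ᶠ z in 𝓝 x, SmoothNear I F σ z :=
  eventually_eventually_nhds.2 h

theorem smoothNear_extend {x : X} (w : V x) : SmoothNear I F (FiberBundle.extend F w) x := by
  obtain ⟨s, hs, h⟩ := FiberBundle.exists_contMDiffOn_extend (k := ∞) I F w
  exact (eventually_mem_nhds_iff.2 hs).mono fun z hz => h.contMDiffAt hz

/-- The section which is constant in the trivialization at `x₀`. -/
def localSec (V : X → Type*) [TopologicalSpace (TotalSpace F V)]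
    [∀ x, AddCommGroup (V x)] [∀ x, Module ℝ (V x)] [∀ x, TopologicalSpace (V x)]
    [FiberBundle F V] [VectorBundle ℝ F V] (x₀ : X) (w : F) (x : X) : V x :=
  (trivializationAt F V x₀).symmL ℝ x w

theorem smoothNear_localSec {x₀ x : X} (hx : x ∈ (trivializationAt F V x₀).baseSet) (w : F) :
    SmoothNear I F (localSec V x₀ w) x := by
  have h : ContMDiffOn I (I.prod 𝓘(ℝ, F)) ∞
      (fun x => TotalSpace.mk' F x (localSec V x₀ w x)) (trivializationAt F V x₀).baseSet := by
    rw [(trivializationAt F V x₀).contMDiffOn_section_baseSet_iff]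
    refine (contMDiffOn_const (c := w)).congr fun z hz => ?_
    rw [localSec, (trivializationAt F V x₀).symmL_apply hz,
      (trivializationAt F V x₀).apply_mk_symm hz]
  filter_upwards [(trivializationAt F V x₀).open_baseSet.mem_nhds hx] with z hz
  exact h.contMDiffAt ((trivializationAt F V x₀).open_baseSet.mem_nhds hz)

theorem exists_contMDiff_eventuallyEq [T2Space X] {σ : Π x, V x} {x : X}
    (h : SmoothNear I F σ x) :
    ∃ σ' : Π x, V x, ContMDiff I (I.prod 𝓘(ℝ, F)) ∞ (fun x => TotalSpace.mk' F x (σ' x)) ∧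
      ∀ᶠ z in 𝓝 x, σ' z = σ z := by
  obtain ⟨U, hU, hUo, hx⟩ := eventually_nhds_iff.1 h
  obtain ⟨f, -, hf⟩ := (SmoothBumpFunction.nhds_basis_tsupport (I := I) x).mem_iff.1
    (hUo.mem_nhds hx)
  refine ⟨fun z => f z • σ z, ?_, ?_⟩
  · exact ContMDiffOn.smul_section_of_tsupport f.contMDiff.contMDiffOn hUo hf
      fun z hz => (hU z hz).contMDiffWithinAt
  · filter_upwards [f.eventuallyEq_one] with z hz
    simp [hz]

variable [T2Space X] (cov : CovariantDerivative I F V)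

theorem cov_congr {cov : CovariantDerivative I F V} {σ σ' : Π x, V x} {x : X}
    (h : MDifferentiableAt I (I.prod 𝓘(ℝ, F)) (fun x => TotalSpace.mk' F x (σ x)) x)
    (h' : MDifferentiableAt I (I.prod 𝓘(ℝ, F)) (fun x => TotalSpace.mk' F x (σ' x)) x)
    (heq : ∀ᶠ z in 𝓝 x, σ z = σ' z) : cov σ x = cov σ' x :=
  cov.isCovariantDerivativeOn.congr_of_eventuallyEq h h' univ_mem heq

variable {cov}

theorem contMDiffAt_cov (hcov : cov.ContMDiffCovariantDerivative ∞) {σ : Π x, V x} {x : X}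
    (h : SmoothNear I F σ x) :
    ContMDiffAt I (I.prod 𝓘(ℝ, E →L[ℝ] F)) ∞
      (fun x => TotalSpace.mk' (E →L[ℝ] F) (E := fun x => TangentSpace I x →L[ℝ] V x) x (cov σ x))
      x := by
  obtain ⟨σ', hσ', heq⟩ := exists_contMDiff_eventuallyEq h
  have h1 := (hcov.contMDiff.contMDiff (σ := σ') (by simpa using hσ'.contMDiffOn)).contMDiffAt
    (x := x) univ_mem
  refine h1.congr_of_eventuallyEq ?_
  filter_upwards [eventually_eventually_nhds.2 heq, h] with z hz hz'
  congr 1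
  exact cov_congr (hz'.mdifferentiableAt (by simp))
    (hσ'.contMDiffAt.mdifferentiableAt (by simp)) (hz.mono fun _ h => h.symm)

theorem smoothNear_cov_apply (hcov : cov.ContMDiffCovariantDerivative ∞) {σ : Π x, V x} {x : X}
    (h : SmoothNear I F σ x) {U : Π x : X, TangentSpace I x} (hU : SmoothNear I E U x) :
    SmoothNear I F (fun z => cov σ z (U z)) x := by
  filter_upwards [h.eventually, hU] with z hz hUz
  exact (contMDiffAt_cov hcov hz).clm_bundle_apply hUz

section Endomorphisms

variable {𝕂 : Type*} [Field 𝕂] [Algebra 𝕂 ℂ] [∀ x, Module 𝕂 (V x)] {a : Π x, Module.End 𝕂 (V x)}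

theorem IsSmoothEnd.smoothNear (ha : IsSmoothEnd 𝕂 I F a) {σ : Π x, V x} {x : X}
    (h : SmoothNear I F σ x) : SmoothNear I F (fun z => a z (σ z)) x := by
  obtain ⟨σ', hσ', heq⟩ := exists_contMDiff_eventuallyEq h
  filter_upwards [eventually_eventually_nhds.2 heq] with z hz
  refine (ha σ' hσ').contMDiffAt.congr_of_eventuallyEq (hz.mono fun y hy => ?_)
  simp only [hy]

theorem Preserves.cov_apply (ha : IsSmoothEnd 𝕂 I F a) (hp : Preserves a cov)
    {σ : Π x, V x} {x : X} (h : SmoothNear I F σ x) (v : TangentSpace I x) :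
    cov (fun z => a z (σ z)) x v = a x (cov σ x v) := by
  obtain ⟨σ', hσ', heq⟩ := exists_contMDiff_eventuallyEq h
  rw [← cov_congr (hσ'.contMDiffAt.mdifferentiableAt (by simp)) h.mdifferentiableAt heq,
    ← hp σ' hσ' x v]
  refine congrArg (fun f => f v) (cov_congr (ha.smoothNear h).mdifferentiableAt
    ((ha σ' hσ').contMDiffAt.mdifferentiableAt (by simp)) (heq.mono fun y hy => ?_))
  rw [hy]

end Endomorphisms

end LocalSections

/-! ### Connections in a chart and a trivialization -/

section InChart

variable {E : Type*} [NormedAddCommGroup E] [NormedSpace ℝ E] [FiniteDimensional ℝ E]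
  {H : Type*} [TopologicalSpace H] {I : ModelWithCorners ℝ E H}
  {X : Type*} [TopologicalSpace X] [ChartedSpace H X] [IsManifold I ∞ X]
  {F : Type*} [NormedAddCommGroup F] [NormedSpace ℝ F] [FiniteDimensional ℝ F]
  {V : X → Type*} [TopologicalSpace (TotalSpace F V)]
  [∀ x, AddCommGroup (V x)] [∀ x, Module ℝ (V x)] [∀ x, TopologicalSpace (V x)]
  [∀ x, IsTopologicalAddGroup (V x)] [∀ x, ContinuousSMul ℝ (V x)] [FiberBundle F V]
  [VectorBundle ℝ F V] [ContMDiffVectorBundle ∞ F V I]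

variable (I F V) in
/-- The part of the chart at `x₀` over which the bundle is trivialized. -/
def chartDomain (x₀ : X) : Set E :=
  (extChartAt I x₀).target ∩ (extChartAt I x₀).symm ⁻¹' (trivializationAt F V x₀).baseSet

variable (I) in
/-- The frame of the tangent bundle that is given by the chart at `x₀`. -/
def chartFrame (x₀ : X) (y : E) : E →L[ℝ] TangentSpace I ((extChartAt I x₀).symm y) :=
  mfderivWithin 𝓘(ℝ, E) I (extChartAt I x₀).symm (Set.range I) y

variable (I F) in
/-- A section, read in the chart and the trivialization at `x₀`. -/
def readSec (x₀ : X) (σ : Π x, V x) (y : E) : F :=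
  (trivializationAt F V x₀).continuousLinearMapAt ℝ ((extChartAt I x₀).symm y)
    (σ ((extChartAt I x₀).symm y))

/-- The connection form in the chart and the trivialization at `x₀`. -/
def connMatrix (cov : CovariantDerivative I F V) (x₀ : X) (y : E) : E →L[ℝ] F →L[ℝ] F :=
  ∑ a, (ContinuousLinearMap.smulRightL ℝ F F
      (LinearMap.toContinuousLinearMap ((finBasis ℝ F).coord a))).comp
    (((trivializationAt F V x₀).continuousLinearMapAt ℝ ((extChartAt I x₀).symm y)).comp
      ((cov (localSec V x₀ (finBasis ℝ F a)) ((extChartAt I x₀).symm y)).comp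
        (chartFrame I x₀ y)))

theorem connMatrix_apply (cov : CovariantDerivative I F V) (x₀ : X) (y v : E) (w : F) :
    connMatrix cov x₀ y v w = ∑ a, (finBasis ℝ F).coord a w •
      (trivializationAt F V x₀).continuousLinearMapAt ℝ ((extChartAt I x₀).symm y)
        (cov (localSec V x₀ (finBasis ℝ F a)) ((extChartAt I x₀).symm y) (chartFrame I x₀ y v)) := by
  simp only [connMatrix, sum_apply, ContinuousLinearMap.comp_apply]
  rfl

theorem connMatrix_pathConn (cov cov' : CovariantDerivative I F V) (x₀ : X) (y : E) (s : ℝ) :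
    connMatrix (pathConn cov cov' s) x₀ y
      = connMatrix cov x₀ y + s • (connMatrix cov' x₀ y - connMatrix cov x₀ y) := by
  ext v w
  simp only [connMatrix_apply, add_apply, smul_apply, sub_apply,
    ← Finset.sum_sub_distrib, Finset.smul_sum, ← Finset.sum_add_distrib]
  refine Finset.sum_congr rfl fun a _ => ?_
  have h : pathConn cov cov' s (localSec V x₀ (finBasis ℝ F a)) ((extChartAt I x₀).symm y)
      (chartFrame I x₀ y v) = s • cov' (localSec V x₀ (finBasis ℝ F a)) ((extChartAt I x₀).symm y)
      (chartFrame I x₀ y v) + (1 - s) • cov (localSec V x₀ (finBasis ℝ F a))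
        ((extChartAt I x₀).symm y) (chartFrame I x₀ y v) := rfl
  rw [h, map_add, map_smul, map_smul]
  module

variable {x₀ : X} {y : E}

theorem mem_chartDomain_self : extChartAt I x₀ x₀ ∈ chartDomain I F V x₀ :=
  ⟨mem_extChartAt_target x₀, by
    rw [Set.mem_preimage, extChartAt_to_inv]
    exact FiberBundle.mem_baseSet_trivializationAt' x₀⟩

theorem eventually_chart_symm (hy : y ∈ (extChartAt I x₀).target) {P : X → Prop}
    (h : ∀ᶠ z in 𝓝 ((extChartAt I x₀).symm y), P z) :
    ∀ᶠ y' in 𝓝[Set.range I] y, P ((extChartAt I x₀).symm y') :=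
  (contMDiffWithinAt_extChartAt_symm_range (n := ∞) x₀ hy).continuousWithinAt.eventually h

theorem chartDomain_mem_nhdsWithin (hy : y ∈ chartDomain I F V x₀) :
    chartDomain I F V x₀ ∈ 𝓝[Set.range I] y :=
  inter_mem (extChartAt_target_mem_nhdsWithin_of_mem hy.1)
    (eventually_chart_symm hy.1 ((trivializationAt F V x₀).open_baseSet.mem_nhds hy.2))

theorem chart_symm_chart : (extChartAt I x₀).symm (extChartAt I x₀ x₀) = x₀ :=
  extChartAt_to_inv x₀

theorem uniqueDiffWithinAt_of_mem_chartDomain (hy : y ∈ chartDomain I F V x₀) :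
    UniqueDiffWithinAt ℝ (Set.range I) y :=
  I.uniqueDiffOn y (extChartAt_target_subset_range x₀ hy.1)

theorem readSec_eq (hy : y ∈ chartDomain I F V x₀) (σ : Π x, V x) :
    readSec I F x₀ σ y = (trivializationAt F V x₀ ⟨(extChartAt I x₀).symm y,
      σ ((extChartAt I x₀).symm y)⟩).2 :=
  (trivializationAt F V x₀).continuousLinearMapAt_apply_of_mem ℝ hy.2 _

theorem readSec_localSec (hy : y ∈ chartDomain I F V x₀) (w : F) :
    readSec I F x₀ (localSec V x₀ w) y = w :=
  (trivializationAt F V x₀).continuousLinearMapAt_symmL hy.2 w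

theorem contDiffWithinAt_readSec (hy : y ∈ chartDomain I F V x₀) {σ : Π x, V x}
    (h : ContMDiffAt I (I.prod 𝓘(ℝ, F)) ∞ (fun x => TotalSpace.mk' F x (σ x))
      ((extChartAt I x₀).symm y)) :
    ContDiffWithinAt ℝ ∞ (readSec I F x₀ σ) (Set.range I) y := by
  have h1 := ((trivializationAt F V x₀).contMDiffAt_section_iff hy.2).1 h
  have h2 := h1.comp_contMDiffWithinAt y (contMDiffWithinAt_extChartAt_symm_range x₀ hy.1)
  refine h2.contDiffWithinAt.congr_of_eventuallyEq ?_ (readSec_eq hy σ)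
  filter_upwards [chartDomain_mem_nhdsWithin hy] with z hz
  exact readSec_eq hz σ

theorem differentiableWithinAt_readSec (hy : y ∈ chartDomain I F V x₀) {σ : Π x, V x}
    (h : MDifferentiableAt I (I.prod 𝓘(ℝ, F)) (fun x => TotalSpace.mk' F x (σ x))
      ((extChartAt I x₀).symm y)) :
    DifferentiableWithinAt ℝ (readSec I F x₀ σ) (Set.range I) y := by
  have : ContMDiffVectorBundle 1 F V I := ContMDiffVectorBundle.of_le (n := ∞) (by simp)
  have h1 := ((trivializationAt F V x₀).mdifferentiableAt_section_iff I σ hy.2).1 h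
  have h2 := h1.comp_mdifferentiableWithinAt y
    ((contMDiffWithinAt_extChartAt_symm_range (n := 1) x₀ hy.1).mdifferentiableWithinAt (by simp))
  refine h2.differentiableWithinAt.congr_of_eventuallyEq ?_ (readSec_eq hy σ)
  filter_upwards [chartDomain_mem_nhdsWithin hy] with z hz
  exact readSec_eq hz σ

theorem mvfderiv_chartFrame (hy : y ∈ (extChartAt I x₀).target) {g : X → ℝ}
    (hg : MDifferentiableAt I 𝓘(ℝ, ℝ) g ((extChartAt I x₀).symm y)) (v : E) :
    mvfderiv I g ((extChartAt I x₀).symm y) (chartFrame I x₀ y v)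
      = fderivWithin ℝ (fun y' => g ((extChartAt I x₀).symm y')) (Set.range I) y v := by
  have h := mfderiv_comp_mfderivWithin y hg
    ((contMDiffWithinAt_extChartAt_symm_range (n := 1) x₀ hy).mdifferentiableWithinAt (by simp))
    (I.uniqueMDiffOn _ (extChartAt_target_subset_range x₀ hy))
  rw [mfderivWithin_eq_fderivWithin] at h
  exact (congrArg (fun f : E →L[ℝ] ℝ => f v) h).symm

theorem cov_sum {cov : CovariantDerivative I F V} {x : X} {ι : Type*} (s : Finset ι)
    (g : ι → X → ℝ) (f : ι → Π x, V x)
    (hg : ∀ i ∈ s, MDifferentiableAt I 𝓘(ℝ, ℝ) (g i) x)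
    (hf : ∀ i ∈ s, MDifferentiableAt I (I.prod 𝓘(ℝ, F)) (fun x => TotalSpace.mk' F x (f i x)) x) :
    MDifferentiableAt I (I.prod 𝓘(ℝ, F))
      (fun x => TotalSpace.mk' F x ((∑ i ∈ s, g i • f i) x)) x ∧
    cov (∑ i ∈ s, g i • f i) x
      = ∑ i ∈ s, (g i x • cov (f i) x + (mvfderiv I (g i) x).smulRight (f i x)) := by
  classical
  induction s using Finset.induction_on with
  | empty =>
    refine ⟨mdifferentiableAt_zeroSection (IB := I) (F := F) ℝ V, ?_⟩
    simp
  | insert i s hi ih =>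
    obtain ⟨h1, h2⟩ := ih (fun j hj => hg j (Finset.mem_insert_of_mem hj))
      (fun j hj => hf j (Finset.mem_insert_of_mem hj))
    have h3 : MDifferentiableAt I (I.prod 𝓘(ℝ, F))
        (fun x => TotalSpace.mk' F x ((g i • f i) x)) x :=
      (hg i (Finset.mem_insert_self i s)).smul_section (hf i (Finset.mem_insert_self i s))
    rw [Finset.sum_insert hi, Finset.sum_insert hi, ← h2,
      ← cov.isCovariantDerivativeOn.leibniz (s := Set.univ) (hf i (Finset.mem_insert_self i s))
        (hg i (Finset.mem_insert_self i s)) trivial]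
    exact ⟨mdifferentiableAt_add_section h3 h1,
      cov.isCovariantDerivativeOn.add (s := Set.univ) h3 h1 trivial⟩

variable [T2Space X]

theorem readSec_cov {cov : CovariantDerivative I F V} (hy : y ∈ chartDomain I F V x₀)
    {σ : Π x, V x} (h : MDifferentiableAt I (I.prod 𝓘(ℝ, F))
      (fun x => TotalSpace.mk' F x (σ x)) ((extChartAt I x₀).symm y)) (v : E) :
    (trivializationAt F V x₀).continuousLinearMapAt ℝ ((extChartAt I x₀).symm y)
        (cov σ ((extChartAt I x₀).symm y) (chartFrame I x₀ y v))
      = fderivWithin ℝ (readSec I F x₀ σ) (Set.range I) y v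
        + connMatrix cov x₀ y v (readSec I F x₀ σ y) := by
  have : ContMDiffVectorBundle 1 F V I := ContMDiffVectorBundle.of_le (n := ∞) (by simp)
  let c : Fin (finrank ℝ F) → F →L[ℝ] ℝ := fun a => LinearMap.toContinuousLinearMap ((finBasis ℝ F).coord a)
  let g : Fin (finrank ℝ F) → X → ℝ := fun a x => c a (trivializationAt F V x₀ ⟨x, σ x⟩).2
  have hsnd : MDifferentiableAt I 𝓘(ℝ, F) (fun x => (trivializationAt F V x₀ ⟨x, σ x⟩).2) ((extChartAt I x₀).symm y) :=
    ((trivializationAt F V x₀).mdifferentiableAt_section_iff I σ hy.2).1 h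
  have hg : ∀ a, MDifferentiableAt I 𝓘(ℝ, ℝ) (g a) ((extChartAt I x₀).symm y) := fun a =>
    ((c a).differentiableAt.mdifferentiableAt).comp ((extChartAt I x₀).symm y) hsnd
  have hf : ∀ a, MDifferentiableAt I (I.prod 𝓘(ℝ, F))
      (fun x => TotalSpace.mk' F x (localSec V x₀ (finBasis ℝ F a) x)) ((extChartAt I x₀).symm y) := fun a =>
    (smoothNear_localSec hy.2 (finBasis ℝ F a)).mdifferentiableAt
  have hsum := cov_sum (cov := cov) Finset.univ g (fun a => localSec V x₀ (finBasis ℝ F a))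
    (fun a _ => hg a) (fun a _ => hf a)
  have heq : ∀ᶠ z in 𝓝 ((extChartAt I x₀).symm y), σ z = (∑ a, g a • localSec V x₀ (finBasis ℝ F a)) z := by
    filter_upwards [(trivializationAt F V x₀).open_baseSet.mem_nhds hy.2] with z hz
    have h1 : ∑ a, g a z • finBasis ℝ F a = (trivializationAt F V x₀).continuousLinearMapAt ℝ z (σ z) := by
      rw [(trivializationAt F V x₀).continuousLinearMapAt_apply_of_mem ℝ hz]
      exact (finBasis ℝ F).sum_repr _
    have h2 := (trivializationAt F V x₀).symmL_continuousLinearMapAt (R := ℝ) hz (σ z)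
    rw [← h1, map_sum] at h2
    rw [← h2, Finset.sum_apply]
    refine Finset.sum_congr rfl fun a _ => ?_
    rw [map_smul]
    rfl
  have hdiff := differentiableWithinAt_readSec hy h
  have hU := uniqueDiffWithinAt_of_mem_chartDomain hy
  rw [cov_congr h hsum.1 heq, hsum.2, connMatrix_apply, sum_apply, map_sum]
  have hterm : ∀ a, (trivializationAt F V x₀).continuousLinearMapAt ℝ ((extChartAt I x₀).symm y)
      ((g a ((extChartAt I x₀).symm y) • cov (localSec V x₀ (finBasis ℝ F a)) ((extChartAt I x₀).symm y)
        + (mvfderiv I (g a) ((extChartAt I x₀).symm y)).smulRight (localSec V x₀ (finBasis ℝ F a) ((extChartAt I x₀).symm y)))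
          (chartFrame I x₀ y v))
      = (finBasis ℝ F).coord a (fderivWithin ℝ (readSec I F x₀ σ) (Set.range I) y v) • finBasis ℝ F a
        + (finBasis ℝ F).coord a (readSec I F x₀ σ y) • (trivializationAt F V x₀).continuousLinearMapAt ℝ ((extChartAt I x₀).symm y)
          (cov (localSec V x₀ (finBasis ℝ F a)) ((extChartAt I x₀).symm y) (chartFrame I x₀ y v)) := by
    intro a
    have h1 : mvfderiv I (g a) ((extChartAt I x₀).symm y) (chartFrame I x₀ y v)
        = (finBasis ℝ F).coord a (fderivWithin ℝ (readSec I F x₀ σ) (Set.range I) y v) := by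
      rw [mvfderiv_chartFrame hy.1 (hg a)]
      have h2 : (fun y' => g a ((extChartAt I x₀).symm y')) =ᶠ[𝓝[Set.range I] y]
          fun y' => c a (readSec I F x₀ σ y') := by
        filter_upwards [chartDomain_mem_nhdsWithin hy] with z hz
        rw [readSec_eq hz]
      rw [h2.fderivWithin_eq (by rw [readSec_eq hy])]
      exact congrArg (fun f : E →L[ℝ] ℝ => f v)
        (((c a).hasFDerivAt.comp_hasFDerivWithinAt y hdiff.hasFDerivWithinAt).fderivWithin hU)
    have h3 : g a ((extChartAt I x₀).symm y) = (finBasis ℝ F).coord a (readSec I F x₀ σ y) := by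
      rw [readSec_eq hy]
      rfl
    rw [add_apply, smul_apply, ContinuousLinearMap.smulRight_apply, map_add, map_smul, map_smul,
      h1, h3]
    have h4 : (trivializationAt F V x₀).continuousLinearMapAt ℝ ((extChartAt I x₀).symm y) (localSec V x₀ (finBasis ℝ F a) ((extChartAt I x₀).symm y)) = finBasis ℝ F a :=
      readSec_localSec hy (finBasis ℝ F a)
    rw [h4, add_comm]
  rw [Finset.sum_congr rfl fun a _ => hterm a, Finset.sum_add_distrib]
  congr 1
  exact (finBasis ℝ F).sum_repr _

theorem symmL_eq_chartFrame (hy : y ∈ (extChartAt I x₀).target) (v : E) :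
    (trivializationAt E (TangentSpace I) x₀).symmL ℝ ((extChartAt I x₀).symm y) v
      = chartFrame I x₀ y v := by
  rw [TangentBundle.symmL_trivializationAt (by
    rw [← extChartAt_source (I := I)]; exact (extChartAt I x₀).map_target hy), chartFrame]
  have h : ∀ y' : E, y' = y → (mfderivWithin 𝓘(ℝ, E) I (extChartAt I x₀).symm (Set.range I) y' :
      E → E) = mfderivWithin 𝓘(ℝ, E) I (extChartAt I x₀).symm (Set.range I) y := by
    rintro y' rfl
    rfl
  exact congrFun (h (extChartAt I x₀ ((extChartAt I x₀).symm y)) ((extChartAt I x₀).right_inv hy)) v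

theorem contDiffWithinAt_connMatrix {cov : CovariantDerivative I F V}
    (hcov : cov.ContMDiffCovariantDerivative ∞) :
    ContDiffWithinAt ℝ ∞ (connMatrix cov x₀) (Set.range I) (extChartAt I x₀ x₀) := by
  refine ContDiffWithinAt.sum fun a _ => ContDiffWithinAt.clm_comp contDiffWithinAt_const ?_
  have h1 := (contMDiffAt_hom_bundle _).1 (contMDiffAt_cov hcov (x := x₀)
    (smoothNear_localSec (x₀ := x₀) (FiberBundle.mem_baseSet_trivializationAt' x₀)
      (finBasis ℝ F a)))
  have h2 := h1.2.comp_contMDiffWithinAt_of_eq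
    (contMDiffWithinAt_extChartAt_symm_range x₀ (mem_extChartAt_target x₀)) chart_symm_chart
  refine h2.contDiffWithinAt.congr_of_eventuallyEq_of_mem ?_ (Set.mem_range_self _)
  filter_upwards [extChartAt_target_mem_nhdsWithin x₀] with y hy
  ext v
  simp only [ContinuousLinearMap.comp_apply, Function.comp_def, ContinuousLinearMap.inCoordinates]
  rw [← symmL_eq_chartFrame hy]

end InChart

/-! ### The curvature in a chart and a trivialization -/

section CurvatureInChart

variable {E : Type*} [NormedAddCommGroup E] [NormedSpace ℝ E] [FiniteDimensional ℝ E]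
  {H : Type*} [TopologicalSpace H] {I : ModelWithCorners ℝ E H}
  {X : Type*} [TopologicalSpace X] [ChartedSpace H X] [IsManifold I ∞ X] [T2Space X]
  {F : Type*} [NormedAddCommGroup F] [NormedSpace ℝ F] [FiniteDimensional ℝ F]
  {V : X → Type*} [TopologicalSpace (TotalSpace F V)]
  [∀ x, AddCommGroup (V x)] [∀ x, Module ℝ (V x)] [∀ x, TopologicalSpace (V x)]
  [∀ x, IsTopologicalAddGroup (V x)] [∀ x, ContinuousSMul ℝ (V x)] [FiberBundle F V]
  [VectorBundle ℝ F V] [ContMDiffVectorBundle ∞ F V I]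
  {x₀ : X} {y : E}

theorem two_le_infty : (2 : WithTop ℕ∞) ≤ (∞ : WithTop ℕ∞) := WithTop.coe_le_coe.2 le_top

theorem mem_chartDomain_tangent (hy : y ∈ (extChartAt I x₀).target) :
    y ∈ chartDomain I E (TangentSpace I : X → Type _) x₀ := by
  refine ⟨hy, ?_⟩
  rw [Set.mem_preimage, TangentBundle.trivializationAt_baseSet, ← extChartAt_source (I := I)]
  exact (extChartAt I x₀).map_target hy

theorem chartFrame_readSec (hy : y ∈ (extChartAt I x₀).target) (U : Π x : X, TangentSpace I x) :
    chartFrame I x₀ y (readSec I E x₀ U y) = U ((extChartAt I x₀).symm y) := by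
  rw [← symmL_eq_chartFrame hy]
  exact (trivializationAt E (TangentSpace I) x₀).symmL_continuousLinearMapAt
    (mem_chartDomain_tangent hy).2 _

theorem readSec_of_eq_chartFrame (hy : y ∈ (extChartAt I x₀).target)
    (U : Π x : X, TangentSpace I x) {u : E}
    (h : U ((extChartAt I x₀).symm y) = chartFrame I x₀ y u) : readSec I E x₀ U y = u := by
  rw [readSec, h, ← symmL_eq_chartFrame hy]
  exact (trivializationAt E (TangentSpace I) x₀).continuousLinearMapAt_symmL
    (mem_chartDomain_tangent hy).2 _

theorem mlieBracket_eq_chartFrame (hy : y ∈ (extChartAt I x₀).target)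
    {U U' : Π x : X, TangentSpace I x}
    (hU : SmoothNear I E U ((extChartAt I x₀).symm y))
    (hU' : SmoothNear I E U' ((extChartAt I x₀).symm y)) :
    VectorField.mlieBracket I U U' ((extChartAt I x₀).symm y)
      = chartFrame I x₀ y (VectorField.lieBracketWithin ℝ (readSec I E x₀ U) (readSec I E x₀ U')
        (Set.range I) y) := by
  have : IsManifold I (minSmoothness ℝ 2) X := IsManifold.of_le (n := ∞) (by simpa using two_le_infty)
  have hyr : y ∈ Set.range I := extChartAt_target_subset_range x₀ hy
  have hinv := isInvertible_mfderivWithin_extChartAt_symm hy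
  have h := VectorField.mpullbackWithin_mlieBracketWithin (I := 𝓘(ℝ, E)) (I' := I) (n := 2)
    (t := Set.univ) (hU.mdifferentiableAt.mdifferentiableWithinAt)
    (hU'.mdifferentiableAt.mdifferentiableWithinAt) I.uniqueMDiffOn
    (contMDiffWithinAt_extChartAt_symm_range (n := 2) x₀ hy) hyr (by simp) (by simp)
    (I.range_subset_closure_interior hyr)
  rw [VectorField.mlieBracketWithin_univ, VectorField.mlieBracketWithin_eq_lieBracketWithin,
    VectorField.mpullbackWithin_apply] at h
  have hpull : ∀ U : Π x : X, TangentSpace I x,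
      VectorField.mpullbackWithin 𝓘(ℝ, E) I (extChartAt I x₀).symm U (Set.range I)
        =ᶠ[𝓝[Set.range I] y] readSec I E x₀ U := by
    intro U
    filter_upwards [extChartAt_target_mem_nhdsWithin_of_mem hy] with y' hy'
    exact (isInvertible_mfderivWithin_extChartAt_symm hy').inverse_apply_eq.2
      (chartFrame_readSec hy' U).symm
  rw [(hpull U).lieBracketWithin_vectorField_eq_of_mem (hpull U') hyr] at h
  exact (hinv.inverse_apply_eq.1 h)

theorem readSec_cov_apply_eventuallyEq {cov : CovariantDerivative I F V}
    (hy : y ∈ chartDomain I F V x₀) {σ : Π x, V x}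
    (h : SmoothNear I F σ ((extChartAt I x₀).symm y)) (U : Π x : X, TangentSpace I x) :
    readSec I F x₀ (fun z => cov σ z (U z)) =ᶠ[𝓝[Set.range I] y] fun y' =>
      fderivWithin ℝ (readSec I F x₀ σ) (Set.range I) y' (readSec I E x₀ U y')
        + connMatrix cov x₀ y' (readSec I E x₀ U y') (readSec I F x₀ σ y') := by
  filter_upwards [chartDomain_mem_nhdsWithin hy, eventually_chart_symm hy.1 h] with y' hy' h'
  rw [← readSec_cov hy' (h'.mdifferentiableAt (by simp)), chartFrame_readSec hy'.1]
  rfl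

theorem hasFDerivWithinAt_covariant {S : Set E} {w : E → F} {A : E → E →L[ℝ] F →L[ℝ] F}
    {U : E → E} (hw : DifferentiableWithinAt ℝ w S y)
    (hdw : DifferentiableWithinAt ℝ (fderivWithin ℝ w S) S y)
    (hA : DifferentiableWithinAt ℝ A S y) (hU : DifferentiableWithinAt ℝ U S y)
    (hS : UniqueDiffWithinAt ℝ S y) (u : E) :
    fderivWithin ℝ (fun y' => fderivWithin ℝ w S y' (U y') + A y' (U y') (w y')) S y u
      = fderivWithin ℝ (fderivWithin ℝ w S) S y u (U y)
        + fderivWithin ℝ w S y (fderivWithin ℝ U S y u)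
        + (fderivWithin ℝ A S y u (U y) (w y) + A y (fderivWithin ℝ U S y u) (w y)
          + A y (U y) (fderivWithin ℝ w S y u)) := by
  have h1 := hdw.hasFDerivWithinAt.clm_apply hU.hasFDerivWithinAt
  have h2 := (hA.hasFDerivWithinAt.clm_apply hU.hasFDerivWithinAt).clm_apply hw.hasFDerivWithinAt
  rw [(h1.fun_add h2).fderivWithin hS]
  simp only [add_apply, ContinuousLinearMap.comp_apply, ContinuousLinearMap.flip_apply]
  abel

theorem trivialization_curvature {cov : CovariantDerivative I F V}
    (hcov : cov.ContMDiffCovariantDerivative ∞) (hy : y ∈ chartDomain I F V x₀)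
    (hA : DifferentiableWithinAt ℝ (connMatrix cov x₀) (Set.range I) y) (u v : E)
    (w : V ((extChartAt I x₀).symm y)) :
    (trivializationAt F V x₀).continuousLinearMapAt ℝ ((extChartAt I x₀).symm y)
        (curvature cov ((extChartAt I x₀).symm y) (chartFrame I x₀ y u) (chartFrame I x₀ y v) w)
      = flatCurvature (connMatrix cov x₀) (Set.range I) y u v
        ((trivializationAt F V x₀).continuousLinearMapAt ℝ ((extChartAt I x₀).symm y) w) := by
  let U : Π x : X, TangentSpace I x := FiberBundle.extend E (chartFrame I x₀ y u)
  let U' : Π x : X, TangentSpace I x :=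
    FiberBundle.extend E (chartFrame I x₀ y v)
  let W : Π x : X, V x := FiberBundle.extend F w
  have hU : SmoothNear I E U ((extChartAt I x₀).symm y) := smoothNear_extend _
  have hU' : SmoothNear I E U' ((extChartAt I x₀).symm y) := smoothNear_extend _
  have hW : SmoothNear I F W ((extChartAt I x₀).symm y) := smoothNear_extend _
  have hWz : W ((extChartAt I x₀).symm y) = w := FiberBundle.extend_apply_self _ _
  have hcurv : curvature cov ((extChartAt I x₀).symm y) (chartFrame I x₀ y u) (chartFrame I x₀ y v) w
      = cov (fun x => cov W x (U' x)) ((extChartAt I x₀).symm y) (chartFrame I x₀ y u)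
        - cov (fun x => cov W x (U x)) ((extChartAt I x₀).symm y) (chartFrame I x₀ y v)
        - cov W ((extChartAt I x₀).symm y) (VectorField.mlieBracket I U U' ((extChartAt I x₀).symm y)) := rfl
  have hS := uniqueDiffWithinAt_of_mem_chartDomain hy
  have hyr : y ∈ Set.range I := extChartAt_target_subset_range x₀ hy.1
  have hyT := mem_chartDomain_tangent (X := X) hy.1
  have hw := contDiffWithinAt_readSec hy hW.contMDiffAt
  have hwd : DifferentiableWithinAt ℝ (readSec I F x₀ W) (Set.range I) y :=
    hw.differentiableWithinAt (by simp)
  have hdw : DifferentiableWithinAt ℝ (fderivWithin ℝ (readSec I F x₀ W) (Set.range I))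
      (Set.range I) y :=
    ((hw.of_le (m := 2) two_le_infty).fderivWithin_right (m := 1) I.uniqueDiffOn (by norm_num)
      hyr).differentiableWithinAt (by simp)
  have hUd : DifferentiableWithinAt ℝ (readSec I E x₀ U) (Set.range I) y :=
    differentiableWithinAt_readSec hyT hU.mdifferentiableAt
  have hU'd : DifferentiableWithinAt ℝ (readSec I E x₀ U') (Set.range I) y :=
    differentiableWithinAt_readSec hyT hU'.mdifferentiableAt
  have hUy : readSec I E x₀ U y = u :=
    readSec_of_eq_chartFrame hy.1 U (FiberBundle.extend_apply_self _ _)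
  have hU'y : readSec I E x₀ U' y = v :=
    readSec_of_eq_chartFrame hy.1 U' (FiberBundle.extend_apply_self _ _)
  have hWy : readSec I F x₀ W y
      = (trivializationAt F V x₀).continuousLinearMapAt ℝ ((extChartAt I x₀).symm y) w := by
    rw [readSec, hWz]
  have hsymm := (hw.isSymmSndFDerivWithinAt (by simpa using two_le_infty) I.uniqueDiffOn
    (I.range_subset_closure_interior hyr) hyr) u v
  rw [hcurv, map_sub, map_sub, mlieBracket_eq_chartFrame hy.1 hU hU',
    readSec_cov hy (smoothNear_cov_apply hcov hW hU').mdifferentiableAt,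
    readSec_cov hy (smoothNear_cov_apply hcov hW hU).mdifferentiableAt,
    readSec_cov hy hW.mdifferentiableAt,
    (readSec_cov_apply_eventuallyEq hy hW U').fderivWithin_eq_of_mem hyr,
    (readSec_cov_apply_eventuallyEq hy hW U).fderivWithin_eq_of_mem hyr,
    (readSec_cov_apply_eventuallyEq hy hW U').eq_of_nhdsWithin hyr,
    (readSec_cov_apply_eventuallyEq hy hW U).eq_of_nhdsWithin hyr,
    hasFDerivWithinAt_covariant hwd hdw hA hU'd hS, hasFDerivWithinAt_covariant hwd hdw hA hUd hS,
    VectorField.lieBracketWithin, hUy, hU'y, hWy, flatCurvature, hsymm]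
  simp only [map_add, map_sub, sub_apply]
  abel

end CurvatureInChart

/-! ### Endomorphism-valued forms in a chart and a trivialization -/

section LocalModel

variable {𝕂 : Type*} [Field 𝕂] [Algebra ℝ 𝕂] [Algebra 𝕂 ℂ] [IsScalarTower ℝ 𝕂 ℂ]
  {E : Type*} [NormedAddCommGroup E] [NormedSpace ℝ E] [FiniteDimensional ℝ E]
  {H : Type*} [TopologicalSpace H] {I : ModelWithCorners ℝ E H}
  {X : Type*} [TopologicalSpace X] [ChartedSpace H X] [IsManifold I ∞ X] [T2Space X]
  {F : Type*} [NormedAddCommGroup F] [NormedSpace ℝ F] [FiniteDimensional ℝ F]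
  [Module 𝕂 F] [IsScalarTower ℝ 𝕂 F] [Module.Finite 𝕂 F]
  {V : X → Type*} [TopologicalSpace (TotalSpace F V)]
  [∀ x, AddCommGroup (V x)] [∀ x, Module ℝ (V x)] [∀ x, Module 𝕂 (V x)]
  [∀ x, IsScalarTower ℝ 𝕂 (V x)] [∀ x, TopologicalSpace (V x)]
  [∀ x, IsTopologicalAddGroup (V x)] [∀ x, ContinuousSMul ℝ (V x)] [FiberBundle F V]
  [VectorBundle ℝ F V] [ContMDiffVectorBundle ∞ F V I]
  {x₀ : X} {y : E}

/-- The chart at `x₀` identifies the model space with the tangent spaces. -/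
def chartEquiv (hy : y ∈ (extChartAt I x₀).target) :
    E ≃ₗ[ℝ] TangentSpace I ((extChartAt I x₀).symm y) :=
  ((trivializationAt E (TangentSpace I : X → Type _) x₀).linearEquivAt ℝ _
    (mem_chartDomain_tangent hy).2).symm

theorem chartEquiv_apply (hy : y ∈ (extChartAt I x₀).target) (v : E) :
    chartEquiv hy v = chartFrame I x₀ y v := by
  rw [← symmL_eq_chartFrame hy, (trivializationAt E (TangentSpace I : X → Type _) x₀).symmL_apply
    (mem_chartDomain_tangent hy).2]
  rfl

theorem inChart_eq (hy : y ∈ (extChartAt I x₀).target) (α : DiffForm I X) :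
    inChart α x₀ y = pullbackForm (chartEquiv hy).toLinearMap (α ((extChartAt I x₀).symm y)) := by
  have h : (chartEquiv hy).toLinearMap = (chartFrame I x₀ y).toLinearMap :=
    LinearMap.ext fun v => chartEquiv_apply hy v
  rw [h]
  rfl

section Fibre

variable [he : (trivializationAt F V x₀).IsLinear 𝕂]

variable (𝕂) in
/-- The trivialization at `x₀` identifies the fibres with the model fibre. -/
def fibreEquiv (hy : y ∈ chartDomain I F V x₀) : V ((extChartAt I x₀).symm y) ≃ₗ[𝕂] F :=
  (trivializationAt F V x₀).linearEquivAt 𝕂 _ hy.2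

theorem fibreEquiv_apply (hy : y ∈ chartDomain I F V x₀) (w : V ((extChartAt I x₀).symm y)) :
    fibreEquiv 𝕂 hy w
      = (trivializationAt F V x₀).continuousLinearMapAt ℝ ((extChartAt I x₀).symm y) w := by
  rw [(trivializationAt F V x₀).continuousLinearMapAt_apply_of_mem ℝ hy.2]
  rfl

theorem fibreEquiv_localSec (hy : y ∈ chartDomain I F V x₀) (w : F) :
    fibreEquiv 𝕂 hy (localSec V x₀ w ((extChartAt I x₀).symm y)) = w := by
  rw [fibreEquiv_apply]
  exact readSec_localSec hy w

theorem fibreEquiv_symm_apply (hy : y ∈ chartDomain I F V x₀) (w : F) :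
    (fibreEquiv 𝕂 hy).symm w = localSec V x₀ w ((extChartAt I x₀).symm y) := by
  rw [LinearEquiv.symm_apply_eq, fibreEquiv_localSec]

variable (I F) in
/-- A bundle endomorphism in the chart and the trivialization at `x₀`. -/
def endMatrix (γ : Π x, Module.End 𝕂 (V x)) (x₀ : X) (y : E) : F →L[ℝ] F :=
  ∑ a, (LinearMap.toContinuousLinearMap ((finBasis ℝ F).coord a)).smulRight
    (readSec I F x₀ (fun x => γ x (localSec V x₀ (finBasis ℝ F a) x)) y)

theorem endMatrix_apply (hy : y ∈ chartDomain I F V x₀) (γ : Π x, Module.End 𝕂 (V x)) (w : F) :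
    endMatrix I F γ x₀ y w
      = fibreEquiv 𝕂 hy (γ ((extChartAt I x₀).symm y) ((fibreEquiv 𝕂 hy).symm w)) := by
  have h : endMatrix I F γ x₀ y w = ∑ a, (finBasis ℝ F).coord a w •
      fibreEquiv 𝕂 hy (γ ((extChartAt I x₀).symm y)
        ((fibreEquiv 𝕂 hy).symm (finBasis ℝ F a))) := by
    simp only [endMatrix, sum_apply, ContinuousLinearMap.smulRight_apply]
    refine Finset.sum_congr rfl fun a _ => ?_
    rw [fibreEquiv_symm_apply, fibreEquiv_apply]
    rfl
  have h2 : w = ∑ a, (finBasis ℝ F).coord a w • finBasis ℝ F a :=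
    ((finBasis ℝ F).sum_repr w).symm
  rw [h]
  conv_rhs => rw [h2]
  have h3 : ∀ f : F →ₗ[𝕂] F, ∀ (r : ℝ) (x : F), f (r • x) = r • f x := fun f r x =>
    (f.restrictScalars ℝ).map_smul r x
  have h4 := map_sum ((fibreEquiv 𝕂 hy).conj (γ ((extChartAt I x₀).symm y)))
    (fun a => (finBasis ℝ F).coord a w • finBasis ℝ F a) Finset.univ
  simp only [h3] at h4
  exact h4.symm

theorem endMatrix_eq_conj (hy : y ∈ chartDomain I F V x₀) (γ : Π x, Module.End 𝕂 (V x)) (w : F) :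
    endMatrix I F γ x₀ y w = (fibreEquiv 𝕂 hy).conj (γ ((extChartAt I x₀).symm y)) w :=
  endMatrix_apply hy γ w

theorem contDiffWithinAt_endMatrix {γ : Π x, Module.End 𝕂 (V x)} (hγ : IsSmoothEnd 𝕂 I F γ)
    (hy : y ∈ chartDomain I F V x₀) :
    ContDiffWithinAt ℝ ∞ (endMatrix I F γ x₀) (Set.range I) y := by
  refine ContDiffWithinAt.sum fun a _ => ContDiffWithinAt.smulRight contDiffWithinAt_const ?_
  exact contDiffWithinAt_readSec hy (hγ.smoothNear (smoothNear_localSec hy.2 _)).contMDiffAt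

theorem frameEquiv_ofEnd_endMatrix (hy : y ∈ chartDomain I F V x₀)
    (γ : Π x, Module.End 𝕂 (V x)) :
    frameEquiv (chartEquiv hy.1) (fibreEquiv 𝕂 hy) (ofEnd (γ ((extChartAt I x₀).symm y)))
      = endFormL 𝕂 E F (endMatrix I F γ x₀ y) := by
  rw [frameEquiv_ofEnd, endFormL_apply]
  congr 1
  rw [funext (endMatrix_eq_conj hy γ), endOfMap_linear]

theorem connMatrix_eq {cov : CovariantDerivative I F V} (hy : y ∈ chartDomain I F V x₀) (v : E)
    (w : F) :
    connMatrix cov x₀ y v w = fibreEquiv 𝕂 hy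
      (cov (localSec V x₀ w) ((extChartAt I x₀).symm y) (chartFrame I x₀ y v)) := by
  have h := readSec_cov (cov := cov) hy (smoothNear_localSec hy.2 w).mdifferentiableAt v
  have h1 : readSec I F x₀ (localSec V x₀ w) =ᶠ[𝓝[Set.range I] y] fun _ => w := by
    filter_upwards [chartDomain_mem_nhdsWithin hy] with z hz
    exact readSec_localSec hz w
  rw [h1.fderivWithin_eq (readSec_localSec hy w), readSec_localSec hy w] at h
  rw [fibreEquiv_apply, h]
  simp

theorem fderivWithin_endMatrix {cov : CovariantDerivative I F V} {γ : Π x, Module.End 𝕂 (V x)}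
    (hγ : IsSmoothEnd 𝕂 I F γ) (hp : Preserves γ cov) (hy : y ∈ chartDomain I F V x₀) (v : E)
    (w : F) :
    fderivWithin ℝ (endMatrix I F γ x₀) (Set.range I) y v w
      + connMatrix cov x₀ y v (endMatrix I F γ x₀ y w)
      - endMatrix I F γ x₀ y (connMatrix cov x₀ y v w) = 0 := by
  have hs := smoothNear_localSec (I := I) hy.2 w
  have h1 : readSec I F x₀ (fun x => γ x (localSec V x₀ w x)) =ᶠ[𝓝[Set.range I] y]
      fun y' => endMatrix I F γ x₀ y' w := by
    filter_upwards [chartDomain_mem_nhdsWithin hy] with y' hy'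
    rw [endMatrix_apply hy', fibreEquiv_symm_apply, fibreEquiv_apply]
    rfl
  have hyr : y ∈ Set.range I := extChartAt_target_subset_range x₀ hy.1
  have h2 := readSec_cov (cov := cov) hy (hγ.smoothNear hs).mdifferentiableAt v
  have h3 : fderivWithin ℝ (fun y' => endMatrix I F γ x₀ y' w) (Set.range I) y v
      = fderivWithin ℝ (endMatrix I F γ x₀) (Set.range I) y v w :=
    fderivWithin_linear_comp (ContinuousLinearMap.apply ℝ F w).toLinearMap
      (uniqueDiffWithinAt_of_mem_chartDomain hy)
      ((contDiffWithinAt_endMatrix hγ hy).differentiableWithinAt (by simp)) v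
  rw [hp.cov_apply hγ hs, h1.fderivWithin_eq_of_mem hyr, h1.eq_of_nhdsWithin hyr, h3] at h2
  rw [← h2, connMatrix_eq (𝕂 := 𝕂) hy, endMatrix_apply hy, LinearEquiv.symm_apply_apply,
    fibreEquiv_apply, sub_self]

variable (𝕂) in
/-- The connection is linear over the field `𝕂`. -/
def IsLinearOver (cov : CovariantDerivative I F V) : Prop :=
  ∀ (c : 𝕂) (σ : Π x, V x) (x : X), SmoothNear I F σ x → ∀ v : TangentSpace I x,
    cov (fun z => c • σ z) x v = c • cov σ x v

theorem IsLinearOver.pathConn {cov cov' : CovariantDerivative I F V} (h : IsLinearOver 𝕂 cov)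
    (h' : IsLinearOver 𝕂 cov') (s : ℝ) : IsLinearOver 𝕂 (pathConn cov cov' s) := by
  intro c σ x hσ v
  have hp : ∀ σ : Π x, V x, EquivariantTransgression.pathConn cov cov' s σ x v
      = s • cov' σ x v + (1 - s) • cov σ x v := fun _ => rfl
  rw [hp, hp, h c σ x hσ v, h' c σ x hσ v, smul_add, smul_comm c s, smul_comm c (1 - s)]

theorem connMatrix_linear {cov : CovariantDerivative I F V} (h : IsLinearOver 𝕂 cov)
    (hy : y ∈ chartDomain I F V x₀) (v : E) :
    ∃ φ : End 𝕂 F, ∀ w, connMatrix cov x₀ y v w = φ w := by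
  refine ⟨{ toFun := fun w => connMatrix cov x₀ y v w
            map_add' := fun w w' => map_add _ w w'
            map_smul' := fun c w => ?_ }, fun w => rfl⟩
  rw [connMatrix_eq (𝕂 := 𝕂) hy, connMatrix_eq (𝕂 := 𝕂) hy, RingHom.id_apply, ← map_smul,
    ← h c _ _ (smoothNear_localSec hy.2 w)]
  have hs := smoothNear_localSec (I := I) hy.2 w
  have hs' := smoothNear_localSec (I := I) hy.2 (c • w)
  have heq : ∀ z ∈ (trivializationAt F V x₀).baseSet,
      localSec V x₀ (c • w) z = c • localSec V x₀ w z := fun z hz => by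
    have h1 : ∀ w, localSec V x₀ w z = ((trivializationAt F V x₀).linearEquivAt 𝕂 z hz).symm w :=
      fun w => (trivializationAt F V x₀).symmL_apply hz w
    rw [h1, h1, map_smul]
  have hev := (trivializationAt F V x₀).open_baseSet.mem_nhds hy.2
  congr 2
  refine cov_congr hs'.mdifferentiableAt ?_ (eventually_of_mem hev heq)
  refine hs'.mdifferentiableAt.congr_of_eventuallyEq (eventually_of_mem hev fun z hz => ?_)
  simp only [heq z hz]

end Fibre

end LocalModel

section FlatCurvature

variable {𝕂 : Type*} [Field 𝕂] [Algebra ℝ 𝕂]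
  {E : Type*} [NormedAddCommGroup E] [NormedSpace ℝ E] [FiniteDimensional ℝ E]
  {F : Type*} [NormedAddCommGroup F] [NormedSpace ℝ F] [FiniteDimensional ℝ F]
  [Module 𝕂 F] [IsScalarTower ℝ 𝕂 F] {S : Set E} {y : E}

theorem fderivWithin_linear (hS : UniqueDiffWithinAt ℝ S y) (hy : y ∈ S)
    {A : E → E →L[ℝ] F →L[ℝ] F} (hA : DifferentiableWithinAt ℝ A S y)
    (hlin : ∀ᶠ z in 𝓝[S] y, ∀ v, ∃ φ : End 𝕂 F, ∀ w, A z v w = φ w) (u v : E) (c : 𝕂) (w : F) :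
    fderivWithin ℝ A S y u v (c • w) = c • fderivWithin ℝ A S y u v w := by
  have h1 : ∀ w, fderivWithin ℝ (fun z => A z v w) S y u = fderivWithin ℝ A S y u v w := fun w =>
    fderivWithin_linear_comp ((ContinuousLinearMap.apply ℝ F w).toLinearMap ∘ₗ
      (ContinuousLinearMap.apply ℝ (F →L[ℝ] F) v).toLinearMap) hS hA u
  let ℓ : F →ₗ[ℝ] F := (LinearMap.lsmul 𝕂 F c).restrictScalars ℝ
  have h2 : fderivWithin ℝ (fun z => ℓ (A z v w)) S y u = ℓ (fderivWithin ℝ A S y u v w) :=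
    fderivWithin_linear_comp (ℓ ∘ₗ (ContinuousLinearMap.apply ℝ F w).toLinearMap ∘ₗ
      (ContinuousLinearMap.apply ℝ (F →L[ℝ] F) v).toLinearMap) hS hA u
  have h3 : (fun z => A z v (c • w)) =ᶠ[𝓝[S] y] fun z => ℓ (A z v w) := by
    filter_upwards [hlin] with z hz
    obtain ⟨φ, hφ⟩ := hz v
    rw [hφ, hφ, map_smul]
    rfl
  rw [← h1, h3.fderivWithin_eq_of_mem hy, h2]
  rfl

theorem flatCurvature_linear (hS : UniqueDiffWithinAt ℝ S y) (hy : y ∈ S)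
    {A : E → E →L[ℝ] F →L[ℝ] F} (hA : DifferentiableWithinAt ℝ A S y)
    (hlin : ∀ᶠ z in 𝓝[S] y, ∀ v, ∃ φ : End 𝕂 F, ∀ w, A z v w = φ w) :
    ∃ B : E →ₗ[ℝ] E →ₗ[ℝ] End 𝕂 F, (∀ u v, B v u = -B u v) ∧
      ∀ u v w, B u v w = flatCurvature A S y u v w := by
  have hA' : ∀ v (c : 𝕂) w, A y v (c • w) = c • A y v w := fun v c w => by
    obtain ⟨φ, hφ⟩ := hlin.self_of_nhdsWithin hy v
    rw [hφ, hφ, map_smul]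
  refine ⟨LinearMap.mk₂ ℝ (fun u v =>
    { toFun := fun w => flatCurvature A S y u v w
      map_add' := fun w w' => ?_
      map_smul' := fun c w => ?_ }) ?_ ?_ ?_ ?_, ?_, ?_⟩
  · simp only [flatCurvature, map_add]
    abel
  · simp only [flatCurvature, hA', fderivWithin_linear hS hy hA hlin, RingHom.id_apply, smul_sub,
      smul_add]
  · intro u u' v
    ext w
    simp only [flatCurvature, map_add, LinearMap.coe_mk, AddHom.coe_mk, LinearMap.add_apply,
      add_apply]
    abel
  · intro r u v
    ext w
    simp only [flatCurvature, map_smul, LinearMap.coe_mk, AddHom.coe_mk, LinearMap.smul_apply,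
      smul_apply, smul_add, smul_sub]
  · intro u v v'
    ext w
    simp only [flatCurvature, map_add, LinearMap.coe_mk, AddHom.coe_mk, LinearMap.add_apply,
      add_apply]
    abel
  · intro r u v
    ext w
    simp only [flatCurvature, map_smul, LinearMap.coe_mk, AddHom.coe_mk, LinearMap.smul_apply,
      smul_apply, smul_add, smul_sub]
  · intro u v
    ext w
    simp only [flatCurvature, LinearMap.mk₂_apply, LinearMap.coe_mk, AddHom.coe_mk,
      LinearMap.neg_apply]
    abel
  · intro u v w
    rfl

end FlatCurvature

section LocalModel

variable {𝕂 : Type*} [Field 𝕂] [Algebra ℝ 𝕂] [Algebra 𝕂 ℂ] [IsScalarTower ℝ 𝕂 ℂ]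
  {E : Type*} [NormedAddCommGroup E] [NormedSpace ℝ E] [FiniteDimensional ℝ E]
  {H : Type*} [TopologicalSpace H] {I : ModelWithCorners ℝ E H}
  {X : Type*} [TopologicalSpace X] [ChartedSpace H X] [IsManifold I ∞ X] [T2Space X]
  {F : Type*} [NormedAddCommGroup F] [NormedSpace ℝ F] [FiniteDimensional ℝ F]
  [Module 𝕂 F] [IsScalarTower ℝ 𝕂 F] [Module.Finite 𝕂 F]
  {V : X → Type*} [TopologicalSpace (TotalSpace F V)]
  [∀ x, AddCommGroup (V x)] [∀ x, Module ℝ (V x)] [∀ x, Module 𝕂 (V x)]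
  [∀ x, IsScalarTower ℝ 𝕂 (V x)] [∀ x, TopologicalSpace (V x)]
  [∀ x, IsTopologicalAddGroup (V x)] [∀ x, ContinuousSMul ℝ (V x)] [FiberBundle F V]
  [VectorBundle ℝ F V] [ContMDiffVectorBundle ∞ F V I]
  {x₀ : X} {y : E} [he : (trivializationAt F V x₀).IsLinear 𝕂]

theorem eventually_connMatrix_linear {cov : CovariantDerivative I F V} (h : IsLinearOver 𝕂 cov)
    (hy : y ∈ chartDomain I F V x₀) :
    ∀ᶠ z in 𝓝[Set.range I] y, ∀ v, ∃ φ : End 𝕂 F, ∀ w, connMatrix cov x₀ z v w = φ w := by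
  filter_upwards [chartDomain_mem_nhdsWithin hy] with z hz v
  exact connMatrix_linear h hz v

theorem frameEquiv_curvForm {cov : CovariantDerivative I F V}
    (hcov : cov.ContMDiffCovariantDerivative ∞) (h : IsLinearOver 𝕂 cov)
    (hy : y ∈ chartDomain I F V x₀)
    (hA : DifferentiableWithinAt ℝ (connMatrix cov x₀) (Set.range I) y) :
    frameEquiv (chartEquiv hy.1) (fibreEquiv 𝕂 hy) (curvForm 𝕂 cov ((extChartAt I x₀).symm y))
      = (endFormData 𝕂 E F).curv (vecBasis E) (Set.range I)
        (fun z => connFormL 𝕂 E F (connMatrix cov x₀ z)) y := by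
  have hS := uniqueDiffWithinAt_of_mem_chartDomain hy
  have hyr : y ∈ Set.range I := extChartAt_target_subset_range x₀ hy.1
  obtain ⟨B, hB, hBeq⟩ := flatCurvature_linear hS hyr hA (eventually_connMatrix_linear h hy)
  rw [curv_connFormL 𝕂 hS hA (connMatrix_linear h hy)]
  have h1 : (flatCurvature (connMatrix cov x₀) (Set.range I) y) = fun u v w => B u v w := by
    funext u v w
    rw [hBeq]
  rw [h1, ← frameEquiv_endTwoForm (chartEquiv hy.1) (fibreEquiv 𝕂 hy) B hB, curvForm]
  congr 2
  funext u v w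
  rw [LinearEquiv.eq_symm_apply, hBeq, fibreEquiv_apply, fibreEquiv_apply,
    ← trivialization_curvature hcov hy hA, ← chartEquiv_apply hy.1, ← chartEquiv_apply hy.1,
    LinearEquiv.apply_symm_apply, LinearEquiv.apply_symm_apply]

theorem frameEquiv_velocityForm {cov cov' : CovariantDerivative I F V} (h : IsLinearOver 𝕂 cov)
    (h' : IsLinearOver 𝕂 cov') (hy : y ∈ chartDomain I F V x₀) :
    frameEquiv (chartEquiv hy.1) (fibreEquiv 𝕂 hy)
        (velocityForm 𝕂 cov cov' ((extChartAt I x₀).symm y))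
      = connFormL 𝕂 E F (connMatrix cov' x₀ y - connMatrix cov x₀ y) := by
  choose φ hφ using connMatrix_linear h hy
  choose φ' hφ' using connMatrix_linear h' hy
  let B : E →ₗ[ℝ] End 𝕂 F :=
    { toFun := fun v => φ' v - φ v
      map_add' := fun u v => by
        ext w
        simp only [LinearMap.sub_apply, LinearMap.add_apply, ← hφ, ← hφ', map_add, add_apply]
        abel
      map_smul' := fun r v => by
        ext w
        simp only [LinearMap.sub_apply, LinearMap.smul_apply, ← hφ, ← hφ', map_smul, smul_apply,
          smul_sub, RingHom.id_apply] }
  have h1 : (fun v w => (connMatrix cov' x₀ y - connMatrix cov x₀ y) v w) = fun v w => B v w := by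
    funext v w
    simp only [B, LinearMap.coe_mk, AddHom.coe_mk, LinearMap.sub_apply, ← hφ, ← hφ', sub_apply]
  rw [connFormL_apply, h1, ← frameEquiv_endOneForm (chartEquiv hy.1) (fibreEquiv 𝕂 hy) B,
    velocityForm]
  congr 2
  funext v w
  have h2 : ∀ cov : CovariantDerivative I F V, fibreEquiv 𝕂 hy
      (cov (FiberBundle.extend F w) ((extChartAt I x₀).symm y) v)
      = fderivWithin ℝ (readSec I F x₀ (FiberBundle.extend F w)) (Set.range I) y
          ((chartEquiv hy.1).symm v)
        + connMatrix cov x₀ y ((chartEquiv hy.1).symm v) (fibreEquiv 𝕂 hy w) := fun cov => by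
    have h3 := readSec_cov (cov := cov) hy (smoothNear_extend w).mdifferentiableAt
      ((chartEquiv hy.1).symm v)
    rw [← chartEquiv_apply hy.1, LinearEquiv.apply_symm_apply, ← fibreEquiv_apply (𝕂 := 𝕂) hy] at h3
    rw [h3, readSec, FiberBundle.extend_apply_self, ← fibreEquiv_apply (𝕂 := 𝕂) hy]
  rw [LinearEquiv.eq_symm_apply, map_sub, h2, h2, add_sub_add_left_eq_sub]
  simp only [B, LinearMap.coe_mk, AddHom.coe_mk, LinearMap.sub_apply, ← hφ, ← hφ']

theorem pathForm_connFormL (cov cov' : CovariantDerivative I F V) (s : ℝ) :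
    pathForm (fun z => connFormL 𝕂 E F (connMatrix cov x₀ z))
      (fun z => connFormL 𝕂 E F (connMatrix cov' x₀ z - connMatrix cov x₀ z)) s
      = fun z => connFormL 𝕂 E F (connMatrix (pathConn cov cov' s) x₀ z) := by
  funext z
  rw [pathForm, connMatrix_pathConn, map_add, map_smul]

theorem contMDiffCovariantDerivative_pathConn {cov cov' : CovariantDerivative I F V}
    (hcov : cov.ContMDiffCovariantDerivative ∞) (hcov' : cov'.ContMDiffCovariantDerivative ∞)
    (s : ℝ) : (pathConn cov cov' s).ContMDiffCovariantDerivative ∞ :=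
  CovariantDerivative.ContMDiffCovariantDerivative.affineCombination cov' cov contMDiff_const
    hcov' hcov

theorem eventually_differentiableWithinAt {N : Type*} [NormedAddCommGroup N] [NormedSpace ℝ N]
    {f : E → N} {S : Set E} (hf : ContDiffWithinAt ℝ ∞ f S y) (hy : y ∈ S) :
    ∀ᶠ z in 𝓝[S] y, DifferentiableWithinAt ℝ f S z := by
  have h := (hf.of_le (n := ∞) (m := 1) (by simp)).eventually (by simp)
  rw [Set.insert_eq_of_mem hy] at h
  exact h.mono fun z hz => hz.differentiableWithinAt (by simp)

/-- Near `x₀`, a path of connections is given by a path of connection forms on the model space. -/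
theorem eventually_frameEquiv {cov cov' : CovariantDerivative I F V}
    (hcov : cov.ContMDiffCovariantDerivative ∞) (hcov' : cov'.ContMDiffCovariantDerivative ∞)
    (h : IsLinearOver 𝕂 cov) (h' : IsLinearOver 𝕂 cov') :
    ∀ᶠ y in 𝓝[Set.range I] (extChartAt I x₀ x₀), ∃ hy : y ∈ chartDomain I F V x₀,
      (∀ s, frameEquiv (chartEquiv hy.1) (fibreEquiv 𝕂 hy)
        (curvForm 𝕂 (pathConn cov cov' s) ((extChartAt I x₀).symm y))
        = (endFormData 𝕂 E F).curv (vecBasis E) (Set.range I)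
          (pathForm (fun z => connFormL 𝕂 E F (connMatrix cov x₀ z))
            (fun z => connFormL 𝕂 E F (connMatrix cov' x₀ z - connMatrix cov x₀ z)) s) y) ∧
      frameEquiv (chartEquiv hy.1) (fibreEquiv 𝕂 hy)
        (velocityForm 𝕂 cov cov' ((extChartAt I x₀).symm y))
        = connFormL 𝕂 E F (connMatrix cov' x₀ y - connMatrix cov x₀ y) := by
  have hr : extChartAt I x₀ x₀ ∈ Set.range I := Set.mem_range_self _
  filter_upwards [chartDomain_mem_nhdsWithin (mem_chartDomain_self (I := I) (F := F) (V := V) (x₀ := x₀)),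
    eventually_differentiableWithinAt (contDiffWithinAt_connMatrix hcov) hr,
    eventually_differentiableWithinAt (contDiffWithinAt_connMatrix hcov') hr] with y hy h1 h2
  refine ⟨hy, fun s => ?_, frameEquiv_velocityForm h h' hy⟩
  rw [pathForm_connFormL, frameEquiv_curvForm (contMDiffCovariantDerivative_pathConn hcov hcov' s)
    (h.pathConn h' s) hy]
  have h3 : connMatrix (pathConn cov cov' s) x₀
      = fun z => connMatrix cov x₀ z + s • (connMatrix cov' x₀ z - connMatrix cov x₀ z) :=
    funext fun z => connMatrix_pathConn cov cov' x₀ z s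
  rw [h3]
  exact h1.fun_add ((h2.fun_sub h1).fun_const_smul s)

theorem connectionPath_connMatrix {cov cov' : CovariantDerivative I F V}
    (hcov : cov.ContMDiffCovariantDerivative ∞) (hcov' : cov'.ContMDiffCovariantDerivative ∞) :
    ConnectionPath (endFormData 𝕂 E F) (endFormData 𝕂 E F).genIdeal (Set.range I)
      (extChartAt I x₀ x₀) (fun z => connFormL 𝕂 E F (connMatrix cov x₀ z))
      (fun z => connFormL 𝕂 E F (connMatrix cov' x₀ z - connMatrix cov x₀ z)) :=
  connectionPath_connFormL 𝕂 (contDiffWithinAt_connMatrix hcov)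
    ((contDiffWithinAt_connMatrix hcov').sub (contDiffWithinAt_connMatrix hcov))

theorem parallelEnd_endMatrix {cov cov' : CovariantDerivative I F V} (h : IsLinearOver 𝕂 cov)
    (h' : IsLinearOver 𝕂 cov') {γ : Π x, Module.End 𝕂 (V x)} (hγ : IsSmoothEnd 𝕂 I F γ)
    (hp : Preserves γ cov) (hp' : Preserves γ cov') :
    ParallelEnd (endFormData 𝕂 E F) (vecBasis E) (Set.range I) (extChartAt I x₀ x₀)
      (fun z => connFormL 𝕂 E F (connMatrix cov x₀ z))
      (fun z => connFormL 𝕂 E F (connMatrix cov' x₀ z - connMatrix cov x₀ z))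
      (fun z => endFormL 𝕂 E F (endMatrix I F γ x₀ z)) := by
  have hdom := chartDomain_mem_nhdsWithin (mem_chartDomain_self (I := I) (F := F) (V := V) (x₀ := x₀))
  refine parallelEnd_endFormL 𝕂 I.uniqueDiffOn
    (contDiffWithinAt_endMatrix hγ mem_chartDomain_self) (Set.mem_range_self _)
    (eventually_connMatrix_linear h mem_chartDomain_self)
    (eventually_connMatrix_linear h' mem_chartDomain_self) ?_ ?_ ?_
  · filter_upwards [hdom] with z hz
    exact ⟨_, endMatrix_eq_conj hz γ⟩
  · filter_upwards [hdom] with z hz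
    exact fderivWithin_endMatrix hγ hp hz
  · filter_upwards [hdom] with z hz
    exact fderivWithin_endMatrix hγ hp' hz

end LocalModel

/-! ### Transgression forms on manifolds, checked in charts -/

section ManifoldForms

theorem formIntegral_smul {T : Type*} [AddCommGroup T] [Module ℝ T] [FiniteDimensional ℝ T] (c : ℂ)
    (f : ℝ → FormAlg T) : c • formIntegral f = formIntegral fun s => c • f s := by
  have h : ∀ J s, formCoeff J (c • f s) = c * formCoeff J (f s) := fun J s => by
    simp [formCoeff]
  simp only [formIntegral, h, Finset.smul_sum, smul_smul]
  refine Finset.sum_congr rfl fun J _ => ?_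
  rw [intervalIntegral.integral_const_mul]

theorem formIntegral_neg {T : Type*} [AddCommGroup T] [Module ℝ T] [FiniteDimensional ℝ T]
    (f : ℝ → FormAlg T) : -formIntegral f = formIntegral fun s => -f s := by
  have h := formIntegral_smul (-1) f
  simpa only [neg_one_smul] using h

variable {E : Type*} [NormedAddCommGroup E] [NormedSpace ℝ E] [FiniteDimensional ℝ E]
  {H : Type*} [TopologicalSpace H] {I : ModelWithCorners ℝ E H}
  {X : Type*} [TopologicalSpace X] [ChartedSpace H X] [IsManifold I ∞ X]
  {α β θ α' β' θ' : DiffForm I X} {x₀ : X}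

/-- The form `α` is smooth at `x₀`, and closed and even there. -/
structure ClosedEvenAt (α : DiffForm I X) (x₀ : X) : Prop where
  smooth : ContDiffWithinAt ℝ ∞ (inChart α x₀) (Set.range I) (extChartAt I x₀ x₀)
  closed : (formData E).d (vecBasis E) (Set.range I) (inChart α x₀) (extChartAt I x₀ x₀) = 0
  even : (formData E).inv (inChart α x₀ (extChartAt I x₀ x₀)) = inChart α x₀ (extChartAt I x₀ x₀)

/-- The form `θ` is smooth at `x₀`, and `β - α = dθ` there. -/
structure TransgressionAt (α β θ : DiffForm I X) (x₀ : X) : Prop where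
  smooth : ContDiffWithinAt ℝ ∞ (inChart θ x₀) (Set.range I) (extChartAt I x₀ x₀)
  sub_eq : inChart β x₀ (extChartAt I x₀ x₀) - inChart α x₀ (extChartAt I x₀ x₀)
    = (formData E).d (vecBasis E) (Set.range I) (inChart θ x₀) (extChartAt I x₀ x₀)

theorem pullbackForm_comp {T₁ T₂ T₃ : Type*} [AddCommGroup T₁] [Module ℝ T₁] [AddCommGroup T₂]
    [Module ℝ T₂] [AddCommGroup T₃] [Module ℝ T₃] (L : T₁ →ₗ[ℝ] T₂) (M : T₂ →ₗ[ℝ] T₃)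
    (a : FormAlg T₃) : pullbackForm L (pullbackForm M a) = pullbackForm (M ∘ₗ L) a := by
  have h : (pullbackForm L).comp (pullbackForm M) = pullbackForm (M ∘ₗ L) := by
    refine ExteriorAlgebra.hom_ext (LinearMap.ext fun v => ?_)
    simp only [LinearMap.comp_apply, AlgHom.toLinearMap_apply, AlgHom.comp_apply]
    change pullbackForm L (pullbackForm M (oneForm v)) = pullbackForm (M ∘ₗ L) (oneForm v)
    rw [pullbackForm_oneForm, pullbackForm_oneForm, pullbackForm_oneForm]
    rfl
  exact congrArg (fun f => f a) h

theorem pullbackForm_id {T : Type*} [AddCommGroup T] [Module ℝ T] (a : FormAlg T) :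
    pullbackForm (LinearMap.id : T →ₗ[ℝ] T) a = a := by
  have h : pullbackForm (LinearMap.id : T →ₗ[ℝ] T) = AlgHom.id ℂ (FormAlg T) := by
    refine ExteriorAlgebra.hom_ext (LinearMap.ext fun v => ?_)
    change pullbackForm LinearMap.id (oneForm v) = oneForm v
    rw [pullbackForm_oneForm]
    rfl
  rw [h]
  rfl

theorem pullbackForm_mfderiv_inChart (α : DiffForm I X) (x : X) :
    pullbackForm (T' := E) (mfderiv I 𝓘(ℝ, E) (extChartAt I x) x).toLinearMap
      (inChart α x (extChartAt I x x)) = α x := by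
  have key : ∀ (z : X) (_ : z = x) (N : TangentSpace I x →ₗ[ℝ] TangentSpace I z),
      (∀ v : E, (N v : E) = v) → pullbackForm N (α z) = α x := by
    rintro z rfl N hN
    have h : N = LinearMap.id := LinearMap.ext hN
    rw [h, pullbackForm_id]
  refine (pullbackForm_comp (T₁ := TangentSpace I x) (T₂ := E)
    (T₃ := TangentSpace I ((extChartAt I x).symm (extChartAt I x x)))
    (mfderiv I 𝓘(ℝ, E) (extChartAt I x) x).toLinearMap
    (mfderivWithin 𝓘(ℝ, E) I (extChartAt I x).symm (Set.range I)
      (extChartAt I x x)).toLinearMap _).trans ?_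
  refine key _ (extChartAt_to_inv x) _ fun v => ?_
  exact (congrArg (fun f : E →L[ℝ] E => f _) (mfderivWithin_range_extChartAt_symm (I := I))).trans
    (congrArg (fun f : E →L[ℝ] E => f v) (mfderiv_extChartAt_self (I := I) (x := x)))

theorem inChart_mul (α β : DiffForm I X) (x₀ : X) (y : E) :
    inChart (α * β) x₀ y = inChart α x₀ y * inChart β x₀ y :=
  map_mul _ _ _

theorem inChart_add (α β : DiffForm I X) (x₀ : X) (y : E) :
    inChart (α + β) x₀ y = inChart α x₀ y + inChart β x₀ y :=
  map_add _ _ _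

theorem inChart_sub (α β : DiffForm I X) (x₀ : X) (y : E) :
    inChart (α - β) x₀ y = inChart α x₀ y - inChart β x₀ y :=
  map_sub _ _ _

theorem uniqueDiffWithinAt_chart (x₀ : X) :
    UniqueDiffWithinAt ℝ (Set.range I) (extChartAt I x₀ x₀) :=
  I.uniqueDiffOn _ (Set.mem_range_self _)

theorem isTransgression_of_forall (h : ∀ x, TransgressionAt α β θ x) : IsTransgression α β θ := by
  refine ⟨fun x J => contDiffWithinAt_formCoeff (h x).smooth J, funext fun x => ?_⟩
  have h1 := extDerivFlat_eq_d (uniqueDiffWithinAt_chart x)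
    ((h x).smooth.differentiableWithinAt (by simp))
  exact (pullbackForm_mfderiv_inChart (β - α) x).symm.trans
    (congrArg (pullbackForm (T' := E) (mfderiv I 𝓘(ℝ, E) (extChartAt I x) x).toLinearMap)
      ((inChart_sub β α x _).trans ((h x).sub_eq.trans h1.symm)))

theorem ClosedEvenAt.mul (h : ClosedEvenAt α x₀) (h' : ClosedEvenAt β x₀) :
    ClosedEvenAt (α * β) x₀ := by
  have heq : inChart (α * β) x₀ = fun y => inChart α x₀ y * inChart β x₀ y :=
    funext fun y => inChart_mul α β x₀ y
  refine ⟨?_, ?_, ?_⟩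
  · rw [heq]
    exact h.smooth.mul h'.smooth
  · rw [heq, (formData E).d_mul _ (uniqueDiffWithinAt_chart x₀)
      (h.smooth.differentiableWithinAt (by simp)) (h'.smooth.differentiableWithinAt (by simp)),
      h.closed, h'.closed, zero_mul, mul_zero, add_zero]
  · rw [inChart_mul, map_mul, h.even, h'.even]

theorem TransgressionAt.add (h : TransgressionAt α β θ x₀) (h' : TransgressionAt β β' θ' x₀) :
    TransgressionAt α β' (θ + θ') x₀ := by
  have heq : inChart (θ + θ') x₀ = fun y => inChart θ x₀ y + inChart θ' x₀ y :=
    funext fun y => inChart_add θ θ' x₀ y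
  refine ⟨?_, ?_⟩
  · rw [heq]
    exact h.smooth.add h'.smooth
  · rw [heq, (formData E).d_add _ (uniqueDiffWithinAt_chart x₀)
      (h.smooth.differentiableWithinAt (by simp)) (h'.smooth.differentiableWithinAt (by simp)),
      ← h.sub_eq, ← h'.sub_eq, add_comm, sub_add_sub_cancel]

theorem TransgressionAt.mul_right (h : TransgressionAt α β θ x₀) {γ : DiffForm I X}
    (hγ : ClosedEvenAt γ x₀) : TransgressionAt (α * γ) (β * γ) (θ * γ) x₀ := by
  have heq : inChart (θ * γ) x₀ = fun y => inChart θ x₀ y * inChart γ x₀ y :=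
    funext fun y => inChart_mul θ γ x₀ y
  refine ⟨?_, ?_⟩
  · rw [heq]
    exact h.smooth.mul hγ.smooth
  · rw [heq, (formData E).d_mul _ (uniqueDiffWithinAt_chart x₀)
      (h.smooth.differentiableWithinAt (by simp)) (hγ.smooth.differentiableWithinAt (by simp)),
      hγ.closed, mul_zero, add_zero, ← h.sub_eq, inChart_mul, inChart_mul, sub_mul]

theorem TransgressionAt.mul_left (h : TransgressionAt α β θ x₀) {γ : DiffForm I X}
    (hγ : ClosedEvenAt γ x₀) : TransgressionAt (γ * α) (γ * β) (γ * θ) x₀ := by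
  have heq : inChart (γ * θ) x₀ = fun y => inChart γ x₀ y * inChart θ x₀ y :=
    funext fun y => inChart_mul γ θ x₀ y
  refine ⟨?_, ?_⟩
  · rw [heq]
    exact hγ.smooth.mul h.smooth
  · rw [heq, (formData E).d_mul _ (uniqueDiffWithinAt_chart x₀)
      (hγ.smooth.differentiableWithinAt (by simp)) (h.smooth.differentiableWithinAt (by simp)),
      hγ.closed, hγ.even, zero_mul, zero_add, ← h.sub_eq, inChart_mul, inChart_mul, mul_sub]

theorem inChart_mul_comm (hα : ClosedEvenAt α x₀) (β : DiffForm I X) :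
    inChart (α * β) x₀ (extChartAt I x₀ x₀) = inChart (β * α) x₀ (extChartAt I x₀ x₀) := by
  rw [inChart_mul, inChart_mul]
  exact commute_of_involute_eq hα.even _

theorem TransgressionAt.congr (h : TransgressionAt α β θ x₀)
    (hα : inChart α' x₀ (extChartAt I x₀ x₀) = inChart α x₀ (extChartAt I x₀ x₀))
    (hβ : inChart β' x₀ (extChartAt I x₀ x₀) = inChart β x₀ (extChartAt I x₀ x₀)) :
    TransgressionAt α' β' θ x₀ :=
  ⟨h.smooth, by rw [hα, hβ, h.sub_eq]⟩

/-- A family of flat forms that represents a family of forms in the chart at `x₀` gives a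
transgression form. -/
theorem transgressionAt_of_pair {ξ : ℝ → DiffForm I X} {F T : ℝ → E → FormAlg E}
    (h : TransgressionPair (formData E) (vecBasis E) (Set.range I) (extChartAt I x₀ x₀) F T)
    (hξ : ∀ᶠ y in 𝓝[Set.range I] (extChartAt I x₀ x₀), ∀ s, inChart (ξ s) x₀ y = F s y)
    (hθ : ∀ᶠ y in 𝓝[Set.range I] (extChartAt I x₀ x₀),
      ∃ (L : E ≃ₗ[ℝ] TangentSpace I ((extChartAt I x₀).symm y))
        (f : ℝ → FormAlg (TangentSpace I ((extChartAt I x₀).symm y))),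
        inChart θ x₀ y = pullbackForm L.toLinearMap (formIntegral f) ∧
        ∀ s, pullbackForm L.toLinearMap (f s) = T s y) :
    (∀ s, ClosedEvenAt (ξ s) x₀) ∧ TransgressionAt (ξ 0) (ξ 1) θ x₀ := by
  have hr : extChartAt I x₀ x₀ ∈ Set.range I := Set.mem_range_self _
  have hξ' : ∀ s, inChart (ξ s) x₀ =ᶠ[𝓝[Set.range I] (extChartAt I x₀ x₀)] F s := fun s =>
    hξ.mono fun y hy => hy s
  obtain ⟨n, g, hg⟩ := h.poly'
  have hθ' : inChart θ x₀ =ᶠ[𝓝[Set.range I] (extChartAt I x₀ x₀)]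
      fun y => ∑ k ∈ Finset.range n, ((k : ℝ) + 1)⁻¹ • g k y := by
    filter_upwards [hθ, hg.2] with y hy hTy
    obtain ⟨L, f, h1, h2⟩ := hy
    rw [h1]
    exact pullbackEquiv_formIntegral L fun s => (h2 s).trans (hTy s)
  refine ⟨fun s => ⟨?_, ?_, ?_⟩, ?_, ?_⟩
  · exact (h.poly.contDiffWithinAt hr s).congr_of_eventuallyEq_of_mem (hξ' s) hr
  · rw [(formData E).d_congr _ (hξ' s) hr, h.closed]
  · rw [(hξ' s).eq_of_nhdsWithin hr, h.even]
  · refine ContDiffWithinAt.congr_of_eventuallyEq_of_mem ?_ hθ' hr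
    exact ContDiffWithinAt.sum fun k _ => (hg.1 k).const_smul _
  · rw [(formData E).d_congr _ hθ' hr, (hξ' 0).eq_of_nhdsWithin hr,
      (hξ' 1).eq_of_nhdsWithin hr]
    exact hg.sub_eq_d (formData E) (vecBasis E) I.uniqueDiffOn hr h.deriv

end ManifoldForms

section LinearOver

variable {E : Type*} [NormedAddCommGroup E] [NormedSpace ℝ E] [FiniteDimensional ℝ E]
  {H : Type*} [TopologicalSpace H] {I : ModelWithCorners ℝ E H}
  {X : Type*} [TopologicalSpace X] [ChartedSpace H X] [IsManifold I ∞ X] [T2Space X]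

theorem isLinearOver_real {F : Type*} [NormedAddCommGroup F] [NormedSpace ℝ F]
    [FiniteDimensional ℝ F] {V : X → Type*} [TopologicalSpace (TotalSpace F V)]
    [∀ x, AddCommGroup (V x)] [∀ x, Module ℝ (V x)] [∀ x, TopologicalSpace (V x)]
    [∀ x, IsTopologicalAddGroup (V x)] [∀ x, ContinuousSMul ℝ (V x)] [FiberBundle F V]
    [VectorBundle ℝ F V] [ContMDiffVectorBundle ∞ F V I] (cov : CovariantDerivative I F V) :
    IsLinearOver ℝ cov := fun c _ _ hσ v =>
  congrArg (fun f => f v)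
    (cov.isCovariantDerivativeOn.smul_const (s := Set.univ) c hσ.mdifferentiableAt trivial)

variable {F : Type*} [NormedAddCommGroup F] [NormedSpace ℂ F] [FiniteDimensional ℂ F]
  {V : X → Type*} [TopologicalSpace (TotalSpace F V)]
  [∀ x, AddCommGroup (V x)] [∀ x, Module ℂ (V x)] [∀ x, TopologicalSpace (V x)]
  [∀ x, IsTopologicalAddGroup (V x)] [∀ x, ContinuousSMul ℝ (V x)]
  [FiberBundle F V] [VectorBundle ℂ F V] [VectorBundle ℝ F V] [ContMDiffVectorBundle ∞ F V I]

theorem isSmoothEnd_complex (c : ℂ) :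
    IsSmoothEnd ℂ I F (fun x => algebraMap ℂ (Module.End ℂ (V x)) c) := by
  intro σ hσ x
  have hx := FiberBundle.mem_baseSet_trivializationAt' (F := F) (E := V) x
  rw [(trivializationAt F V x).contMDiffAt_section_iff hx]
  have h1 := ((trivializationAt F V x).contMDiffAt_section_iff hx).1 hσ.contMDiffAt
  let ℓ : F →L[ℝ] F := LinearMap.toContinuousLinearMap ((LinearMap.lsmul ℂ F c).restrictScalars ℝ)
  refine (ℓ.contMDiff.contMDiffAt.comp x h1).congr_of_eventuallyEq ?_
  filter_upwards [(trivializationAt F V x).open_baseSet.mem_nhds hx] with z hz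
  exact ((trivializationAt F V x).linear ℂ hz).map_smul c (σ z)

theorem isLinearOver_complex {cov : CovariantDerivative I F V}
    (h : Preserves (fun _ => algebraMap ℂ (Module.End ℂ _) Complex.I) cov) :
    IsLinearOver ℂ cov := by
  have : FiniteDimensional ℝ F := FiniteDimensional.complexToReal F
  intro c σ x hσ v
  have h1 : ∀ (r : ℝ) (τ : Π x, V x), SmoothNear I F τ x →
      cov (r • τ) x v = r • cov τ x v := fun r τ hτ =>
    isLinearOver_real cov r τ x hτ v
  have hIσ : SmoothNear I F (fun z => Complex.I • σ z) x :=
    (isSmoothEnd_complex Complex.I).smoothNear hσ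
  have h2 : cov (fun z => Complex.I • σ z) x v = Complex.I • cov σ x v :=
    h.cov_apply (isSmoothEnd_complex Complex.I) hσ v
  have hr : ∀ (r : ℝ) {τ : Π x, V x}, SmoothNear I F τ x → SmoothNear I F (r • τ) x :=
    fun r τ hτ => (isSmoothEnd_complex (r : ℂ)).smoothNear hτ
  have h3 : (fun z => c • σ z) = c.re • σ + c.im • fun z => Complex.I • σ z := by
    funext z
    conv_lhs => rw [← Complex.re_add_im c, add_smul, mul_smul]
    rfl
  rw [h3, cov.isCovariantDerivativeOn.add (s := Set.univ) (hr _ hσ).mdifferentiableAt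
    (hr _ hIσ).mdifferentiableAt trivial, add_apply, h1 _ _ hσ, h1 _ _ hIσ, h2]
  conv_rhs => rw [← Complex.re_add_im c, add_smul, mul_smul]
  rfl

end LinearOver

section Frames

variable {𝕂 : Type*} [Field 𝕂] [Algebra 𝕂 ℂ] {T : Type*} [AddCommGroup T] [Module ℝ T]
  {W : Type*} [AddCommGroup W] [Module 𝕂 W] {T' : Type*} [AddCommGroup T'] [Module ℝ T']
  {W' : Type*} [AddCommGroup W'] [Module 𝕂 W']

theorem pullbackForm_exp_strace (L : T' ≃ₗ[ℝ] T) (τ : W ≃ₗ[𝕂] W') (c : ℝ)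
    (a : EndFormAlg 𝕂 T W) :
    pullbackForm L.toLinearMap (nilEval (PowerSeries.exp ℂ) ((c : ℂ) • strace a))
      = nilEval (PowerSeries.exp ℝ) (c • straceReal 𝕂 T' W' (frameEquiv L τ a)) := by
  have h := nilEval_map (PowerSeries.exp ℂ) (pullbackEquiv L).toAlgHom (pullbackEquiv L).injective
    ((c : ℂ) • strace a)
  refine h.symm.trans ?_
  rw [nilEval_exp_complex (fun _ _ => rfl), straceReal_apply, strace_frameEquiv, map_smul]
  rfl

theorem frameEquiv_nilEval {W : Type*} [AddCommGroup W] [Module ℝ W] {W' : Type*}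
    [AddCommGroup W'] [Module ℝ W'] (L : T' ≃ₗ[ℝ] T) (τ : W ≃ₗ[ℝ] W') (p : PowerSeries ℝ)
    (a : EndFormAlg ℝ T W) :
    frameEquiv L τ (nilEval p a) = realNilEval p (frameEquiv L τ a) := by
  rw [nilEval_eq_realNilEval, frameEquiv_realNilEval]

theorem frameEquiv_nilEval_exp {W : Type*} [AddCommGroup W] [Module ℂ W] {W' : Type*}
    [AddCommGroup W'] [Module ℂ W'] (L : T' ≃ₗ[ℝ] T) (τ : W ≃ₗ[ℂ] W')
    (a : EndFormAlg ℂ T W) :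
    frameEquiv L τ (nilEval (PowerSeries.exp ℂ) a)
      = realNilEval (PowerSeries.exp ℝ) (frameEquiv L τ a) := by
  rw [nilEval_exp_eq_realNilEval, frameEquiv_realNilEval]

theorem frameEquiv_sub (L : T' ≃ₗ[ℝ] T) (τ : W ≃ₗ[𝕂] W') (a b : EndFormAlg 𝕂 T W) :
    frameEquiv L τ (a - b) = frameEquiv L τ a - frameEquiv L τ b :=
  map_sub _ _ _

theorem frameEquiv_one (L : T' ≃ₗ[ℝ] T) (τ : W ≃ₗ[𝕂] W') :
    frameEquiv L τ (1 : EndFormAlg 𝕂 T W) = 1 :=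
  map_one _

end Frames

section Paths

variable {E : Type*} [NormedAddCommGroup E] [NormedSpace ℝ E] [FiniteDimensional ℝ E]
  {H : Type*} [TopologicalSpace H] {I : ModelWithCorners ℝ E H}
  {X : Type*} [TopologicalSpace X] [ChartedSpace H X] [IsManifold I ∞ X]
  {F : Type*} [NormedAddCommGroup F] [NormedSpace ℝ F]
  {V : X → Type*} [TopologicalSpace (TotalSpace F V)]
  [∀ x, AddCommGroup (V x)] [∀ x, Module ℝ (V x)] [∀ x, TopologicalSpace (V x)]
  [∀ x, IsTopologicalAddGroup (V x)] [∀ x, ContinuousSMul ℝ (V x)] [FiberBundle F V]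

theorem pathConn_zero (cov cov' : CovariantDerivative I F V) : pathConn cov cov' 0 = cov := by
  ext σ x
  simp [pathConn, CovariantDerivative.affineCombination]

theorem pathConn_one (cov cov' : CovariantDerivative I F V) : pathConn cov cov' 1 = cov' := by
  ext σ x
  simp [pathConn, CovariantDerivative.affineCombination]

end Paths

section AHat

variable {E : Type*} [NormedAddCommGroup E] [NormedSpace ℝ E] [FiniteDimensional ℝ E]
  {H : Type*} [TopologicalSpace H] {I : ModelWithCorners ℝ E H}
  {X : Type*} [TopologicalSpace X] [ChartedSpace H X] [IsManifold I ∞ X] [T2Space X]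
  {F : Type*} [NormedAddCommGroup F] [NormedSpace ℝ F] [FiniteDimensional ℝ F]
  {V : X → Type*} [TopologicalSpace (TotalSpace F V)]
  [∀ x, AddCommGroup (V x)] [∀ x, Module ℝ (V x)] [∀ x, TopologicalSpace (V x)]
  [∀ x, IsTopologicalAddGroup (V x)] [∀ x, ContinuousSMul ℝ (V x)] [FiberBundle F V]
  [VectorBundle ℝ F V] [ContMDiffVectorBundle ∞ F V I]

theorem mem_closure_interior_range (x₀ : X) :
    extChartAt I x₀ x₀ ∈ closure (interior (Set.range I)) :=
  I.range_subset_closure_interior (Set.mem_range_self _)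

theorem transgressionAt_aHat {cov cov' : CovariantDerivative I F V}
    (hcov : cov.ContMDiffCovariantDerivative ∞) (hcov' : cov'.ContMDiffCovariantDerivative ∞)
    (x₀ : X) :
    (∀ s, ClosedEvenAt (aHatForm (pathConn cov cov' s)) x₀) ∧
      TransgressionAt (aHatForm cov) (aHatForm cov') (aHatTransgression cov cov') x₀ := by
  have hS : UniqueDiffOn ℝ (Set.range I) := I.uniqueDiffOn
  have hr : extChartAt I x₀ x₀ ∈ Set.range I := Set.mem_range_self _
  have hp : PowerSeries.constantCoeff lnAHat = 0 := PowerSeries.constantCoeff_logOf (by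
    rw [PowerSeries.constantCoeff_inv, ← PowerSeries.coeff_zero_eq_constantCoeff_apply,
      sinhHalfDiv, PowerSeries.coeff_mk]
    simp)
  have hc : (1 / 2 : ℂ) = ((1 / 2 : ℝ) : ℂ) := by norm_num
  have hpair := transgressionPair_exp_tr (v := vecBasis E) (tracedForms ℝ E F)
    (connectionPath_connMatrix (𝕂 := ℝ) (x₀ := x₀) hcov hcov') hS hr
    (mem_closure_interior_range x₀) hp (1 / 2)
  have hframe := eventually_frameEquiv (𝕂 := ℝ) (x₀ := x₀) hcov hcov' (isLinearOver_real cov)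
    (isLinearOver_real cov')
  have key : ∀ (y : E) (hy : y ∈ chartDomain I F V x₀) (s : ℝ) (R : EndFormAlg ℝ E F),
      frameEquiv (chartEquiv hy.1) (fibreEquiv ℝ hy)
        (curvForm ℝ (pathConn cov cov' s) ((extChartAt I x₀).symm y)) = R →
      pullbackForm (chartEquiv hy.1).toLinearMap
        (aHatForm (pathConn cov cov' s) ((extChartAt I x₀).symm y))
      = nilEval (PowerSeries.exp ℝ) ((1 / 2 : ℝ) • straceReal ℝ E F (realNilEval lnAHat R)) := by
    rintro y hy s R rfl
    rw [aHatForm, hc, pullbackForm_exp_strace _ (fibreEquiv ℝ hy), frameEquiv_nilEval]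
  have h := transgressionAt_of_pair (ξ := fun s => aHatForm (pathConn cov cov' s))
    (θ := aHatTransgression cov cov') hpair ?_ ?_
  · simpa only [pathConn_zero, pathConn_one] using h
  · filter_upwards [hframe] with y ⟨hy, h1, _⟩ s
    rw [inChart_eq hy.1, key y hy s _ (h1 s)]
    rfl
  · filter_upwards [hframe] with y ⟨hy, h1, h2⟩
    refine ⟨chartEquiv hy.1, _, (inChart_eq hy.1 _).trans
      (congrArg _ (formIntegral_smul _ _)), fun s => ?_⟩
    rw [map_smul, map_mul, key y hy s _ (h1 s), ← strace_frameEquiv _ (fibreEquiv ℝ hy), map_mul,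
        frameEquiv_nilEval, h1, h2, hc]
    rfl

end AHat

section Chern

variable {E : Type*} [NormedAddCommGroup E] [NormedSpace ℝ E] [FiniteDimensional ℝ E]
  {H : Type*} [TopologicalSpace H] {I : ModelWithCorners ℝ E H}
  {X : Type*} [TopologicalSpace X] [ChartedSpace H X] [IsManifold I ∞ X] [T2Space X]
  {F : Type*} [NormedAddCommGroup F] [NormedSpace ℂ F] [FiniteDimensional ℂ F]
  {V : X → Type*} [TopologicalSpace (TotalSpace F V)]
  [∀ x, AddCommGroup (V x)] [∀ x, Module ℂ (V x)] [∀ x, TopologicalSpace (V x)]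
  [∀ x, IsTopologicalAddGroup (V x)] [∀ x, ContinuousSMul ℝ (V x)]
  [FiberBundle F V] [VectorBundle ℂ F V] [VectorBundle ℝ F V] [ContMDiffVectorBundle ∞ F V I]

theorem transgressionAt_chern {cov cov' : CovariantDerivative I F V}
    (hcov : cov.ContMDiffCovariantDerivative ∞) (hcov' : cov'.ContMDiffCovariantDerivative ∞)
    (hlin : Preserves (fun _ => algebraMap ℂ (Module.End ℂ _) Complex.I) cov)
    (hlin' : Preserves (fun _ => algebraMap ℂ (Module.End ℂ _) Complex.I) cov')
    {γ : Π x, Module.End ℂ (V x)} (hγ : IsSmoothEnd ℂ I F γ) (hp : Preserves γ cov)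
    (hp' : Preserves γ cov') (x₀ : X) :
    (∀ s, ClosedEvenAt (chernForm γ (pathConn cov cov' s)) x₀) ∧
      TransgressionAt (chernForm γ cov) (chernForm γ cov') (chernTransgression γ cov cov') x₀ := by
  have : FiniteDimensional ℝ F := FiniteDimensional.complexToReal F
  have : (trivializationAt F V x₀).IsLinear ℂ := inferInstance
  have h := isLinearOver_complex hlin
  have h' := isLinearOver_complex hlin'
  have hpair := transgressionPair_tr_exp (v := vecBasis E) (tracedForms ℂ E F)
    (connectionPath_connMatrix (𝕂 := ℂ) (x₀ := x₀) hcov hcov')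
    (parallelEnd_endMatrix h h' hγ hp hp') I.uniqueDiffOn (Set.mem_range_self _)
    (mem_closure_interior_range x₀)
  have hframe := eventually_frameEquiv (𝕂 := ℂ) (x₀ := x₀) hcov hcov' h h'
  have h := transgressionAt_of_pair (ξ := fun s => chernForm γ (pathConn cov cov' s))
    (θ := chernTransgression γ cov cov') hpair ?_ ?_
  · simpa only [pathConn_zero, pathConn_one] using h
  · filter_upwards [hframe] with y ⟨hy, h1, _⟩ s
    rw [inChart_eq hy.1, chernForm, ← strace_frameEquiv _ (fibreEquiv ℂ hy), map_mul,
      frameEquiv_nilEval_exp, map_neg, h1, frameEquiv_ofEnd_endMatrix]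
    rfl
  · filter_upwards [hframe] with y ⟨hy, h1, h2⟩
    refine ⟨chartEquiv hy.1, _, (inChart_eq hy.1 _).trans
      (congrArg _ (formIntegral_neg _)), fun s => ?_⟩
    rw [map_neg, ← strace_frameEquiv _ (fibreEquiv ℂ hy),
      map_mul (frameEquiv _ _), map_mul (frameEquiv _ _),
        frameEquiv_nilEval_exp, map_neg, h1, h2, frameEquiv_ofEnd_endMatrix]
    rfl

end Chern

section Normal

variable {E : Type*} [NormedAddCommGroup E] [NormedSpace ℝ E] [FiniteDimensional ℝ E]
  {H : Type*} [TopologicalSpace H] {I : ModelWithCorners ℝ E H}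
  {X : Type*} [TopologicalSpace X] [ChartedSpace H X] [IsManifold I ∞ X] [T2Space X]
  {F : Type*} [NormedAddCommGroup F] [NormedSpace ℝ F] [FiniteDimensional ℝ F]
  {V : X → Type*} [TopologicalSpace (TotalSpace F V)]
  [∀ x, AddCommGroup (V x)] [∀ x, Module ℝ (V x)] [∀ x, TopologicalSpace (V x)]
  [∀ x, IsTopologicalAddGroup (V x)] [∀ x, ContinuousSMul ℝ (V x)] [FiberBundle F V]
  [VectorBundle ℝ F V] [ContMDiffVectorBundle ∞ F V I] {x₀ : X} {y : E}
  {γ : Π x, Module.End ℝ (V x)}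

theorem det_one_sub_endMatrix (hy : y ∈ chartDomain I F V x₀) :
    LinearMap.det ((1 - endMatrix I F γ x₀ y : F →L[ℝ] F) : F →ₗ[ℝ] F)
      = LinearMap.det (1 - γ ((extChartAt I x₀).symm y)) := by
  rw [← LinearMap.det_conj (1 - γ ((extChartAt I x₀).symm y)) (fibreEquiv ℝ hy)]
  congr 1
  refine LinearMap.ext fun w => ?_
  change w - endMatrix I F γ x₀ y w = fibreEquiv ℝ hy ((fibreEquiv ℝ hy).symm w
    - γ ((extChartAt I x₀).symm y) ((fibreEquiv ℝ hy).symm w))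
  rw [endMatrix_apply hy, map_sub, LinearEquiv.apply_symm_apply]

theorem ofEnd_one_sub (hy : y ∈ chartDomain I F V x₀) :
    frameEquiv (chartEquiv hy.1) (fibreEquiv ℝ hy) (ofEnd (1 - γ ((extChartAt I x₀).symm y)))
      = 1 - endFormL ℝ E F (endMatrix I F γ x₀ y) := by
  have h : (ofEnd (1 - γ ((extChartAt I x₀).symm y)) :
      EndFormAlg ℝ (TangentSpace I ((extChartAt I x₀).symm y)) (V ((extChartAt I x₀).symm y)))
      = 1 - ofEnd (γ ((extChartAt I x₀).symm y)) := TensorProduct.tmul_sub _ _ _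
  rw [h, frameEquiv_sub, frameEquiv_one, frameEquiv_ofEnd_endMatrix]

theorem isUnit_ofEnd {T W : Type*} [AddCommGroup T] [Module ℝ T] [AddCommGroup W] [Module ℝ W]
    {a : Module.End ℝ W} (ha : IsUnit a) : IsUnit (ofEnd a : EndFormAlg ℝ T W) :=
  ha.map (Algebra.TensorProduct.includeRight : Module.End ℝ W →ₐ[ℝ] EndFormAlg ℝ T W)

theorem isUnit_one_sub_endMatrix (hy : y ∈ chartDomain I F V x₀)
    (hdet : 0 < LinearMap.det (1 - γ ((extChartAt I x₀).symm y))) :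
    IsUnit (1 - endFormL ℝ E F (endMatrix I F γ x₀ y)) := by
  have : FiniteDimensional ℝ (V ((extChartAt I x₀).symm y)) :=
    (fibreEquiv ℝ hy).symm.finiteDimensional
  rw [← ofEnd_one_sub hy]
  exact (isUnit_ofEnd ((LinearMap.isUnit_iff_isUnit_det _).2 hdet.ne'.isUnit)).map
    (frameEquiv (chartEquiv hy.1) (fibreEquiv ℝ hy))

theorem frameEquiv_normalF (cov : CovariantDerivative I F V) (hy : y ∈ chartDomain I F V x₀)
    {R : EndFormAlg ℝ E F} (hR : frameEquiv (chartEquiv hy.1) (fibreEquiv ℝ hy)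
      (curvForm ℝ cov ((extChartAt I x₀).symm y)) = R) :
    frameEquiv (chartEquiv hy.1) (fibreEquiv ℝ hy) (normalF γ cov ((extChartAt I x₀).symm y))
      = 1 - endFormL ℝ E F (endMatrix I F γ x₀ y) * realNilEval (PowerSeries.exp ℝ) (-R) := by
  rw [normalF, frameEquiv_sub, frameEquiv_one, map_mul, frameEquiv_nilEval, map_neg,
    frameEquiv_ofEnd_endMatrix, hR]

theorem pullbackForm_normalForm (cov : CovariantDerivative I F V) (hy : y ∈ chartDomain I F V x₀)
    {R : EndFormAlg ℝ E F} (hR : frameEquiv (chartEquiv hy.1) (fibreEquiv ℝ hy)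
      (curvForm ℝ cov ((extChartAt I x₀).symm y)) = R) :
    pullbackForm (chartEquiv hy.1).toLinearMap (normalForm γ cov ((extChartAt I x₀).symm y))
      = (Real.sqrt (LinearMap.det ((1 - endMatrix I F γ x₀ y : F →L[ℝ] F) : F →ₗ[ℝ] F)))⁻¹ •
        nilEval (PowerSeries.exp ℝ) ((-1 / 2 : ℝ) • straceReal ℝ E F
          (realNilEval (PowerSeries.log ℝ)
            (Ring.inverse (1 - endFormL ℝ E F (endMatrix I F γ x₀ y)) *
            (1 - endFormL ℝ E F (endMatrix I F γ x₀ y) * realNilEval (PowerSeries.exp ℝ) (-R))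
            - 1))) := by
  have hc : (-1 / 2 : ℂ) = ((-1 / 2 : ℝ) : ℂ) := by norm_num
  rw [normalForm, hc, map_smul (pullbackForm _), pullbackForm_exp_strace _ (fibreEquiv ℝ hy),
    frameEquiv_nilEval, frameEquiv_sub, frameEquiv_one, map_mul, frameEquiv_inverse,
    ofEnd_one_sub, frameEquiv_normalF cov hy hR, det_one_sub_endMatrix hy, ← Complex.ofReal_inv]
  rfl

theorem transgressionAt_normal {cov cov' : CovariantDerivative I F V}
    (hcov : cov.ContMDiffCovariantDerivative ∞) (hcov' : cov'.ContMDiffCovariantDerivative ∞)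
    (hγ : IsSmoothEnd ℝ I F γ) (hp : Preserves γ cov) (hp' : Preserves γ cov')
    (hdet : ∀ x, 0 < LinearMap.det (1 - γ x)) (x₀ : X) :
    (∀ s, ClosedEvenAt (normalForm γ (pathConn cov cov' s)) x₀) ∧
      TransgressionAt (normalForm γ cov) (normalForm γ cov')
        (normalTransgression γ cov cov') x₀ := by
  have hr : extChartAt I x₀ x₀ ∈ Set.range I := Set.mem_range_self _
  have hc : (-1 / 2 : ℂ) = ((-1 / 2 : ℝ) : ℂ) := by norm_num
  have h := isLinearOver_real cov
  have h' := isLinearOver_real cov'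
  have hy₀ := mem_chartDomain_self (I := I) (F := F) (V := V) (x₀ := x₀)
  have hdet₀ := hdet ((extChartAt I x₀).symm (extChartAt I x₀ x₀))
  rw [← det_one_sub_endMatrix hy₀] at hdet₀
  have hγ' := contDiffWithinAt_endMatrix hγ hy₀
  have hκ' := fderivWithin_inv_sqrt_det (uniqueDiffWithinAt_chart x₀)
    (hγ'.differentiableWithinAt (by simp)) hdet₀
    (A := fun v => connMatrix cov x₀ (extChartAt I x₀ x₀) v) fun v => by
      ext w
      have h1 := fderivWithin_endMatrix hγ hp hy₀ v w
      change _ = endMatrix I F γ x₀ _ (connMatrix cov x₀ _ v w)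
        - connMatrix cov x₀ _ v (endMatrix I F γ x₀ _ w)
      rw [eq_sub_iff_add_eq, ← sub_eq_zero, h1]
  have hunit : ∀ᶠ z in 𝓝[Set.range I] (extChartAt I x₀ x₀),
      IsUnit (1 - endFormL ℝ E F (endMatrix I F γ x₀ z)) := by
    filter_upwards [chartDomain_mem_nhdsWithin hy₀] with z hz
    exact isUnit_one_sub_endMatrix hz (hdet _)
  have hpair := transgressionPair_exp_tr_log (v := vecBasis E) (tracedForms ℝ E F)
    (connectionPath_connMatrix (𝕂 := ℝ) (x₀ := x₀) hcov hcov')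
    (parallelEnd_endMatrix h h' hγ hp hp') I.uniqueDiffOn hr
    (mem_closure_interior_range x₀) hunit (-1 / 2) (contDiffWithinAt_inv_sqrt_det hγ' hdet₀) hκ'
    (fun _ _ => rfl)
  have hframe := eventually_frameEquiv (𝕂 := ℝ) (x₀ := x₀) hcov hcov' h h'
  have h := transgressionAt_of_pair (ξ := fun s => normalForm γ (pathConn cov cov' s))
    (θ := normalTransgression γ cov cov') hpair ?_ ?_
  · simpa only [pathConn_zero, pathConn_one] using h
  · filter_upwards [hframe] with y ⟨hy, h1, _⟩ s
    rw [inChart_eq hy.1, pullbackForm_normalForm _ hy (h1 s)]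
    rfl
  · filter_upwards [hframe] with y ⟨hy, h1, h2⟩
    refine ⟨chartEquiv hy.1, _, (inChart_eq hy.1 _).trans
      (congrArg _ (formIntegral_smul _ _)), fun s => ?_⟩
    rw [map_smul (pullbackForm _), map_mul (pullbackForm _), pullbackForm_normalForm _ hy (h1 s),
      ← strace_frameEquiv _ (fibreEquiv ℝ hy), map_mul (frameEquiv _ _), map_mul (frameEquiv _ _),
      frameEquiv_sub, frameEquiv_one, frameEquiv_inverse, frameEquiv_normalF _ hy (h1 s), h2, hc]
    rfl

end Normal

end

end EquivariantTransgression

open EquivariantTransgression in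
theorem lemma5p9
    -- the base: a smooth manifold with (possibly empty) boundary
    {E : Type*} [NormedAddCommGroup E] [NormedSpace ℝ E] [FiniteDimensional ℝ E]
    {H : Type*} [TopologicalSpace H] {I : ModelWithCorners ℝ E H}
    {X : Type*} [TopologicalSpace X] [ChartedSpace H X] [IsManifold I ∞ X] [T2Space X]
    -- a smooth real vector bundle `N`
    {FN : Type*} [NormedAddCommGroup FN] [NormedSpace ℝ FN] [FiniteDimensional ℝ FN]
    {N : X → Type*} [TopologicalSpace (TotalSpace FN N)]
    [∀ x, AddCommGroup (N x)] [∀ x, Module ℝ (N x)] [∀ x, TopologicalSpace (N x)]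
    [∀ x, IsTopologicalAddGroup (N x)] [∀ x, ContinuousSMul ℝ (N x)]
    [FiberBundle FN N] [VectorBundle ℝ FN N] [ContMDiffVectorBundle ∞ FN N I]
    -- a smooth complex vector bundle `S`
    {FS : Type*} [NormedAddCommGroup FS] [NormedSpace ℂ FS] [FiniteDimensional ℂ FS]
    {S : X → Type*} [TopologicalSpace (TotalSpace FS S)]
    [∀ x, AddCommGroup (S x)] [∀ x, Module ℂ (S x)] [∀ x, TopologicalSpace (S x)]
    [∀ x, IsTopologicalAddGroup (S x)] [∀ x, ContinuousSMul ℝ (S x)]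
    [FiberBundle FS S] [VectorBundle ℂ FS S] [VectorBundle ℝ FS S]
    [ContMDiffVectorBundle ∞ FS S I]
    -- the smooth connections on `TX`, on `N` and on `S`; those on `S` are complex linear
    (cov cov' : CovariantDerivative I E (TangentSpace I : X → Type _))
    (hcov : cov.ContMDiffCovariantDerivative ∞) (hcov' : cov'.ContMDiffCovariantDerivative ∞)
    (covN covN' : CovariantDerivative I FN N)
    (hcovN : covN.ContMDiffCovariantDerivative ∞) (hcovN' : covN'.ContMDiffCovariantDerivative ∞)
    (covS covS' : CovariantDerivative I FS S)
    (hcovS : covS.ContMDiffCovariantDerivative ∞) (hcovS' : covS'.ContMDiffCovariantDerivative ∞)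
    (hlin : Preserves (fun _ => algebraMap ℂ (Module.End ℂ _) Complex.I) covS)
    (hlin' : Preserves (fun _ => algebraMap ℂ (Module.End ℂ _) Complex.I) covS')
    -- the actions of the group element on `N` and `S`: smooth and preserving the connections
    (γN : Π x, Module.End ℝ (N x)) (hγN : IsSmoothEnd ℝ I FN γN)
    (hγNcov : Preserves γN covN) (hγNcov' : Preserves γN covN')
    (hdet : ∀ x, 0 < LinearMap.det (1 - γN x))
    (γS : Π x, Module.End ℂ (S x)) (hγS : IsSmoothEnd ℂ I FS γS)
    (hγScov : Preserves γS covS) (hγScov' : Preserves γS covS') :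
    IsTransgression (normalForm γN covN) (normalForm γN covN')
      (normalTransgression γN covN covN') ∧
    IsTransgression (aHatForm cov) (aHatForm cov') (aHatTransgression cov cov') ∧
    IsTransgression (chernForm γS covS) (chernForm γS covS')
      (chernTransgression γS covS covS') ∧
    IsTransgression (integrand γN γS cov covN covS) (integrand γN γS cov' covN' covS')
      (integrandTransgression γN γS cov cov' covN covN' covS covS') := by
  have hN := transgressionAt_normal hcovN hcovN' hγN hγNcov hγNcov' hdet
  have hA := transgressionAt_aHat hcov hcov'
  have hC := transgressionAt_chern hcovS hcovS' hlin hlin' hγS hγScov hγScov'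
  refine ⟨isTransgression_of_forall fun x => (hN x).2, isTransgression_of_forall fun x => (hA x).2,
    isTransgression_of_forall fun x => (hC x).2, isTransgression_of_forall fun x => ?_⟩
  have hN₀ : ClosedEvenAt (normalForm γN covN) x := pathConn_zero covN covN' ▸ (hN x).1 0
  have hN₁ : ClosedEvenAt (normalForm γN covN') x := pathConn_one covN covN' ▸ (hN x).1 1
  have hA₀ : ClosedEvenAt (aHatForm cov) x := pathConn_zero cov cov' ▸ (hA x).1 0
  have hA₁ : ClosedEvenAt (aHatForm cov') x := pathConn_one cov cov' ▸ (hA x).1 1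
  have hC₁ : ClosedEvenAt (chernForm γS covS') x := pathConn_one covS covS' ▸ (hC x).1 1
  have h := ((hC x).2.mul_left (hN₀.mul hA₀)).add
    ((((hA x).2.mul_left hN₀).mul_right hC₁).add (((hN x).2.mul_right hA₁).mul_right hC₁))
  rw [add_comm, add_comm (normalForm γN covN * _ * _)] at h
  refine h.congr ?_ ?_
  · rw [mul_assoc (normalForm γN covN)]
    exact (inChart_mul_comm hN₀ _).symm
  · rw [mul_assoc (normalForm γN covN')]
    exact (inChart_mul_comm hN₁ _).symm
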